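/- Let $1<\alpha<2$, $\beta=\alpha/2$, $T,L>0$, $\Omega=[0,L]$, and let $a_0,a_1,f\in L^2(\Omega)$. Write $\omega_\delta(t)=t^{\delta-1}/\Gamma(\delta)$ and $\partial_t^\beta\psi(t)=\int_0^t\omega_{1-\beta}(t-s)\psi'(s)\,ds$ (Caputo derivative). Let $\lambda_k=(k\pi/L)^2$, $\varphi_k(x)=\sqrt{2/L}\,\sin(k\pi x/L)$, $k\ge1$, be the Dirichlet eigensystem of $-\Delta=-\partial_{xx}$ on $\Omega$, and $D((-\Delta)^\gamma)=\{\psi\in L^2(\Omega):\sum_k|\lambda_k^\gamma(\psi,\varphi_k)|^2<\infty\}$. **Reduced system.** $(u,v)$ solves $$\partial_t^\beta v-u_{xx}=a_1\,\omega_{2-\alpha}(t)+t^{1-\alpha}f,\qquad v=\partial_t^\beta u\quad\text{in }\Omega\times(0,T),$$ with $u(0)=a_0$, $v(0)=0$, and $u=v=0$ on $\partial\Omega\times(0,T)$. Here $u,v:[0,T]\to L^2(\Omega)$ are continuous, and continuously differentiable on $(0,T)$ with integrable derivative; for $t\in(0,T)$, $u(t)\in H^2(\Omega)\cap H^1_0(\Omega)$,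 $v(t)\in H_0^1(\Omega)$, and the equations hold in $L^2(\Omega)$. **Scheme.** For $r\ge1$ and an integer $N\ge1$ let $t_k=T(k/N)^r$ ($0\le k\le N$), $\tau_k=t_k-t_{k-1}$, $\rho_k=\tau_k/\tau_{k+1}$. For $\theta\in[0,1)$ put $t_{n-\theta}=\theta t_{n-1}+(1-\theta)t_n$ and $W^{n-\theta}=\theta W^{n-1}+(1-\theta)W^n$, and $$(\bar\partial_t^\beta W)^{n-\theta}=\sum_{k=1}^nA^{(n)}_{n-k}(W^k-W^{k-1}).$$ - $L1$: $\theta=0$ and $A^{(n)}_{n-k}=\frac1{\tau_k}\int_{t_{k-1}}^{t_k}\omega_{1-\beta}(t_n-s)\,ds$. - $L2$-$1_\sigma$ (Alikhanov): $\theta=\beta/2$ and $A^{(n)}_{n-k}=a^{(n)}_{n-k}+\rho_{k-1}b^{(n)}_{n-k+1}-b^{(n)}_{n-k}$, where the second term is omitted for $k=1$ and the third for $k=n$. Here $a^{(n)}_{0}=\frac1{\tau_n}\int_{t_{n-1}}^{t_{n-\theta}}\omega_{1-\beta}(t_{n-\theta}-s)\,ds$, and for $1\le k\le n-1$ $$a^{(n)}_{n-k}=\frac1{\tau_k}\int_{t_{k-1}}^{t_k}\omega_{1-\beta}(t_{n-\theta}-s)\,ds,\qquad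 b^{(n)}_{n-k}=\frac{2}{\tau_k(\tau_k+\tau_{k+1})}\int_{t_{k-1}}^{t_k}\Bigl(s-\frac{t_{k-1}+t_k}2\Bigr)\omega_{1-\beta}(t_{n-\theta}-s)\,ds.$$ The time semi-discrete scheme asks for $U^n,V^n\in L^2(\Omega)$, $0\le n\le N$, with $U^0=a_0$, $V^0=0$ and, for $1\le n\le N$, $U^n,V^n\in H^1_0(\Omega)$, $U^{n-\theta}\in H^2(\Omega)$ and $$(\bar\partial_t^\beta V)^{n-\theta}-\Delta U^{n-\theta}=a_1\,\omega_{2-\alpha}(t_{n-\theta})+t_{n-\theta}^{1-\alpha}f,\qquad V^{n-\theta}=(\bar\partial_t^\beta U)^{n-\theta}.$$ **Regularity assumptions**, for some $\gamma_1\in(\frac1\alpha+\frac14,\frac32]$, $\gamma_2\in(\frac14,1]$, $\epsilon>0$: - (B1) $a_0\in D((-\Delta)^{\gamma_1+\epsilon})$ and $a_1,f\in D((-\Delta)^{\gamma_2+\epsilon})$; - (B2) $a_0\in D((-\Delta)^{\gamma_1+\epsilon+\frac12})$ and $a_1,f\in D((-\Delta)^{\gamma_2+\epsilon+\frac12})$.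 **Theorem.** Assume (B1) if $\theta=0$ ($L1$), or (B2) if $\theta=\beta/2$ ($L2$-$1_\sigma$), and let $r\ge1$. Then there is a constant $C>0$, independent of $N$ and $n$, such that for every solution $(u,v)$ of the reduced system, every $N\ge1$ (no restriction on the step sizes), every solution $(U^n,V^n)$ of the scheme and all $1\le n\le N$, the errors $\bar u^n=u(t_n)-U^n$, $\bar v^n=v(t_n)-V^n$ have $\nabla\bar u^n\in L^2(\Omega)$ and satisfy $$\|\bar v^n\|_{L^2}+\|\nabla\bar u^n\|_{L^2}\le\begin{cases}C\bigl(N^{-\min\{r(1-\beta),2-\beta\}}+N^{-\min\{r(1-\beta/2),2-\beta\}}\bigr),&\theta=0,\\ C\bigl(N^{-\min\{r(1-\beta),2\}}+N^{-\min\{r(1-\beta/2),2\}}\bigr),&\theta=\beta/2.\end{cases}$$ In particular the error is at most $CN^{-(2-\beta)}$ for $L1$ with $r=\frac{4-\alpha}{2-\alpha}$, and at most $CN^{-2}$ for $L2$-$1_\sigma$ with $r=\frac4{2-\alpha}$. These are the least $r\ge1$ for which both exponents in the corresponding bound equal $2-\beta$, respectively $2$. -/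

import Mathlib

noncomputable section

namespace SFOR

open MeasureTheory Set

/-! ### The spatial domain `Ω = [0, L]`, weak derivatives and boundary values -/

/-- The real Hilbert space `L²(Ω)`, `Ω = [0, L]` (the two end points are a null set). -/
abbrev L2 (L : ℝ) : Type := Lp ℝ 2 (volume.restrict (Ioo (0 : ℝ) L))

/-- `g ∈ L²(Ω)` is the weak derivative of `w ∈ L²(Ω)`:
`∫ w φ' = - ∫ g φ` for all `φ ∈ C_c^∞((0, L))`. -/
def HasWeakDeriv (L : ℝ) (w g : L2 L) : Prop :=
  ∀ φ : ℝ → ℝ, ContDiff ℝ ((⊤ : ℕ∞) : WithTop ℕ∞) φ → HasCompactSupport φ →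
    tsupport φ ⊆ Ioo (0 : ℝ) L →
      ∫ x in Ioo (0 : ℝ) L, w x * deriv φ x = - ∫ x in Ioo (0 : ℝ) L, g x * φ x

/-- `h ∈ L²(Ω)` is the weak Laplacian `Δ w = w_xx` of `w`, and `w ∈ H²(Ω)`. -/
def HasWeakLaplacian (L : ℝ) (w h : L2 L) : Prop :=
  ∃ g : L2 L, HasWeakDeriv L w g ∧ HasWeakDeriv L g h

/-- `w ∈ H¹₀(Ω)`: `w` has a weak derivative in `L²(Ω)`, and its continuous representative on
`[0, L]` vanishes at both end points. -/
def MemH10 (L : ℝ) (w : L2 L) : Prop :=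
  (∃ g : L2 L, HasWeakDeriv L w g) ∧
    ∃ c : ℝ → ℝ, ContinuousOn c (Icc 0 L) ∧ c 0 = 0 ∧ c L = 0 ∧
      (w : ℝ → ℝ) =ᵐ[volume.restrict (Ioo (0 : ℝ) L)] c

/-! ### Fractional powers of the Dirichlet Laplacian -/

/-- The Dirichlet eigenvalues `(k π / L)²`, `k = 1, 2, …`; the argument `j` stands for
`k = j + 1`. -/
def dirichletEigenvalue (L : ℝ) (j : ℕ) : ℝ := (((j : ℝ) + 1) * Real.pi / L) ^ 2

/-- The `L²(Ω)`-normalized Dirichlet eigenfunctions `√(2 / L) sin (k π x / L)`, `k = j + 1`. -/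
def dirichletEigenfunction (L : ℝ) (j : ℕ) (x : ℝ) : ℝ :=
  Real.sqrt (2 / L) * Real.sin (((j : ℝ) + 1) * Real.pi * x / L)

/-- The coefficient `(ψ, φ_k)` of `ψ` in the orthonormal basis of eigenfunctions. -/
def eigenCoeff (L : ℝ) (ψ : L2 L) (j : ℕ) : ℝ :=
  ∫ x in Ioo (0 : ℝ) L, ψ x * dirichletEigenfunction L j x

/-- The domain `D((-Δ)^γ) = {ψ ∈ L²(Ω) : ∑ |λ_k^γ (ψ, φ_k)|² < ∞}`. -/
def fracDomain (L γ : ℝ) : Set (L2 L) :=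
  {ψ | Summable fun j : ℕ => (dirichletEigenvalue L j ^ γ * eigenCoeff L ψ j) ^ 2}

/-- The regularity assumption on the data, with a shift `s` of the exponents:
`a₀ ∈ D((-Δ)^(γ₁ + ε + s))`, `a₁, f ∈ D((-Δ)^(γ₂ + ε + s))` for some
`γ₁ ∈ (1/α + 1/4, 3/2]`, `γ₂ ∈ (1/4, 1]` and `ε > 0`. -/
def DataRegularity (α L s : ℝ) (a₀ a₁ f : L2 L) : Prop :=
  ∃ γ₁ ∈ Ioc (1 / α + 1 / 4) (3 / 2), ∃ γ₂ ∈ Ioc (1 / 4 : ℝ) 1, ∃ ε > 0,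
    a₀ ∈ fracDomain L (γ₁ + ε + s) ∧ a₁ ∈ fracDomain L (γ₂ + ε + s) ∧
      f ∈ fracDomain L (γ₂ + ε + s)

/-- Assumption B1 (for the `L1` scheme). -/
def AssumptionB1 (α L : ℝ) (a₀ a₁ f : L2 L) : Prop := DataRegularity α L 0 a₀ a₁ f

/-- Assumption B2 (for the `L2-1_σ` scheme). -/
def AssumptionB2 (α L : ℝ) (a₀ a₁ f : L2 L) : Prop := DataRegularity α L (1 / 2) a₀ a₁ f

/-! ### The Caputo derivative and the reduced system -/

/-- The kernel `ω_δ(t) = t^(δ-1) / Γ(δ)`. -/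
def omega (δ t : ℝ) : ℝ := t ^ (δ - 1) / Real.Gamma δ

/-- The Caputo derivative of order `β ∈ (0, 1)`,
`(∂_t^β ψ)(t) = ∫₀ᵗ ω_{1-β}(t - s) ψ'(s) ds`, of a function with values in `L²(Ω)`. -/
def caputo {L : ℝ} (β : ℝ) (ψ : ℝ → L2 L) (t : ℝ) : L2 L :=
  ∫ s in (0 : ℝ)..t, omega (1 - β) (t - s) • deriv ψ s

/-- The right-hand side `a₁(x) ω_{2-α}(t) + g(x, t)` with the singular source
`g(x, t) = t^(1-α) f(x)`. -/
def source {L : ℝ} (α : ℝ) (a₁ f : L2 L) (t : ℝ) : L2 L :=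
  omega (2 - α) t • a₁ + t ^ (1 - α) • f

/-- Continuous on `[0, T]`, continuously differentiable on `(0, T)` with integrable derivative:
the functions of time for which the Caputo derivative makes sense on all of `(0, T)`. -/
structure TimeRegular {L : ℝ} (T : ℝ) (ψ : ℝ → L2 L) : Prop where
  continuousOn : ContinuousOn ψ (Icc 0 T)
  contDiffOn : ContDiffOn ℝ 1 ψ (Ioo 0 T)
  integrableOn : IntegrableOn (deriv ψ) (Ioo 0 T)

/-- `(u, v)` is a (strong) solution of the reduced system, with `β = α / 2`:
`∂_t^β v - u_xx = a₁ ω_{2-α}(t) + t^(1-α) f` and `v = ∂_t^β u` in `Ω × (0, T)`,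
`u(0) = a₀`, `v(0) = 0`, and `u = v = 0` on `∂Ω × (0, T)`. -/
structure IsReducedSolution {L : ℝ} (α T : ℝ) (a₀ a₁ f : L2 L) (u v : ℝ → L2 L) : Prop where
  regular_u : TimeRegular T u
  regular_v : TimeRegular T v
  initial_u : u 0 = a₀
  initial_v : v 0 = 0
  boundary_u : ∀ t ∈ Ioo 0 T, MemH10 L (u t)
  boundary_v : ∀ t ∈ Ioo 0 T, MemH10 L (v t)
  equation_v : ∀ t ∈ Ioo 0 T, ∃ h : L2 L, HasWeakLaplacian L (u t) h ∧
    caputo (α / 2) v t - h = source α a₁ f t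
  equation_u : ∀ t ∈ Ioo 0 T, v t = caputo (α / 2) u t

/-! ### Graded meshes and discrete Caputo derivatives

Here `t : ℕ → ℝ` is a mesh, and `A n k` stands for `A_{n-k}^{(n)}`, `1 ≤ k ≤ n`; likewise for the
coefficients `a_{n-k}^{(n)}` and `b_{n-k}^{(n)}`. -/

/-- The graded mesh `t_k = T (k / N)^r`. -/
def gradedMesh (T r : ℝ) (N k : ℕ) : ℝ := T * ((k : ℝ) / N) ^ r

/-- The step size `τ_k = t_k - t_{k-1}` (for `k ≥ 1`). -/
def stepSize (t : ℕ → ℝ) (k : ℕ) : ℝ := t k - t (k - 1)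

/-- The step ratio `ρ_k = τ_k / τ_{k+1}` (for `k ≥ 1`). -/
def stepRatio (t : ℕ → ℝ) (k : ℕ) : ℝ := stepSize t k / stepSize t (k + 1)

/-- The off-set time point `t_{n-θ} = θ t_{n-1} + (1 - θ) t_n` (for `n ≥ 1`). -/
def offsetTime (θ : ℝ) (t : ℕ → ℝ) (n : ℕ) : ℝ := θ * t (n - 1) + (1 - θ) * t n

/-- The grid function `W^{n-θ} = θ W^{n-1} + (1 - θ) W^n` (for `n ≥ 1`). -/
def offsetValue {L : ℝ} (θ : ℝ) (W : ℕ → L2 L) (n : ℕ) : L2 L :=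
  θ • W (n - 1) + (1 - θ) • W n

/-- The kernels of the nonuniform `L1` formula,
`A_{n-k}^{(n)} = (1 / τ_k) ∫_{t_{k-1}}^{t_k} ω_{1-β}(t_n - s) ds`. -/
def kernelL1 (β : ℝ) (t : ℕ → ℝ) (n k : ℕ) : ℝ :=
  (1 / stepSize t k) * ∫ s in (t (k - 1))..(t k), omega (1 - β) (t n - s)

/-- The coefficients `a_{n-k}^{(n)}` of the Alikhanov formula with off-set `θ`: the integral
runs over `[t_{k-1}, t_k]` for `k ≤ n - 1`, and over `[t_{n-1}, t_{n-θ}]` for `k = n`. -/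
def alikhanovA (β θ : ℝ) (t : ℕ → ℝ) (n k : ℕ) : ℝ :=
  (1 / stepSize t k) *
    ∫ s in (t (k - 1))..(if k = n then offsetTime θ t n else t k),
      omega (1 - β) (offsetTime θ t n - s)

/-- The coefficients `b_{n-k}^{(n)}` of the Alikhanov formula, `1 ≤ k ≤ n - 1`; here
`t_{k-1/2} = (t_{k-1} + t_k) / 2`. -/
def alikhanovB (β θ : ℝ) (t : ℕ → ℝ) (n k : ℕ) : ℝ :=
  (2 / (stepSize t k * (stepSize t k + stepSize t (k + 1)))) *
    ∫ s in (t (k - 1))..(t k),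
      (s - (t (k - 1) + t k) / 2) * omega (1 - β) (offsetTime θ t n - s)

/-- The kernels of the nonuniform Alikhanov (`L2-1_σ`) formula: `A_{n-k}^{(n)}` is `a_{n-k}^{(n)}`,
plus `ρ_{k-1} b_{n-k+1}^{(n)}` if `k ≥ 2`, minus `b_{n-k}^{(n)}` if `k ≤ n - 1`. -/
def kernelAlikhanov (β θ : ℝ) (t : ℕ → ℝ) (n k : ℕ) : ℝ :=
  alikhanovA β θ t n k
    + (if 2 ≤ k then stepRatio t (k - 1) * alikhanovB β θ t n (k - 1) else 0)
    - (if k < n then alikhanovB β θ t n k else 0)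

/-- The discrete Caputo derivative `∑_{k=1}^n A_{n-k}^{(n)} (W^k - W^{k-1})` at `t_{n-θ}`. -/
def discreteCaputo {L : ℝ} (A : ℕ → ℕ → ℝ) (W : ℕ → L2 L) (n : ℕ) : L2 L :=
  ∑ k ∈ Finset.Icc 1 n, A n k • (W k - W (k - 1))

/-! ### The time semi-discrete scheme -/

/-- `(Uⁿ, Vⁿ)`, `0 ≤ n ≤ N`, solves the time semi-discrete scheme with kernels `A` and
off-set `θ` on the mesh `t_0 < … < t_N`. -/
structure IsSchemeSolution {L : ℝ} (α θ : ℝ) (A : ℕ → ℕ → ℝ) (t : ℕ → ℝ) (N : ℕ)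
    (a₀ a₁ f : L2 L) (U V : ℕ → L2 L) : Prop where
  initial_U : U 0 = a₀
  initial_V : V 0 = 0
  boundary_U : ∀ n, 1 ≤ n → n ≤ N → MemH10 L (U n)
  boundary_V : ∀ n, 1 ≤ n → n ≤ N → MemH10 L (V n)
  equation_V : ∀ n, 1 ≤ n → n ≤ N → ∃ h : L2 L, HasWeakLaplacian L (offsetValue θ U n) h ∧
    discreteCaputo A V n - h = source α a₁ f (offsetTime θ t n)
  equation_U : ∀ n, 1 ≤ n → n ≤ N → offsetValue θ V n = discreteCaputo A U n

/-- `‖v(t_n) - Vⁿ‖ + ‖∇(u(t_n) - Uⁿ)‖ ≤ C · rate N` for `1 ≤ n ≤ N`, with a constant `C` that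
depends neither on `N` nor on `n`, for the scheme with off-set `θ` and kernels `A` (a function of
the mesh) on the graded meshes with exponent `r`. The existence of the (unique) weak gradient
`g` of `u(t_n) - Uⁿ` in `L²(Ω)` is part of the claim. There is no restriction on `N`. -/
def ConvergesWithRate {L : ℝ} (α T θ r : ℝ) (A : (ℕ → ℝ) → ℕ → ℕ → ℝ) (a₀ a₁ f : L2 L)
    (rate : ℕ → ℝ) : Prop :=
  ∃ C : ℝ, 0 < C ∧
    ∀ u v : ℝ → L2 L, IsReducedSolution α T a₀ a₁ f u v →
    ∀ N : ℕ, 1 ≤ N →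
    ∀ U V : ℕ → L2 L,
      IsSchemeSolution α θ (A (gradedMesh T r N)) (gradedMesh T r N) N a₀ a₁ f U V →
    ∀ n : ℕ, 1 ≤ n → n ≤ N →
      ∃ g : L2 L, HasWeakDeriv L (u (gradedMesh T r N n) - U n) g ∧
        ‖v (gradedMesh T r N n) - V n‖ + ‖g‖ ≤ C * rate N

end SFOR

end

noncomputable section

namespace SFOR
open MeasureTheory Set

/-! ### Discrete energy stability -/

theorem sum_mul_sub_eq {E : Type*} [AddCommGroup E] [Module ℝ E] (b : ℕ → ℝ) (hb : b 0 = 0)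
    (f : ℕ → E) (m : ℕ) :
    ∑ i ∈ Finset.range m, b (i + 1) • (f (i + 1) - f i) =
      ∑ i ∈ Finset.range m, (b (i + 1) - b i) • (f m - f i) := by
  induction m with
  | zero => simp
  | succ m ih =>
    have h : ∑ i ∈ Finset.range m, (b (i + 1) - b i) • (f (m + 1) - f i) =
        ∑ i ∈ Finset.range m, (b (i + 1) - b i) • (f m - f i) + b m • (f (m + 1) - f m) := by
      have h2 : b m = ∑ i ∈ Finset.range m, (b (i + 1) - b i) := by
        rw [Finset.sum_range_sub, hb, sub_zero]
      rw [h2, Finset.sum_smul, ← Finset.sum_add_distrib]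
      refine Finset.sum_congr rfl fun i _ => ?_
      rw [← smul_add]; congr 1; abel
    rw [Finset.sum_range_succ, Finset.sum_range_succ, ih, h, sub_smul]
    abel

/-- The energy inequality for an off-set discrete fractional derivative. -/
theorem energy_inequality (b : ℕ → ℝ) (hb : b 0 = 0) (θ : ℝ) (y : ℕ → ℂ) (m : ℕ)
    (hmono : ∀ k ≤ m, b k ≤ b (k + 1)) (hθ0 : 0 ≤ θ)
    (hθ1 : θ ≤ 1) (hθ : (1 - θ) * b m ≤ (1 - 2 * θ) * b (m + 1)) :
    ∑ i ∈ Finset.range (m + 1), b (i + 1) * (‖y (i + 1)‖ ^ 2 - ‖y i‖ ^ 2) ≤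
      2 * inner ℝ (θ • y m + (1 - θ) • y (m + 1))
        (∑ i ∈ Finset.range (m + 1), b (i + 1) • (y (i + 1) - y i)) := by
  have h1 := sum_mul_sub_eq b hb (fun i => ‖y i‖ ^ 2) (m + 1)
  simp only [smul_eq_mul] at h1
  rw [h1, sum_mul_sub_eq b hb y (m + 1), inner_sum, Finset.mul_sum]
  simp only [inner_smul_right]
  rw [← sub_nonneg, ← Finset.sum_sub_distrib]
  set x : ℂ := y (m + 1) - y m with hx
  have key : ∀ i, 2 * ((b (i + 1) - b i) * inner ℝ (θ • y m + (1 - θ) • y (m + 1)) (y (m + 1) - y i))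
      - (b (i + 1) - b i) * (‖y (m + 1)‖ ^ 2 - ‖y i‖ ^ 2) =
      (b (i + 1) - b i) * (‖y (m + 1) - y i‖ ^ 2 - 2 * θ * inner ℝ x (y (m + 1) - y i)) := by
    intro i
    have e1 : θ • y m + (1 - θ) • y (m + 1) = y (m + 1) - θ • x := by
      rw [hx, sub_smul, smul_sub, one_smul]; abel
    rw [e1, inner_sub_left, inner_smul_left]
    have e2 : ‖y i‖ ^ 2 = ‖y (m + 1)‖ ^ 2 - 2 * inner ℝ (y (m + 1)) (y (m + 1) - y i)
        + ‖y (m + 1) - y i‖ ^ 2 := by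
      rw [← norm_sub_sq_real]; congr 2; abel
    rw [e2]; simp; ring
  rw [Finset.sum_congr rfl fun i _ => key i, Finset.sum_range_succ]
  have h3 : ∀ i ∈ Finset.range m, -(b (i + 1) - b i) * (θ ^ 2 * ‖x‖ ^ 2) ≤
      (b (i + 1) - b i) * (‖y (m + 1) - y i‖ ^ 2 - 2 * θ * inner ℝ x (y (m + 1) - y i)) := by
    intro i hi
    have hd : 0 ≤ b (i + 1) - b i := sub_nonneg.2 (hmono i (Finset.mem_range.1 hi).le)
    have := real_inner_le_norm x (y (m + 1) - y i)
    have h4 : 0 ≤ ‖y (m + 1) - y i‖ ^ 2 - 2 * θ * inner ℝ x (y (m + 1) - y i) + θ ^ 2 * ‖x‖ ^ 2 := by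
      nlinarith [sq_nonneg (‖y (m + 1) - y i‖ - θ * ‖x‖), mul_le_mul_of_nonneg_left this hθ0]
    nlinarith [mul_nonneg hd h4]
  have h5 := Finset.sum_le_sum h3
  rw [← Finset.sum_mul, Finset.sum_neg_distrib, Finset.sum_range_sub, hb] at h5
  have h6 : (b (m + 1) - b m) * (‖y (m + 1) - y m‖ ^ 2 - 2 * θ * inner ℝ x (y (m + 1) - y m)) =
      (b (m + 1) - b m) * (1 - 2 * θ) * ‖x‖ ^ 2 := by
    rw [← hx, real_inner_self_eq_norm_sq]; ring
  rw [h6]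
  have hbm : 0 ≤ b m := by
    have : ∀ k ≤ m, 0 ≤ b k := by
      intro k
      induction k with
      | zero => intro _; exact hb.ge
      | succ k ih => intro hk; exact (ih (by omega)).trans (hmono k (by omega))
    exact this m le_rfl
  have h7 : 0 ≤ (b (m + 1) - b m) * (1 - 2 * θ) - θ ^ 2 * b m := by
    nlinarith [mul_nonneg (mul_nonneg hθ0 hbm) (sub_nonneg.2 hθ1)]
  nlinarith [mul_nonneg h7 (sq_nonneg ‖x‖)]

/-- Unconditional stability of the scheme for `∂^β e = i μ e + R`, by a barrier argument. -/
theorem scheme_stability (θ μ M : ℝ) (N : ℕ) (A : ℕ → ℕ → ℝ) (e R : ℕ → ℂ) (G r : ℕ → ℝ)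
    (hθ0 : 0 ≤ θ) (hθ1 : θ ≤ 1) (hA0 : ∀ n, A n 0 = 0)
    (hmono : ∀ n ≤ N, ∀ k < n, A n k ≤ A n (k + 1))
    (hθ : ∀ n < N, (1 - θ) * A (n + 1) n ≤ (1 - 2 * θ) * A (n + 1) (n + 1))
    (hpos : ∀ n < N, 0 < A (n + 1) (n + 1))
    (he0 : e 0 = 0) (hG0 : G 0 = 0) (hG : ∀ n, 0 ≤ G n)
    (heq : ∀ n < N, ∑ i ∈ Finset.range (n + 1), A (n + 1) (i + 1) • (e (i + 1) - e i) =
      Complex.I * μ * (θ • e n + (1 - θ) • e (n + 1)) + R (n + 1))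
    (hR : ∀ n < N, ‖R (n + 1)‖ ≤ A (n + 1) (n + 1) * G (n + 1) +
      ∑ i ∈ Finset.range (n + 1), (A (n + 1) (i + 1) - A (n + 1) i) * G i + r (n + 1))
    (hM : ∀ n < N, 2 * (A (n + 1) (n + 1) * G (n + 1)) + r (n + 1) ≤ M * A (n + 1) 1)
    (n : ℕ) (hn1 : 1 ≤ n) (hn : n ≤ N) : ‖e n‖ ≤ 2 * M := by
  obtain ⟨q, hq, hmax⟩ := Finset.exists_max_image (Finset.range (N + 1)) (fun i => ‖e i‖) ⟨0, by simp⟩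
  simp only [Finset.mem_range] at hq hmax
  set E := ‖e q‖ with hE
  have hE0 : 0 ≤ E := norm_nonneg _
  have claim : ∀ m, 1 ≤ m → m ≤ N → ‖e m‖ ^ 2 ≤ 2 * E * (M - G m) := by
    intro m
    induction m using Nat.strong_induction_on with
    | _ m ih =>
      intro h1 hmN
      obtain ⟨p, rfl⟩ : ∃ p, m = p + 1 := ⟨m - 1, by omega⟩
      have hp : p < N := by omega
      have hen := energy_inequality (A (p + 1)) (hA0 _) θ e p
        (fun k hk => hmono _ hmN k (by omega)) hθ0 hθ1 (hθ p hp)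
      have h1 := sum_mul_sub_eq (A (p + 1)) (hA0 _) (fun i => ‖e i‖ ^ 2) (p + 1)
      simp only [smul_eq_mul] at h1
      rw [h1, heq p hp] at hen
      set w := θ • e p + (1 - θ) • e (p + 1) with hw
      have hz : inner ℝ w (Complex.I * μ * w) = 0 := by
        rw [Complex.inner]
        simp only [Complex.mul_re, Complex.mul_im, Complex.I_re, Complex.I_im, Complex.ofReal_re,
          Complex.ofReal_im, Complex.conj_re, Complex.conj_im]
        ring
      have hwE : ‖w‖ ≤ E := by
        have a1 := hmax p (by omega)
        have a2 := hmax (p + 1) (by omega)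
        calc ‖w‖ ≤ ‖θ • e p‖ + ‖(1 - θ) • e (p + 1)‖ := norm_add_le _ _
          _ = θ * ‖e p‖ + (1 - θ) * ‖e (p + 1)‖ := by
            rw [norm_smul, norm_smul, Real.norm_of_nonneg hθ0, Real.norm_of_nonneg (sub_nonneg.2 hθ1)]
          _ ≤ θ * E + (1 - θ) * E := by
            have := sub_nonneg.2 hθ1
            gcongr
          _ = E := by ring
      rw [inner_add_right, hz, zero_add] at hen
      have hen2 : inner ℝ w (R (p + 1)) ≤ E * ‖R (p + 1)‖ :=
        (real_inner_le_norm _ _).trans (by gcongr)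
      have hsum : ∑ i ∈ Finset.range (p + 1), (A (p + 1) (i + 1) - A (p + 1) i) * (‖e (p + 1)‖ ^ 2 - ‖e i‖ ^ 2)
          = A (p + 1) (p + 1) * ‖e (p + 1)‖ ^ 2 - ∑ i ∈ Finset.range (p + 1), (A (p + 1) (i + 1) - A (p + 1) i) * ‖e i‖ ^ 2 := by
        simp only [mul_sub]
        rw [Finset.sum_sub_distrib, ← Finset.sum_mul, Finset.sum_range_sub, hA0, sub_zero]
      rw [hsum] at hen
      have hb : ∑ i ∈ Finset.range (p + 1), (A (p + 1) (i + 1) - A (p + 1) i) * ‖e i‖ ^ 2 ≤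
          ∑ i ∈ Finset.range (p + 1), (A (p + 1) (i + 1) - A (p + 1) i) * (2 * E * (M - G i))
            - A (p + 1) 1 * (2 * E * M) := by
        rw [Finset.sum_range_succ', Finset.sum_range_succ', he0, hG0, hA0]
        simp only [zero_add, sub_zero, norm_zero]
        have : ∑ i ∈ Finset.range p, (A (p + 1) (i + 1 + 1) - A (p + 1) (i + 1)) * ‖e (i + 1)‖ ^ 2 ≤
            ∑ i ∈ Finset.range p, (A (p + 1) (i + 1 + 1) - A (p + 1) (i + 1)) * (2 * E * (M - G (i + 1))) := by
          refine Finset.sum_le_sum fun i hi => ?_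
          have hi := Finset.mem_range.1 hi
          exact mul_le_mul_of_nonneg_left (ih (i + 1) (by omega) (by omega) (by omega))
            (sub_nonneg.2 (hmono _ hmN _ (by omega)))
        linarith
      have hc : ∑ i ∈ Finset.range (p + 1), (A (p + 1) (i + 1) - A (p + 1) i) * (2 * E * (M - G i)) =
          2 * E * (M * A (p + 1) (p + 1)) - 2 * E * ∑ i ∈ Finset.range (p + 1), (A (p + 1) (i + 1) - A (p + 1) i) * G i := by
        have : M * A (p + 1) (p + 1) = ∑ i ∈ Finset.range (p + 1), (A (p + 1) (i + 1) - A (p + 1) i) * M := by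
          rw [← Finset.sum_mul, Finset.sum_range_sub, hA0]; ring
        rw [this, Finset.mul_sum, Finset.mul_sum, ← Finset.sum_sub_distrib]
        exact Finset.sum_congr rfl fun i _ => by ring
      have hd := mul_le_mul_of_nonneg_left (hR p hp) (mul_nonneg zero_le_two hE0)
      have hf := mul_le_mul_of_nonneg_left (hM p hp) (mul_nonneg zero_le_two hE0)
      have : A (p + 1) (p + 1) * ‖e (p + 1)‖ ^ 2 ≤ A (p + 1) (p + 1) * (2 * E * (M - G (p + 1))) := by
        nlinarith
      exact le_of_mul_le_mul_left this (hpos p hp)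
  have hEM : E ≤ 2 * M ∨ E = 0 := by
    rcases Nat.eq_zero_or_pos q with h | h
    · right; rw [hE, h, he0, norm_zero]
    · have h2 := claim q h (by omega)
      by_cases h0 : E = 0
      · exact Or.inr h0
      · left
        have hEp : 0 < E := lt_of_le_of_ne hE0 (Ne.symm h0)
        have : E * E ≤ E * (2 * M) := by nlinarith [mul_nonneg hE0 (hG q)]
        exact le_of_mul_le_mul_left this hEp
  have hM0 : 0 ≤ M := by
    have hN : 0 < N := by omega
    have h1 := hR 0 hN
    have h2 := hM 0 hN
    have h3 := hpos 0 hN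
    simp [hG0] at h1 h2 h3
    have h4 : 0 ≤ A 1 1 * G 1 := mul_nonneg h3.le (hG 1)
    have h5 := norm_nonneg (R 1)
    have : 0 ≤ M * A 1 1 := by linarith
    exact nonneg_of_mul_nonneg_left this h3
  have h7 := hmax n (by omega)
  rcases hEM with h8 | h8 <;> linarith

/-! ### Graded meshes -/

/-- The properties of graded meshes used in the error analysis. -/
structure IsGraded (c : ℝ) (t : ℕ → ℝ) : Prop where
  zero : t 0 = 0
  lt_succ : ∀ k, t k < t (k + 1)
  step_mono : ∀ k, t (k + 1) - t k ≤ t (k + 2) - t (k + 1)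
  le_mul_step : ∀ k : ℕ, t (k + 1) ≤ (k + 1) * (t (k + 1) - t k)
  step_mul_le : ∀ k : ℕ, (t (k + 1) - t k) * (k + 1) ≤ c * t (k + 1)
  succ_le : ∀ k, t (k + 2) ≤ c * t (k + 1)

theorem gradedMesh_zero (T r : ℝ) (hr : 1 ≤ r) (N : ℕ) : gradedMesh T r N 0 = 0 := by
  simp [gradedMesh, Real.zero_rpow (by linarith : r ≠ 0)]

theorem gradedMesh_last (T r : ℝ) (N : ℕ) (hN : 1 ≤ N) : gradedMesh T r N N = T := by
  have : (N : ℝ) ≠ 0 := by positivity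
  simp [gradedMesh, div_self this]

theorem gradedMesh_isGraded (T r : ℝ) (hT : 0 < T) (hr : 1 ≤ r) (N : ℕ) (hN : 1 ≤ N) :
    IsGraded (max r (2 ^ r)) (gradedMesh T r N) := by
  have hN0 : (0 : ℝ) < N := by positivity
  have hr0 : 0 < r := by linarith
  have hform : ∀ k : ℕ, gradedMesh T r N k = T / (N : ℝ) ^ r * (k : ℝ) ^ r := by
    intro k
    rw [gradedMesh, Real.div_rpow (by positivity) (by positivity)]; ring
  have hD : 0 < T / (N : ℝ) ^ r := by positivity
  set D := T / (N : ℝ) ^ r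
  have hlt : ∀ k : ℕ, gradedMesh T r N k < gradedMesh T r N (k + 1) := by
    intro k
    rw [hform, hform]
    refine mul_lt_mul_of_pos_left (Real.rpow_lt_rpow (by positivity) (by push_cast; linarith) hr0) hD
  have hmono : ∀ k : ℕ, gradedMesh T r N (k + 1) - gradedMesh T r N k ≤
      gradedMesh T r N (k + 2) - gradedMesh T r N (k + 1) := by
    intro k
    simp only [hform]
    have h := (convexOn_rpow hr).2 (show (k : ℝ) ∈ Ici 0 by simp)
      (show (k : ℝ) + 2 ∈ Ici 0 by simp; positivity)
      (by norm_num : (0 : ℝ) ≤ 1 / 2) (by norm_num : (0 : ℝ) ≤ 1 / 2) (by norm_num)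
    simp only [smul_eq_mul] at h
    have h2 : (1 / 2 * (k : ℝ) + 1 / 2 * (k + 2)) = k + 1 := by ring
    rw [h2] at h
    push_cast
    nlinarith [mul_le_mul_of_nonneg_left h hD.le]
  have h0 := gradedMesh_zero T r hr N
  refine ⟨h0, hlt, hmono, ?_, ?_, ?_⟩
  · intro k
    induction k with
    | zero => simp [h0]
    | succ k ih =>
      have := mul_le_mul_of_nonneg_left (hmono k) (by positivity : (0 : ℝ) ≤ k + 1)
      have h3 := hlt (k + 1)
      push_cast
      linarith
  · intro k
    have hk : (0 : ℝ) < k + 1 := by positivity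
    have hb := one_add_mul_self_le_rpow_one_add (s := -1 / ((k : ℝ) + 1))
      (by rw [le_div_iff₀ hk]; linarith [(Nat.cast_nonneg k : (0:ℝ) ≤ k)]) hr
    have h4 : 1 + -1 / ((k : ℝ) + 1) = k / (k + 1) := by field_simp; ring
    rw [h4, Real.div_rpow (by positivity) (by positivity), le_div_iff₀ (by positivity)] at hb
    have h5 : (1 + r * (-1 / ((k : ℝ) + 1))) * ((k : ℝ) + 1) ^ r * (k + 1) =
      ((k + 1) - r) * ((k : ℝ) + 1) ^ r := by field_simp; ring
    have h6 := mul_le_mul_of_nonneg_right hb hk.le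
    rw [h5] at h6
    have h7 : r * gradedMesh T r N (k + 1) ≤ max r (2 ^ r) * gradedMesh T r N (k + 1) := by
      refine mul_le_mul_of_nonneg_right (le_max_left _ _) ?_
      rw [hform]; positivity
    refine le_trans ?_ h7
    rw [hform, hform]
    push_cast
    nlinarith [mul_le_mul_of_nonneg_left h6 hD.le]
  · intro k
    have h7 : 2 ^ r * gradedMesh T r N (k + 1) ≤ max r (2 ^ r) * gradedMesh T r N (k + 1) := by
      refine mul_le_mul_of_nonneg_right (le_max_right _ _) ?_
      rw [hform]; positivity
    refine le_trans ?_ h7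
    rw [hform, hform, mul_left_comm, ← Real.mul_rpow (by norm_num) (by positivity)]
    refine mul_le_mul_of_nonneg_left (Real.rpow_le_rpow (by positivity) ?_ hr0.le) hD.le
    push_cast; linarith [(Nat.cast_nonneg k : (0:ℝ) ≤ k)]

/-- On graded meshes `t_k ^ σ k ^ (-e)` is at most a constant times `N ^ (-min (r σ) e)`. -/
theorem gradedMesh_rate (T r σ e : ℝ) (hT : 0 < T) (N : ℕ)
    (k : ℕ) (hk : 1 ≤ k) (hkN : k ≤ N) :
    gradedMesh T r N k ^ σ * (k : ℝ) ^ (-e) ≤ T ^ σ * (N : ℝ) ^ (-min (r * σ) e) := by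
  have hk0 : (0 : ℝ) < k := by positivity
  have hN0 : (0 : ℝ) < N := by have : 0 < N := by omega
                               positivity
  have hkN' : (k : ℝ) ≤ N := by exact_mod_cast hkN
  have hk1 : (1 : ℝ) ≤ k := by exact_mod_cast hk
  rw [gradedMesh, Real.mul_rpow hT.le (by positivity), ← Real.rpow_mul (by positivity), mul_assoc]
  refine mul_le_mul_of_nonneg_left ?_ (by positivity)
  set q := min (r * σ) e
  have h1 : ((k : ℝ) / N) ^ (r * σ) ≤ (k / N : ℝ) ^ q :=
    Real.rpow_le_rpow_of_exponent_ge (by positivity) ((div_le_one hN0).2 hkN') (min_le_left _ _)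
  have h2 : (k : ℝ) ^ (-e) ≤ (k : ℝ) ^ (-q) :=
    Real.rpow_le_rpow_of_exponent_le hk1 (neg_le_neg (min_le_right _ _))
  calc ((k : ℝ) / N) ^ (r * σ) * (k : ℝ) ^ (-e) ≤ (k / N : ℝ) ^ q * (k : ℝ) ^ (-q) := by gcongr
    _ = (N : ℝ) ^ (-q) := by
      rw [Real.div_rpow hk0.le hN0.le, Real.rpow_neg hk0.le, Real.rpow_neg hN0.le]
      have : (k : ℝ) ^ q ≠ 0 := by positivity
      field_simp

end SFOR

namespace SFOR
open MeasureTheory Set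

/-! ### Integrals of monotone and convex functions -/

theorem intervalIntegral_sub_midpoint (a b : ℝ) : ∫ s in a..b, (s - (a + b) / 2) = 0 := by
  rw [intervalIntegral.integral_sub (by simp) (by simp), integral_id]
  simp; ring

theorem integral_sub_midpoint_mul_nonneg {f : ℝ → ℝ} {a b : ℝ} (hab : a ≤ b)
    (hf : MonotoneOn f (Icc a b)) : 0 ≤ ∫ s in a..b, (s - (a + b) / 2) * f s := by
  have hfi : IntervalIntegrable f volume a b := MonotoneOn.intervalIntegrable (by rwa [uIcc_of_le hab])
  have h1 : IntervalIntegrable (fun s => (s - (a + b) / 2) * f s) volume a b :=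
    hfi.continuousOn_mul (by fun_prop)
  have h2 : ∫ s in a..b, (s - (a + b) / 2) * f s =
      ∫ s in a..b, (s - (a + b) / 2) * (f s - f ((a + b) / 2)) := by
    simp_rw [mul_sub]
    rw [intervalIntegral.integral_sub h1 (by apply Continuous.intervalIntegrable; fun_prop),
      intervalIntegral.integral_mul_const, intervalIntegral_sub_midpoint]
    simp
  rw [h2]
  refine intervalIntegral.integral_nonneg hab fun s hs => ?_
  have hm : (a + b) / 2 ∈ Icc a b := ⟨by linarith, by linarith⟩
  rcases le_total s ((a + b) / 2) with h | h
  · exact mul_nonneg_of_nonpos_of_nonpos (by linarith) (by linarith [hf hs hm h])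
  · exact mul_nonneg (by linarith) (by linarith [hf hm hs h])

theorem le_integral_of_monotoneOn {f : ℝ → ℝ} {a b : ℝ} (hab : a ≤ b)
    (hf : MonotoneOn f (Icc a b)) : (b - a) * f a ≤ ∫ s in a..b, f s := by
  have hfi : IntervalIntegrable f volume a b := MonotoneOn.intervalIntegrable (by rwa [uIcc_of_le hab])
  have := intervalIntegral.integral_mono_on hab (intervalIntegrable_const (c := f a)) hfi
    fun s hs => hf (left_mem_Icc.2 hab) hs hs.1
  simpa using this

/-- The upper Hermite–Hadamard inequality. -/
theorem integral_le_of_convexOn {f : ℝ → ℝ} {a b : ℝ} (hab : a < b)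
    (hf : ConvexOn ℝ (Icc a b) f) (hfi : IntervalIntegrable f volume a b) :
    ∫ s in a..b, f s ≤ (b - a) * ((f a + f b) / 2) := by
  have h : ∀ s ∈ Icc a b, f s ≤ f a + (s - a) * ((f b - f a) / (b - a)) := by
    intro s hs
    have hba : 0 < b - a := sub_pos.2 hab
    have := hf.2 (left_mem_Icc.2 hab.le) (right_mem_Icc.2 hab.le)
      (div_nonneg (sub_nonneg.2 hs.2) hba.le) (div_nonneg (sub_nonneg.2 hs.1) hba.le)
      (by field_simp; ring)
    simp only [smul_eq_mul] at this
    have e1 : (b - s) / (b - a) * a + (s - a) / (b - a) * b = s := by field_simp; ring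
    rw [e1] at this
    refine this.trans_eq ?_
    field_simp; ring
  have := intervalIntegral.integral_mono_on hab.le hfi
    (g := fun s => f a + (s - a) * ((f b - f a) / (b - a)))
    (by apply Continuous.intervalIntegrable; fun_prop) h
  refine this.trans_eq ?_
  have hba : b - a ≠ 0 := (sub_pos.2 hab).ne'
  rw [intervalIntegral.integral_add (by simp) (by apply Continuous.intervalIntegrable; fun_prop),
    intervalIntegral.integral_mul_const, intervalIntegral.integral_sub (by simp) (by simp), integral_id]
  simp only [intervalIntegral.integral_const, smul_eq_mul]
  field_simp; ring

/-- The midpoint moment of a convex function is controlled by a slope to the right. -/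
theorem integral_sub_midpoint_mul_le_of_convexOn {f : ℝ → ℝ} {a b c : ℝ} (hab : a ≤ b) (hbc : b < c)
    (hf : ConvexOn ℝ (Icc a c) f) (hfi : IntervalIntegrable f volume a b) :
    ∫ s in a..b, (s - (a + b) / 2) * f s ≤ (f c - f b) / (c - b) * ((b - a) ^ 3 / 12) := by
  set S := (f c - f b) / (c - b) with hS
  have hmono : MonotoneOn (fun s => s * S - f s) (Icc a b) := by
    intro s hs s' hs' hss
    rcases hss.eq_or_lt with rfl | hlt
    · exact le_rfl
    have key : (f s' - f s) / (s' - s) ≤ S := by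
      have h1 := hf.slope_mono_adjacent (x := s) (y := s') (z := c) ⟨hs.1, hs.2.trans hbc.le⟩
        ⟨hab.trans hbc.le, le_rfl⟩ hlt (hs'.2.trans_lt hbc)
      refine h1.trans ?_
      rcases hs'.2.eq_or_lt with rfl | hlt'
      · exact le_rfl
      · exact hf.secant_mono_aux3 ⟨hs'.1, hs'.2.trans hbc.le⟩ ⟨hab.trans hbc.le, le_rfl⟩ hlt' hbc
    rw [div_le_iff₀ (sub_pos.2 hlt)] at key
    show s * S - f s ≤ s' * S - f s'
    linarith
  have h := integral_sub_midpoint_mul_nonneg hab hmono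
  have h1 : IntervalIntegrable (fun s => (s - (a + b) / 2) * f s) volume a b :=
    hfi.continuousOn_mul (by fun_prop)
  simp_rw [mul_sub] at h
  rw [intervalIntegral.integral_sub (by apply Continuous.intervalIntegrable; fun_prop) h1] at h
  have h2 : ∫ s in a..b, (s - (a + b) / 2) * (s * S) = S * ((b - a) ^ 3 / 12) := by
    have : ∀ s : ℝ, (s - (a + b) / 2) * (s * S) = S * s ^ 2 - (S * ((a + b) / 2)) * s := fun s => by ring
    simp_rw [this]
    rw [intervalIntegral.integral_sub (by apply Continuous.intervalIntegrable; fun_prop) (by apply Continuous.intervalIntegrable; fun_prop),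
      intervalIntegral.integral_const_mul, intervalIntegral.integral_const_mul, integral_pow, integral_id]
    push_cast; ring
  linarith

/-! ### The weakly singular kernel -/

theorem omega_one_sub (β u : ℝ) : omega (1 - β) u = u ^ (-β) / Real.Gamma (1 - β) := by
  rw [omega]; congr 2; ring

section Kernel

variable {β : ℝ}

theorem omega_nonneg (hβ1 : β < 1) {u : ℝ} (hu : 0 ≤ u) : 0 ≤ omega (1 - β) u :=
  div_nonneg (Real.rpow_nonneg hu _) (Real.Gamma_pos_of_pos (by linarith)).le

theorem omega_pos (hβ1 : β < 1) {u : ℝ} (hu : 0 < u) : 0 < omega (1 - β) u :=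
  div_pos (Real.rpow_pos_of_pos hu _) (Real.Gamma_pos_of_pos (by linarith))

theorem omega_anti (hβ0 : 0 < β) (hβ1 : β < 1) {u v : ℝ} (hu : 0 < u) (huv : u ≤ v) :
    omega (1 - β) v ≤ omega (1 - β) u := by
  rw [omega_one_sub, omega_one_sub]
  have := Real.Gamma_pos_of_pos (by linarith : 0 < 1 - β)
  exact div_le_div_of_nonneg_right (Real.rpow_le_rpow_of_nonpos hu huv (by linarith)) this.le

/-- The derivative of `s ↦ ω_{1-β}(x - s)`. -/
def omegaDeriv (β u : ℝ) : ℝ := β * u ^ (-β - 1) / Real.Gamma (1 - β)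

theorem omegaDeriv_nonneg (hβ0 : 0 < β) (hβ1 : β < 1) {u : ℝ} (hu : 0 ≤ u) : 0 ≤ omegaDeriv β u :=
  div_nonneg (mul_nonneg hβ0.le (Real.rpow_nonneg hu _)) (Real.Gamma_pos_of_pos (by linarith)).le

theorem hasDerivAt_omega_sub {x s : ℝ} (hs : s < x) :
    HasDerivAt (fun s => omega (1 - β) (x - s)) (omegaDeriv β (x - s)) s := by
  simp_rw [omega_one_sub]
  have h := ((hasDerivAt_id s).const_sub x).rpow_const (p := -β) (Or.inl (sub_pos.2 hs).ne')
  refine (h.div_const (Real.Gamma (1 - β))).congr_deriv ?_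
  simp [omegaDeriv]

theorem monotoneOn_omega_sub (hβ0 : 0 < β) (hβ1 : β < 1) (x : ℝ) :
    MonotoneOn (fun s => omega (1 - β) (x - s)) (Iio x) := by
  intro s hs s' hs' h
  exact omega_anti hβ0 hβ1 (sub_pos.2 hs') (by linarith)

theorem convexOn_omega_sub (hβ0 : 0 < β) (hβ1 : β < 1) (x : ℝ) :
    ConvexOn ℝ (Iio x) (fun s => omega (1 - β) (x - s)) := by
  apply MonotoneOn.convexOn_of_deriv (convex_Iio x)
  · exact fun s hs => (hasDerivAt_omega_sub hs).continuousAt.continuousWithinAt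
  · rw [interior_Iio]
    exact fun s hs => (hasDerivAt_omega_sub hs).differentiableAt.differentiableWithinAt
  · rw [interior_Iio]
    intro s hs s' hs' h
    rw [(hasDerivAt_omega_sub hs).deriv, (hasDerivAt_omega_sub hs').deriv, omegaDeriv, omegaDeriv]
    have := Real.Gamma_pos_of_pos (by linarith : 0 < 1 - β)
    refine div_le_div_of_nonneg_right (mul_le_mul_of_nonneg_left ?_ hβ0.le) this.le
    exact Real.rpow_le_rpow_of_nonpos (sub_pos.2 hs') (by linarith) (by linarith)

theorem intervalIntegrable_omega_sub (hβ1 : β < 1) (x a b : ℝ) :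
    IntervalIntegrable (fun s => omega (1 - β) (x - s)) volume a b := by
  simp_rw [omega_one_sub]
  have h := (intervalIntegral.intervalIntegrable_rpow' (a := x - a) (b := x - b)
    (by linarith : -1 < -β)).comp_sub_left x
  simp only [sub_sub_cancel] at h
  exact h.div_const _

theorem integral_omega_sub (hβ1 : β < 1) (x a : ℝ) :
    ∫ s in a..x, omega (1 - β) (x - s) = (x - a) ^ (1 - β) / ((1 - β) * Real.Gamma (1 - β)) := by
  have h : ∫ s in a..x, omega (1 - β) (x - s) = ∫ s in a..x, (fun u => omega (1 - β) u) (x - s) := rfl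
  rw [h, intervalIntegral.integral_comp_sub_left]
  simp_rw [omega_one_sub]
  rw [intervalIntegral.integral_div, integral_rpow (Or.inl (by linarith)), sub_self,
    Real.zero_rpow (by linarith), div_div]
  congr 1
  · ring_nf
  · ring

theorem integral_omega_sub_eq (hβ1 : β < 1) {x a : ℝ} (hax : a < x) :
    ∫ s in a..x, omega (1 - β) (x - s) = (x - a) / (1 - β) * omega (1 - β) (x - a) := by
  rw [integral_omega_sub hβ1, omega_one_sub, sub_eq_add_neg 1 β, Real.rpow_add (sub_pos.2 hax),
    Real.rpow_one]
  have := (Real.Gamma_pos_of_pos (by linarith : 0 < 1 - β)).ne'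
  have : 1 - β ≠ 0 := by linarith
  rw [← sub_eq_add_neg]
  field_simp

/-- The off-set `θ = β / 2` makes the formula exact for quadratic polynomials on the last
interval. -/
theorem integral_omega_sub_mul_midpoint (hβ0 : 0 < β) (hβ1 : β < 1) {a h : ℝ} (hh : 0 < h) :
    ∫ s in a..(a + (1 - β / 2) * h), omega (1 - β) (a + (1 - β / 2) * h - s) * (s - (a + h / 2)) = 0 := by
  set X := (1 - β / 2) * h with hX
  have hXp : 0 < X := mul_pos (by linarith) hh
  have e : ∀ s, omega (1 - β) (a + X - s) * (s - (a + h / 2)) =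
      (fun u => omega (1 - β) u * ((X - h / 2) - u)) (a + X - s) := fun s => by simp only; ring
  simp_rw [e]
  rw [intervalIntegral.integral_comp_sub_left (fun u => omega (1 - β) u * ((X - h / 2) - u))]
  have e2 : ∫ u in (a + X - (a + X))..(a + X - a), omega (1 - β) u * ((X - h / 2) - u) =
      ∫ u in (0 : ℝ)..X, ((X - h / 2) * u ^ (-β) - u ^ (1 - β)) / Real.Gamma (1 - β) := by
    rw [sub_self, add_sub_cancel_left]
    refine intervalIntegral.integral_congr_uIoo fun u hu => ?_
    rw [uIoo_of_le hXp.le] at hu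
    simp only [omega_one_sub]
    rw [sub_eq_add_neg 1 β, Real.rpow_add hu.1, Real.rpow_one, ← sub_eq_add_neg]
    ring
  rw [e2, intervalIntegral.integral_div, intervalIntegral.integral_sub
    ((intervalIntegral.intervalIntegrable_rpow' (by linarith)).const_mul _)
    (intervalIntegral.intervalIntegrable_rpow' (by linarith)), intervalIntegral.integral_const_mul,
    integral_rpow (Or.inl (by linarith)), integral_rpow (Or.inl (by linarith)),
    Real.zero_rpow (by linarith), Real.zero_rpow (by linarith)]
  have e3 : X ^ (1 - β + 1) = X ^ (-β + 1) * X := by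
    rw [show 1 - β + 1 = (-β + 1) + 1 by ring, Real.rpow_add hXp, Real.rpow_one]
  rw [e3, hX]
  have h1 : -β + 1 ≠ 0 := by linarith
  have h2 : 1 - β + 1 ≠ 0 := by linarith
  field_simp
  ring

/-- Integration by parts against the kernel, for a function vanishing at both ends. -/
theorem norm_integral_omega_smul_deriv_le (hβ0 : 0 < β) (hβ1 : β < 1) {x a b G : ℝ} (hab : a ≤ b)
    (hbx : b < x) {E E' : ℝ → ℂ} (hc : ContinuousOn E (Icc a b))
    (hd : ∀ s ∈ Ioo a b, HasDerivAt E (E' s) s) (hi : IntervalIntegrable E' volume a b)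
    (ha : E a = 0) (hb : E b = 0) (hG : ∀ s ∈ Icc a b, ‖E s‖ ≤ G) :
    ‖∫ s in a..b, omega (1 - β) (x - s) • E' s‖ ≤
      G * (omega (1 - β) (x - b) - omega (1 - β) (x - a)) := by
  have hsub : ∀ s ∈ Icc a b, s < x := fun s hs => hs.2.trans_lt hbx
  have hwc : ContinuousOn (fun s => omega (1 - β) (x - s)) (Icc a b) :=
    fun s hs => (hasDerivAt_omega_sub (hsub s hs)).continuousAt.continuousWithinAt
  have hwi : IntervalIntegrable (fun s => omegaDeriv β (x - s)) volume a b := by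
    apply ContinuousOn.intervalIntegrable
    rw [uIcc_of_le hab]
    intro s hs
    apply ContinuousAt.continuousWithinAt
    refine ContinuousAt.div_const (continuousAt_const.mul ?_) _
    exact (continuousAt_const.sub continuousAt_id).rpow_const (Or.inl (sub_pos.2 (hsub s hs)).ne')
  have hft : ∫ s in a..b, omegaDeriv β (x - s) = omega (1 - β) (x - b) - omega (1 - β) (x - a) := by
    rw [intervalIntegral.integral_eq_sub_of_hasDerivAt (fun s hs => ?_) hwi]
    rw [uIcc_of_le hab] at hs
    exact hasDerivAt_omega_sub (hsub s hs)
  rw [intervalIntegral.integral_smul_deriv_eq_deriv_smul_of_hasDerivAt (u' := fun s => omegaDeriv β (x - s))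
    (v := E) (by rwa [uIcc_of_le hab]) (by rwa [uIcc_of_le hab])
    (by rw [min_eq_left hab, max_eq_right hab]; exact fun s hs => hasDerivAt_omega_sub (hsub s ⟨hs.1.le, hs.2.le⟩))
    (by rwa [min_eq_left hab, max_eq_right hab]) hwi hi, ha, hb, smul_zero, smul_zero, sub_zero, zero_sub,
    norm_neg, ← hft, ← intervalIntegral.integral_const_mul]
  refine intervalIntegral.norm_integral_le_of_norm_le hab (Filter.Eventually.of_forall fun s hs => ?_)
    (hwi.const_mul _)
  have hs' : s ∈ Icc a b := ⟨hs.1.le, hs.2⟩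
  rw [norm_smul, Real.norm_of_nonneg (omegaDeriv_nonneg hβ0 hβ1 (sub_pos.2 (hsub s hs')).le), mul_comm]
  exact mul_le_mul_of_nonneg_right (hG s hs') (omegaDeriv_nonneg hβ0 hβ1 (sub_pos.2 (hsub s hs')).le)

end Kernel
end SFOR

namespace SFOR
open MeasureTheory Set

/-! ### Functions with power-type derivative bounds -/

/-- `z` is continuous on `[0, ∞)`, three times differentiable on `(0, ∞)`, and its derivatives
satisfy `‖z⁽ᵐ⁾(t)‖ ≤ K t ^ (σ - m)`, `m = 1, 2, 3`. -/
structure PowerRegular (K σ : ℝ) (z z₁ z₂ z₃ : ℝ → ℂ) : Prop where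
  cont : ContinuousOn z (Ici 0)
  deriv₁ : ∀ t > 0, HasDerivAt z (z₁ t) t
  deriv₂ : ∀ t > 0, HasDerivAt z₁ (z₂ t) t
  deriv₃ : ∀ t > 0, HasDerivAt z₂ (z₃ t) t
  bound₁ : ∀ t > 0, ‖z₁ t‖ ≤ K * t ^ (σ - 1)
  bound₂ : ∀ t > 0, ‖z₂ t‖ ≤ K * t ^ (σ - 2)
  bound₃ : ∀ t > 0, ‖z₃ t‖ ≤ K * t ^ (σ - 3)

theorem norm_sub_le_of_deriv_le {f f' : ℝ → ℂ} {a b C : ℝ}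
    (hf : ∀ s ∈ Icc a b, HasDerivAt f (f' s) s) (hC : ∀ s ∈ Icc a b, ‖f' s‖ ≤ C)
    {s u : ℝ} (hs : s ∈ Icc a b) (hu : u ∈ Icc a b) : ‖f s - f u‖ ≤ C * (b - a) := by
  have hC0 : 0 ≤ C := (norm_nonneg _).trans (hC s hs)
  have := (convex_Icc a b).norm_image_sub_le_of_norm_hasDerivWithin_le
    (fun x hx => (hf x hx).hasDerivWithinAt) hC hu hs
  refine this.trans (mul_le_mul_of_nonneg_left ?_ hC0)
  rw [Real.norm_eq_abs, abs_le]
  constructor <;> linarith [hs.1, hs.2, hu.1, hu.2]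

theorem continuousOn_z₁ {K σ : ℝ} {z z₁ z₂ z₃ : ℝ → ℂ} (h : PowerRegular K σ z z₁ z₂ z₃) :
    ContinuousOn z₁ (Ioi 0) :=
  fun t ht => (h.deriv₂ t ht).continuousAt.continuousWithinAt

namespace PowerRegular

variable {K σ : ℝ} {z z₁ z₂ z₃ : ℝ → ℂ}

theorem K_nonneg (h : PowerRegular K σ z z₁ z₂ z₃) : 0 ≤ K := by
  have := (norm_nonneg _).trans (h.bound₁ 1 one_pos)
  simpa using this

theorem intervalIntegrable_deriv (h : PowerRegular K σ z z₁ z₂ z₃) (hσ : 0 < σ) {a b : ℝ}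
    (ha : 0 ≤ a) (hab : a ≤ b) : IntervalIntegrable z₁ volume a b := by
  have hg : IntervalIntegrable (fun t : ℝ => K * t ^ (σ - 1)) volume a b :=
    (intervalIntegral.intervalIntegrable_rpow' (by linarith)).const_mul K
  rw [intervalIntegrable_iff_integrableOn_Ioc_of_le hab] at hg ⊢
  refine Integrable.mono' hg ?_ ?_
  · exact ((continuousOn_z₁ h).mono fun s hs => ha.trans_lt hs.1).aestronglyMeasurable measurableSet_Ioc
  · exact (ae_restrict_iff' measurableSet_Ioc).2
      (Filter.Eventually.of_forall fun s hs => h.bound₁ s (ha.trans_lt hs.1))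

theorem norm_sub_zero_le (h : PowerRegular K σ z z₁ z₂ z₃) (hσ : 0 < σ) {s : ℝ} (hs : 0 ≤ s) :
    ‖z s - z 0‖ ≤ K / σ * s ^ σ := by
  rw [← intervalIntegral.integral_eq_sub_of_hasDerivAt_of_le hs
    (h.cont.mono fun x hx => hx.1) (fun x hx => h.deriv₁ x hx.1)
    (h.intervalIntegrable_deriv hσ le_rfl hs)]
  have := intervalIntegral.norm_integral_le_of_norm_le (μ := volume) (f := z₁)
    (g := fun t : ℝ => K * t ^ (σ - 1)) hs
    (Filter.Eventually.of_forall fun t ht => h.bound₁ t ht.1)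
    ((intervalIntegral.intervalIntegrable_rpow' (by linarith)).const_mul K)
  refine this.trans_eq ?_
  rw [intervalIntegral.integral_const_mul, integral_rpow (Or.inl (by linarith)),
    Real.zero_rpow (by linarith), sub_add_cancel, sub_zero]
  ring

theorem norm_avg_sub_deriv_le (h : PowerRegular K σ z z₁ z₂ z₃) (hσ1 : σ ≤ 1) {a b s : ℝ} (ha : 0 < a)
    (hab : a < b) (hs : s ∈ Icc a b) :
    ‖(b - a)⁻¹ • (z b - z a) - z₁ s‖ ≤ K * a ^ (σ - 2) * (b - a) := by
  have hba : 0 < b - a := sub_pos.2 hab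
  have hpos : ∀ u ∈ Icc a b, 0 < u := fun u hu => ha.trans_le hu.1
  have hb2 : ∀ u ∈ Icc a b, ‖z₂ u‖ ≤ K * a ^ (σ - 2) := fun u hu =>
    (h.bound₂ u (hpos u hu)).trans (mul_le_mul_of_nonneg_left
      (Real.rpow_le_rpow_of_nonpos ha hu.1 (by linarith)) h.K_nonneg)
  have h1 : ∀ u ∈ Icc a b, ‖z₁ u - z₁ s‖ ≤ K * a ^ (σ - 2) * (b - a) := fun u hu =>
    norm_sub_le_of_deriv_le (fun v hv => h.deriv₂ v (hpos v hv)) hb2 hu hs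
  have h2 := norm_sub_le_of_deriv_le (f := fun u => z u - u • z₁ s) (f' := fun u => z₁ u - z₁ s)
    (fun v hv => ((h.deriv₁ v (hpos v hv)).sub ((hasDerivAt_id v).smul_const (z₁ s))).congr_deriv (by simp)) h1
    (right_mem_Icc.2 hab.le) (left_mem_Icc.2 hab.le)
  have h3 : (b - a)⁻¹ • (z b - z a) - z₁ s = (b - a)⁻¹ • (z b - b • z₁ s - (z a - a • z₁ s)) := by
    have : z b - b • z₁ s - (z a - a • z₁ s) = (z b - z a) - (b - a) • z₁ s := by
      rw [sub_smul]; abel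
    rw [this, smul_sub _ (z b - z a), smul_smul, inv_mul_cancel₀ hba.ne', one_smul]
  rw [h3, norm_smul, norm_inv, Real.norm_of_nonneg hba.le, inv_mul_le_iff₀ hba]
  linarith

/-- Second-order Taylor estimates. -/
theorem taylor_bounds (h : PowerRegular K σ z z₁ z₂ z₃) (hσ1 : σ ≤ 1) {a d : ℝ} (ha : 0 < a)
    {s : ℝ} (hs : s ∈ Icc a d) :
    ‖z₁ s - z₁ a - (s - a) • z₂ a‖ ≤ K * a ^ (σ - 3) * (d - a) ^ 2 ∧
    ‖z s - z a - (s - a) • z₁ a - ((s - a) ^ 2 / 2) • z₂ a‖ ≤ K * a ^ (σ - 3) * (d - a) ^ 3 := by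
  have had : a ≤ d := hs.1.trans hs.2
  have hpos : ∀ u ∈ Icc a d, 0 < u := fun u hu => ha.trans_le hu.1
  have hb3 : ∀ u ∈ Icc a d, ‖z₃ u‖ ≤ K * a ^ (σ - 3) := fun u hu =>
    (h.bound₃ u (hpos u hu)).trans (mul_le_mul_of_nonneg_left
      (Real.rpow_le_rpow_of_nonpos ha hu.1 (by linarith)) h.K_nonneg)
  have h2 : ∀ u ∈ Icc a d, ‖z₂ u - z₂ a‖ ≤ K * a ^ (σ - 3) * (d - a) := fun u hu =>
    norm_sub_le_of_deriv_le (fun v hv => h.deriv₃ v (hpos v hv)) hb3 hu (left_mem_Icc.2 had)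
  have h1 : ∀ u ∈ Icc a d, ‖z₁ u - z₁ a - (u - a) • z₂ a‖ ≤ K * a ^ (σ - 3) * (d - a) ^ 2 := by
    intro u hu
    have := norm_sub_le_of_deriv_le (f := fun u => z₁ u - z₁ a - (u - a) • z₂ a)
      (f' := fun u => z₂ u - z₂ a)
      (fun v hv => (((h.deriv₂ v (hpos v hv)).sub_const (z₁ a)).sub
          (((hasDerivAt_id v).sub_const a).smul_const (z₂ a))).congr_deriv (by simp)) h2 hu (left_mem_Icc.2 had)
    simp only [sub_self, zero_smul, sub_zero] at this
    refine this.trans_eq (by ring)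
  refine ⟨h1 s hs, ?_⟩
  have := norm_sub_le_of_deriv_le
    (f := fun u => z u - z a - (u - a) • z₁ a - ((u - a) ^ 2 / 2) • z₂ a)
    (f' := fun u => z₁ u - z₁ a - (u - a) • z₂ a)
    (fun v hv => by
      have e1 : HasDerivAt (fun u : ℝ => (u - a) ^ 2 / 2) (v - a) v := by
        have := (((hasDerivAt_id v).sub_const a).pow 2).div_const 2
        refine this.congr_deriv ?_
        simp
      exact ((((h.deriv₁ v (hpos v hv)).sub_const (z a)).sub
        (((hasDerivAt_id v).sub_const a).smul_const (z₁ a))).sub (e1.smul_const (z₂ a))).congr_deriv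
          (by simp)) h1 hs (left_mem_Icc.2 had)
  simp only [sub_self, zero_smul, sub_zero, ne_eq, OfNat.ofNat_ne_zero, not_false_eq_true, zero_pow, zero_div] at this
  refine this.trans_eq (by ring)

/-- Superconvergence of the difference quotient up to a multiple of the midpoint moment. -/
theorem norm_avg_add_sub_deriv_le (h : PowerRegular K σ z z₁ z₂ z₃) (hσ1 : σ ≤ 1) {a b s : ℝ} (ha : 0 < a)
    (hab : a < b) (hs : s ∈ Icc a b) :
    ‖(b - a)⁻¹ • (z b - z a) + (s - (a + (b - a) / 2)) • z₂ a - z₁ s‖ ≤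
      2 * (K * a ^ (σ - 3) * (b - a) ^ 2) := by
  have hba : 0 < b - a := sub_pos.2 hab
  have h1 := (h.taylor_bounds hσ1 ha hs).1
  have h2 := (h.taylor_bounds hσ1 ha (right_mem_Icc.2 hab.le)).2
  have e : (b - a)⁻¹ • (z b - z a) + (s - (a + (b - a) / 2)) • z₂ a - z₁ s =
      (b - a)⁻¹ • (z b - z a - (b - a) • z₁ a - ((b - a) ^ 2 / 2) • z₂ a) -
        (z₁ s - z₁ a - (s - a) • z₂ a) := by
    have hb' : ((b : ℂ) - a) ≠ 0 := by exact_mod_cast hba.ne'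
    simp only [Complex.real_smul]
    push_cast
    field_simp
    ring
  rw [e]
  refine (norm_sub_le _ _).trans ?_
  rw [norm_smul, norm_inv, Real.norm_of_nonneg hba.le, two_mul]
  refine add_le_add ?_ h1
  rw [inv_mul_le_iff₀ hba]
  refine h2.trans_eq (by ring)

variable {β : ℝ}

theorem intervalIntegrable_omega_smul_deriv (h : PowerRegular K σ z z₁ z₂ z₃) (hσ : 0 < σ) (hβ1 : β < 1)
    {x a b : ℝ} (ha : 0 ≤ a) (hab : a ≤ b) (hbx : b ≤ x) :
    IntervalIntegrable (fun s => omega (1 - β) (x - s) • z₁ s) volume a b := by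
  rcases (ha.trans (hab.trans hbx)).eq_or_lt with h0 | hx
  · have : a = b := by linarith
    subst this; exact IntervalIntegrable.refl
  have h1 : IntervalIntegrable (fun s => omega (1 - β) (x - s) • z₁ s) volume 0 (x / 2) := by
    apply (h.intervalIntegrable_deriv hσ le_rfl (by linarith)).continuousOn_smul
    rw [uIcc_of_le (by linarith)]
    exact fun s hs => (hasDerivAt_omega_sub (by linarith [hs.2])).continuousAt.continuousWithinAt
  have h2 : IntervalIntegrable (fun s => omega (1 - β) (x - s) • z₁ s) volume (x / 2) x := by
    apply (intervalIntegrable_omega_sub hβ1 x (x / 2) x).smul_continuousOn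
    rw [uIcc_of_le (by linarith)]
    exact (continuousOn_z₁ h).mono fun s hs => show 0 < s by linarith [hs.1]
  refine (h1.trans h2).mono_set ?_
  rw [uIcc_of_le hab, uIcc_of_le hx.le]
  exact Icc_subset_Icc ha hbx

/-- The consistency error on the first interval. -/
theorem norm_first_interval_le (h : PowerRegular K σ z z₁ z₂ z₃) (hσ : 0 < σ) (hσ1 : σ ≤ 1)
    (hβ0 : 0 < β) (hβ1 : β < 1) {x t : ℝ} (ht : 0 < t) (hxt : t / 2 ≤ x) :
    ‖∫ s in (0 : ℝ)..x, omega (1 - β) (x - s) • (t⁻¹ • (z t - z 0) - z₁ s)‖ ≤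
      (4 + 5 / σ) * K * t ^ σ * (t⁻¹ * ∫ s in (0 : ℝ)..x, omega (1 - β) (x - s)) := by
  have hx : 0 < x := by linarith
  have hK := h.K_nonneg
  set W := ∫ s in (0 : ℝ)..x, omega (1 - β) (x - s) with hW
  have hi := h.intervalIntegrable_omega_smul_deriv hσ hβ1 le_rfl hx.le (le_refl x)
  have hwi : ∀ a b, IntervalIntegrable (fun s => omega (1 - β) (x - s)) volume a b :=
    intervalIntegrable_omega_sub hβ1 x
  simp_rw [smul_sub _ (t⁻¹ • (z t - z 0))]
  rw [intervalIntegral.integral_sub ((hwi _ _).smul_continuousOn continuousOn_const) hi,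
    intervalIntegral.integral_smul_const]
  have hW0 : 0 ≤ W := intervalIntegral.integral_nonneg hx.le fun s hs => omega_nonneg hβ1 (by linarith [hs.2])
  have hA : ‖(∫ s in (0 : ℝ)..x, omega (1 - β) (x - s)) • t⁻¹ • (z t - z 0)‖ ≤ 1 / σ * (K * t ^ σ) * (t⁻¹ * W) := by
    rw [norm_smul, norm_smul, Real.norm_of_nonneg hW0, norm_inv, Real.norm_of_nonneg ht.le]
    have := h.norm_sub_zero_le hσ ht.le
    calc W * (t⁻¹ * ‖z t - z 0‖) ≤ W * (t⁻¹ * (K / σ * t ^ σ)) := by gcongr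
      _ = _ := by ring
  have hsplit : W = (∫ s in (0 : ℝ)..(x / 2), omega (1 - β) (x - s)) +
      ∫ s in (x / 2)..x, omega (1 - β) (x - s) :=
    (intervalIntegral.integral_add_adjacent_intervals (hwi _ _) (hwi _ _)).symm
  set w := omega (1 - β) (x - x / 2) with hw
  have hw0 : 0 ≤ w := omega_nonneg hβ1 (by linarith)
  have hI2 : ∫ s in (x / 2)..x, omega (1 - β) (x - s) = (x / 2) / (1 - β) * w := by
    rw [integral_omega_sub_eq hβ1 (by linarith)]; congr 2; ring
  have hI1 : 0 ≤ ∫ s in (0 : ℝ)..(x / 2), omega (1 - β) (x - s) :=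
    intervalIntegral.integral_nonneg (by linarith) fun s hs => omega_nonneg hβ1 (by linarith [hs.2])
  have hB1 : ‖∫ s in (0 : ℝ)..(x / 2), omega (1 - β) (x - s) • z₁ s‖ ≤ w * (K / σ * (x / 2) ^ σ) := by
    have hr : IntervalIntegrable (fun s : ℝ => w * (K * s ^ (σ - 1))) volume 0 (x / 2) :=
      ((intervalIntegral.intervalIntegrable_rpow' (by linarith)).const_mul K).const_mul w
    have := intervalIntegral.norm_integral_le_of_norm_le (μ := volume)
      (f := fun s => omega (1 - β) (x - s) • z₁ s) (g := fun s => w * (K * s ^ (σ - 1)))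
      (by linarith : (0 : ℝ) ≤ x / 2)
      (Filter.Eventually.of_forall fun s hs => by
        rw [norm_smul, Real.norm_of_nonneg (omega_nonneg hβ1 (by linarith [hs.2]))]
        exact mul_le_mul (omega_anti hβ0 hβ1 (by linarith) (by linarith [hs.2])) (h.bound₁ s hs.1)
          (norm_nonneg _) hw0) hr
    refine this.trans_eq ?_
    rw [intervalIntegral.integral_const_mul, intervalIntegral.integral_const_mul,
      integral_rpow (Or.inl (by linarith)), Real.zero_rpow (by linarith), sub_add_cancel, sub_zero]
    ring
  have hB2 : ‖∫ s in (x / 2)..x, omega (1 - β) (x - s) • z₁ s‖ ≤ K * (x / 2) ^ (σ - 1) * ((x / 2) / (1 - β) * w) := by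
    rw [← hI2, ← intervalIntegral.integral_const_mul]
    refine intervalIntegral.norm_integral_le_of_norm_le (by linarith)
      (Filter.Eventually.of_forall fun s hs => ?_) ((hwi _ _).const_mul _)
    rw [norm_smul, Real.norm_of_nonneg (omega_nonneg hβ1 (by linarith [hs.2])), mul_comm]
    refine mul_le_mul_of_nonneg_right ?_ (omega_nonneg hβ1 (by linarith [hs.2]))
    refine (h.bound₁ s (by linarith [hs.1])).trans (mul_le_mul_of_nonneg_left ?_ hK)
    exact Real.rpow_le_rpow_of_nonpos (by linarith) hs.1.le (by linarith)
  have hB : ‖∫ s in (0 : ℝ)..x, omega (1 - β) (x - s) • z₁ s‖ ≤ (1 / σ + 1) * (K * (x / 2) ^ (σ - 1)) * W := by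
    rw [← intervalIntegral.integral_add_adjacent_intervals
      (h.intervalIntegrable_omega_smul_deriv hσ hβ1 le_rfl (by linarith) (by linarith) :
        IntervalIntegrable _ volume 0 (x / 2))
      (h.intervalIntegrable_omega_smul_deriv hσ hβ1 (by linarith) (by linarith) le_rfl)]
    refine (norm_add_le _ _).trans ((add_le_add hB1 hB2).trans ?_)
    have e1 : (x / 2) ^ σ = (x / 2) ^ (σ - 1) * (x / 2) := by
      conv_rhs => rw [← Real.rpow_one (x / 2), ← Real.rpow_mul (by linarith)]
      rw [one_mul, ← Real.rpow_add (by linarith)]; simp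
    have hle : x / 2 * w ≤ W := by
      rw [hsplit, hI2]
      have : x / 2 * w ≤ x / 2 / (1 - β) * w := by
        refine mul_le_mul_of_nonneg_right ?_ hw0
        rw [le_div_iff₀ (by linarith)]
        nlinarith
      linarith
    have hle2 : (x / 2) / (1 - β) * w ≤ W := by rw [hsplit, hI2]; linarith
    have hp : 0 ≤ K * (x / 2) ^ (σ - 1) := mul_nonneg hK (Real.rpow_nonneg (by linarith) _)
    rw [e1]
    have : w * (K / σ * ((x / 2) ^ (σ - 1) * (x / 2))) = 1 / σ * (K * (x / 2) ^ (σ - 1)) * (x / 2 * w) := by ring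
    rw [this, add_mul, add_mul, one_mul]
    have hs0 : 0 ≤ 1 / σ := by positivity
    gcongr
  have hpow : (x / 2) ^ (σ - 1) ≤ 4 * (t ^ σ * t⁻¹) := by
    have h1 : (x / 2) ^ (σ - 1) ≤ (t / 4) ^ (σ - 1) :=
      Real.rpow_le_rpow_of_nonpos (by linarith) (by linarith) (by linarith)
    refine h1.trans ?_
    rw [Real.div_rpow ht.le (by norm_num), Real.rpow_sub_one ht.ne', div_eq_mul_inv (t ^ σ / t), mul_comm,
      ← Real.rpow_neg (by norm_num), div_eq_mul_inv]
    refine mul_le_mul_of_nonneg_right ?_ (by positivity)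
    calc (4 : ℝ) ^ (-(σ - 1)) ≤ 4 ^ (1 : ℝ) := Real.rpow_le_rpow_of_exponent_le (by norm_num) (by linarith)
      _ = 4 := by norm_num
  refine (norm_sub_le _ _).trans ((add_le_add hA hB).trans ?_)
  have hs0 : 0 ≤ 1 / σ := by positivity
  calc 1 / σ * (K * t ^ σ) * (t⁻¹ * W) + (1 / σ + 1) * (K * (x / 2) ^ (σ - 1)) * W
      ≤ 1 / σ * (K * t ^ σ) * (t⁻¹ * W) + (1 / σ + 1) * (K * (4 * (t ^ σ * t⁻¹))) * W := by gcongr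
    _ = _ := by ring

end PowerRegular
end SFOR

namespace SFOR
open MeasureTheory Set

/-! ### Mesh estimates -/

namespace IsGraded

variable {c : ℝ} {t : ℕ → ℝ}

theorem strictMono (h : IsGraded c t) : StrictMono t := strictMono_nat_of_lt_succ h.lt_succ

theorem nonneg (h : IsGraded c t) (k : ℕ) : 0 ≤ t k := h.zero ▸ h.strictMono.monotone (Nat.zero_le k)

theorem pos (h : IsGraded c t) (k : ℕ) : 0 < t (k + 1) := (h.nonneg k).trans_lt (h.lt_succ k)

theorem one_le (h : IsGraded c t) : 1 ≤ c := by
  have h1 := h.succ_le 0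
  have h2 := h.lt_succ 1
  have h3 := h.pos 0
  have : 1 * t 1 ≤ c * t 1 := by rw [one_mul]; exact h2.le.trans h1
  exact le_of_mul_le_mul_right this h3

/-- A local interpolation bound `t_i ^ (σ - m) H ^ m` in terms of the mesh point and its index. -/
theorem rpow_mul_pow_le (h : IsGraded c t) {σ D H : ℝ} (hσ0 : 0 ≤ σ) (m : ℕ) (hσm : σ ≤ m) (i : ℕ)
    (hH : 0 ≤ H) (hHD : H * ((i + 1 : ℕ) + 1) ≤ D * t (i + 2)) :
    t (i + 1) ^ (σ - m) * H ^ m ≤ c ^ m * D ^ m * (t (i + 2) ^ σ * (((i + 2 : ℕ) : ℝ)) ^ (-(m : ℝ))) := by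
  have hc := h.one_le
  have hc0 : 0 < c := by linarith
  have ht1 := h.pos i
  have ht2 := h.pos (i + 1)
  have hk : (0 : ℝ) < ((i + 2 : ℕ) : ℝ) := by positivity
  have hk' : ((i + 2 : ℕ) : ℝ) = ((i + 1 : ℕ) : ℝ) + 1 := by push_cast; ring
  rw [← hk'] at hHD
  have h1 : t (i + 1) ^ (σ - m) ≤ (t (i + 2) / c) ^ (σ - m) :=
    Real.rpow_le_rpow_of_nonpos (by positivity) (by rw [div_le_iff₀ hc0]; linarith [h.succ_le i]) (by linarith)
  have h2 : (t (i + 2) / c) ^ (σ - m) ≤ c ^ m * t (i + 2) ^ (σ - m) := by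
    rw [Real.div_rpow ht2.le hc0.le, div_eq_mul_inv, ← Real.rpow_neg hc0.le, mul_comm]
    refine mul_le_mul_of_nonneg_right ?_ (by positivity)
    rw [← Real.rpow_natCast]
    exact Real.rpow_le_rpow_of_exponent_le hc (by linarith)
  have h3 : H ≤ D * t (i + 2) / ((i + 2 : ℕ) : ℝ) := by rwa [le_div_iff₀ hk]
  calc t (i + 1) ^ (σ - m) * H ^ m ≤ (c ^ m * t (i + 2) ^ (σ - m)) * (D * t (i + 2) / ((i + 2 : ℕ) : ℝ)) ^ m := by
        gcongr; exact h1.trans h2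
    _ = _ := by
        rw [Real.rpow_sub ht2, Real.rpow_neg hk.le, Real.rpow_natCast, Real.rpow_natCast, div_pow, mul_pow]
        have := ht2.ne'
        field_simp

end IsGraded

variable {β : ℝ}

theorem omega_div (k u : ℝ) (hk : 0 < k) (hu : 0 < u) :
    omega (1 - β) (u / k) = k ^ β * omega (1 - β) u := by
  rw [omega_one_sub, omega_one_sub, Real.div_rpow hu.le hk.le, Real.rpow_neg hk.le, div_inv_eq_mul]
  ring

theorem mul_omega_le_integral (hβ0 : 0 < β) (hβ1 : β < 1) {x a b : ℝ} (hab : a ≤ b) (hbx : b ≤ x) :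
    (b - a) * omega (1 - β) (x - a) ≤ ∫ s in a..b, omega (1 - β) (x - s) := by
  have := intervalIntegral.integral_mono_on_of_le_Ioo hab
    (intervalIntegrable_const (c := omega (1 - β) (x - a))) (intervalIntegrable_omega_sub hβ1 x a b)
    fun s hs => omega_anti hβ0 hβ1 (by linarith [hs.2] : 0 < x - s) (by linarith [hs.1])
  simpa using this

/-- Splitting the Caputo integral along the mesh. -/
theorem caputo_integral_split {K σ c : ℝ} {z z₁ z₂ z₃ : ℝ → ℂ} (h : PowerRegular K σ z z₁ z₂ z₃)
    (hσ : 0 < σ) (hβ1 : β < 1) {t : ℕ → ℝ} (ht : IsGraded c t) (m : ℕ) {x : ℝ} (hx : t m ≤ x) :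
    ∫ s in (0 : ℝ)..x, omega (1 - β) (x - s) • z₁ s =
      ∑ i ∈ Finset.range m, (∫ s in (t i)..(t (i + 1)), omega (1 - β) (x - s) • z₁ s) +
        ∫ s in (t m)..x, omega (1 - β) (x - s) • z₁ s := by
  have hi : ∀ a b, 0 ≤ a → a ≤ b → b ≤ x →
      IntervalIntegrable (fun s => omega (1 - β) (x - s) • z₁ s) volume a b := fun a b =>
    h.intervalIntegrable_omega_smul_deriv hσ hβ1
  rw [intervalIntegral.sum_integral_adjacent_intervals
    (fun k hk => hi _ _ (ht.nonneg k) (ht.lt_succ k).le ((ht.strictMono.monotone hk).trans hx)), ht.zero,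
    intervalIntegral.integral_add_adjacent_intervals (hi _ _ le_rfl (ht.nonneg m) hx) (hi _ _ (ht.nonneg m) hx le_rfl)]

/-! ### The `L1` formula -/

theorem kernelL1_zero (t : ℕ → ℝ) (n : ℕ) : kernelL1 β t n 0 = 0 := by simp [kernelL1]

theorem kernelL1_succ (t : ℕ → ℝ) (n i : ℕ) : kernelL1 β t n (i + 1) =
    (t (i + 1) - t i)⁻¹ * ∫ s in (t i)..(t (i + 1)), omega (1 - β) (t n - s) := by
  simp [kernelL1, stepSize]

section L1

variable {c : ℝ} {t : ℕ → ℝ}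

theorem omega_le_kernelL1 (hβ0 : 0 < β) (hβ1 : β < 1) (ht : IsGraded c t) {n i : ℕ} (hi : i < n) :
    omega (1 - β) (t n - t i) ≤ kernelL1 β t n (i + 1) := by
  have hτ : 0 < t (i + 1) - t i := sub_pos.2 (ht.lt_succ i)
  rw [kernelL1_succ, le_inv_mul_iff₀ hτ]
  exact mul_omega_le_integral hβ0 hβ1 (ht.lt_succ i).le (ht.strictMono.monotone hi)

theorem omega_sub_le_kernelL1_sub (hβ0 : 0 < β) (hβ1 : β < 1) (ht : IsGraded c t) {n i : ℕ} (hi : i + 1 < n) :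
    omega (1 - β) (t n - t (i + 1)) - omega (1 - β) (t n - t i) ≤
      2 * (kernelL1 β t n (i + 2) - kernelL1 β t n (i + 1)) := by
  have h1 := omega_le_kernelL1 hβ0 hβ1 ht hi
  have hτ : 0 < t (i + 1) - t i := sub_pos.2 (ht.lt_succ i)
  have h2 : kernelL1 β t n (i + 1) ≤ (omega (1 - β) (t n - t i) + omega (1 - β) (t n - t (i + 1))) / 2 := by
    rw [kernelL1_succ, inv_mul_le_iff₀ hτ]
    refine integral_le_of_convexOn (ht.lt_succ i) ?_ (intervalIntegrable_omega_sub hβ1 _ _ _)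
    exact (convexOn_omega_sub hβ0 hβ1 (t n)).subset
      (fun s hs => hs.2.trans_lt (ht.strictMono hi)) (convex_Icc _ _)
  linarith

theorem kernelL1_mono (hβ0 : 0 < β) (hβ1 : β < 1) (ht : IsGraded c t) {n k : ℕ} (hk : k < n) :
    kernelL1 β t n k ≤ kernelL1 β t n (k + 1) := by
  rcases k with _ | i
  · rw [kernelL1_zero]
    exact (omega_nonneg hβ1 (sub_nonneg.2 (ht.strictMono.monotone hk.le))).trans (omega_le_kernelL1 hβ0 hβ1 ht hk)
  · have h1 := omega_sub_le_kernelL1_sub hβ0 hβ1 ht hk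
    have h2 := omega_anti hβ0 hβ1 (sub_pos.2 (ht.strictMono hk)) (sub_le_sub_left (ht.lt_succ i).le (t n))
    have h3 : kernelL1 β t n (i + 2) = kernelL1 β t n (i + 1 + 1) := rfl
    linarith

theorem kernelL1_self (hβ1 : β < 1) (ht : IsGraded c t) (m : ℕ) :
    kernelL1 β t (m + 1) (m + 1) = omega (1 - β) (t (m + 1) - t m) / (1 - β) := by
  have hτ : 0 < t (m + 1) - t m := sub_pos.2 (ht.lt_succ m)
  rw [kernelL1_succ, integral_omega_sub_eq hβ1 (ht.lt_succ m)]
  field_simp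

/-- The last step size is at least `t_n / n`. -/
theorem omega_step_le (hβ0 : 0 < β) (hβ1 : β < 1) (ht : IsGraded c t) (m : ℕ) :
    omega (1 - β) (t (m + 1) - t m) ≤ ((m + 1 : ℕ) : ℝ) ^ β * omega (1 - β) (t (m + 1)) := by
  have hm : (0 : ℝ) < ((m + 1 : ℕ) : ℝ) := by positivity
  rw [← omega_div _ _ hm (ht.pos m)]
  refine omega_anti hβ0 hβ1 (div_pos (ht.pos m) hm) ?_
  rw [div_le_iff₀ hm]
  have := ht.le_mul_step m
  push_cast; linarith

variable {K σ : ℝ} {z z₁ z₂ z₃ : ℝ → ℂ}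

/-- The linear interpolation error on an interval of the mesh. -/
theorem norm_linear_error_le (h : PowerRegular K σ z z₁ z₂ z₃) (hσ : 0 < σ) (hσ1 : σ ≤ 1) {a b G : ℝ}
    (ha : 0 ≤ a) (hab : a < b) (hG0 : a = 0 → 2 * (K / σ) * b ^ σ ≤ G)
    (hG : 0 < a → K * a ^ (σ - 2) * (b - a) ^ 2 ≤ G) {s : ℝ} (hs : s ∈ Icc a b) :
    ‖z a + (s - a) • ((b - a)⁻¹ • (z b - z a)) - z s‖ ≤ G := by
  have hba : 0 < b - a := sub_pos.2 hab
  rcases ha.eq_or_lt with rfl | ha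
  · refine le_trans ?_ (hG0 rfl)
    have h1 := h.norm_sub_zero_le hσ hba.le
    have h2 := h.norm_sub_zero_le hσ hs.1
    have hK := h.K_nonneg
    simp only [sub_zero] at h1 hba ⊢
    have h3 : ‖s • (b⁻¹ • (z b - z 0))‖ ≤ K / σ * b ^ σ := by
      rw [norm_smul, norm_smul, norm_inv, Real.norm_of_nonneg hs.1, Real.norm_of_nonneg hba.le, ← mul_assoc]
      refine (mul_le_of_le_one_left (norm_nonneg _) ?_).trans h1
      rw [← div_eq_mul_inv]; exact (div_le_one hba).2 hs.2
    have h4 : K / σ * s ^ σ ≤ K / σ * b ^ σ :=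
      mul_le_mul_of_nonneg_left (Real.rpow_le_rpow hs.1 hs.2 hσ.le) (by positivity)
    calc _ = ‖s • (b⁻¹ • (z b - z 0)) - (z s - z 0)‖ := by congr 1; abel
      _ ≤ _ := norm_sub_le _ _
      _ ≤ _ := by linarith
  · refine le_trans ?_ (hG ha)
    have hpos : ∀ u ∈ Icc a b, 0 < u := fun u hu => ha.trans_le hu.1
    have := norm_sub_le_of_deriv_le (f := fun s => z a + (s - a) • ((b - a)⁻¹ • (z b - z a)) - z s)
      (f' := fun s => (b - a)⁻¹ • (z b - z a) - z₁ s)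
      (fun v hv => (((((hasDerivAt_id v).sub_const a).smul_const _).const_add (z a)).sub
        (h.deriv₁ v (hpos v hv))).congr_deriv (by simp))
      (fun v hv => h.norm_avg_sub_deriv_le hσ1 ha hab hv) hs (left_mem_Icc.2 hab.le)
    simp only [sub_self, zero_smul, add_zero, sub_zero] at this
    refine this.trans_eq (by ring)

/-- The consistency error of the `L1` formula, in the form required by the stability theorem. -/
theorem norm_consistencyL1_le (h : PowerRegular K σ z z₁ z₂ z₃) (hσ : 0 < σ) (hσ1 : σ ≤ 1)
    (hβ0 : 0 < β) (hβ1 : β < 1) (ht : IsGraded c t) (G : ℕ → ℝ)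
    (hG1 : (4 + 5 / σ) * K * t 1 ^ σ ≤ G 1)
    (hG : ∀ i, K * t (i + 1) ^ (σ - 2) * (t (i + 2) - t (i + 1)) ^ 2 ≤ G (i + 2)) (m : ℕ) :
    ‖∑ i ∈ Finset.range (m + 1), kernelL1 β t (m + 1) (i + 1) • (z (t (i + 1)) - z (t i)) -
      ∫ s in (0 : ℝ)..(t (m + 1)), omega (1 - β) (t (m + 1) - s) • z₁ s‖ ≤
    kernelL1 β t (m + 1) (m + 1) * G (m + 1) +
      ∑ i ∈ Finset.range m, (kernelL1 β t (m + 1) (i + 2) - kernelL1 β t (m + 1) (i + 1)) * (2 * G (i + 1)) := by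
  set x := t (m + 1) with hx
  have hK := h.K_nonneg
  have hwi : ∀ a b, IntervalIntegrable (fun s => omega (1 - β) (x - s)) volume a b :=
    intervalIntegrable_omega_sub hβ1 x
  have hterm : ∀ i, i < m + 1 → kernelL1 β t (m + 1) (i + 1) • (z (t (i + 1)) - z (t i)) -
      ∫ s in (t i)..(t (i + 1)), omega (1 - β) (x - s) • z₁ s =
      ∫ s in (t i)..(t (i + 1)), omega (1 - β) (x - s) •
        ((t (i + 1) - t i)⁻¹ • (z (t (i + 1)) - z (t i)) - z₁ s) := by
    intro i hi
    simp_rw [smul_sub _ ((t (i + 1) - t i)⁻¹ • (z (t (i + 1)) - z (t i)))]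
    rw [intervalIntegral.integral_sub ((hwi _ _).smul_continuousOn continuousOn_const)
      (h.intervalIntegrable_omega_smul_deriv hσ hβ1 (ht.nonneg i) (ht.lt_succ i).le (ht.strictMono.monotone hi)),
      intervalIntegral.integral_smul_const, kernelL1_succ, smul_smul, mul_comm]
  have hG1' : 2 * (K / σ) * t 1 ^ σ ≤ G 1 := by
    refine le_trans ?_ hG1
    have h1 : 0 ≤ K * t 1 ^ σ := mul_nonneg hK (Real.rpow_nonneg (ht.nonneg 1) _)
    have : (4 + 5 / σ) * K * t 1 ^ σ - 2 * (K / σ) * t 1 ^ σ = (4 + 3 / σ) * (K * t 1 ^ σ) := by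
      field_simp; ring
    have : 0 ≤ (4 + 3 / σ) * (K * t 1 ^ σ) := by positivity
    linarith
  rw [caputo_integral_split h hσ hβ1 ht m (ht.lt_succ m).le, Finset.sum_range_succ, add_sub_add_comm,
    ← Finset.sum_sub_distrib, hterm m (Nat.lt_succ_self m), add_comm]
  refine (norm_add_le _ _).trans (add_le_add ?_ ((norm_sum_le _ _).trans (Finset.sum_le_sum fun i hi => ?_)))
  · rw [kernelL1_succ]
    have hτ : 0 < t (m + 1) - t m := sub_pos.2 (ht.lt_succ m)
    have hI : 0 ≤ ∫ s in (t m)..(t (m + 1)), omega (1 - β) (x - s) :=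
      intervalIntegral.integral_nonneg (ht.lt_succ m).le fun s hs => omega_nonneg hβ1 (by linarith [hs.2])
    rcases m with _ | m
    · rw [zero_add, ht.zero, sub_zero] at *
      have h1 := h.norm_first_interval_le (β := β) hσ hσ1 hβ0 hβ1 (ht.pos 0) (x := t 1) (by linarith)
      rw [zero_add] at h1
      refine h1.trans ?_
      rw [mul_comm]
      exact mul_le_mul_of_nonneg_left hG1 (mul_nonneg (inv_nonneg.2 hτ.le) hI)
    · have h1 : ‖∫ s in (t (m + 1))..(t (m + 1 + 1)), omega (1 - β) (x - s) •
          ((t (m + 1 + 1) - t (m + 1))⁻¹ • (z (t (m + 1 + 1)) - z (t (m + 1))) - z₁ s)‖ ≤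
          ∫ s in (t (m + 1))..(t (m + 1 + 1)), (K * t (m + 1) ^ (σ - 2) * (t (m + 1 + 1) - t (m + 1))) * omega (1 - β) (x - s) := by
        refine intervalIntegral.norm_integral_le_of_norm_le (ht.lt_succ _).le
          (Filter.Eventually.of_forall fun s hs => ?_) ((hwi _ _).const_mul _)
        have hw := omega_nonneg hβ1 (sub_nonneg.2 hs.2)
        rw [norm_smul, Real.norm_of_nonneg hw, mul_comm]
        exact mul_le_mul_of_nonneg_right (h.norm_avg_sub_deriv_le hσ1 (ht.pos m) (ht.lt_succ _) ⟨hs.1.le, hs.2⟩) hw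
      refine h1.trans ?_
      rw [intervalIntegral.integral_const_mul]
      have h2 := mul_le_mul_of_nonneg_left (hG m) (mul_nonneg (inv_nonneg.2 hτ.le) hI)
      refine le_trans (le_of_eq ?_) h2
      field_simp
  · have hi' : i < m := Finset.mem_range.1 hi
    rw [hterm i (by omega)]
    have hab := ht.lt_succ i
    have hpos : ∀ u ∈ Ioo (t i) (t (i + 1)), 0 < u := fun u hu => (ht.nonneg i).trans_lt hu.1
    have hGi : ∀ s ∈ Icc (t i) (t (i + 1)), ‖z (t i) + (s - t i) • ((t (i + 1) - t i)⁻¹ • (z (t (i + 1)) - z (t i))) - z s‖ ≤ G (i + 1) := by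
      intro s hs
      refine norm_linear_error_le h hσ hσ1 (ht.nonneg i) hab ?_ ?_ hs
      · intro h0
        rcases i with _ | i
        · exact hG1'
        · exact absurd h0 (ht.pos i).ne'
      · intro h0
        rcases i with _ | i
        · exact absurd ht.zero h0.ne'
        · exact hG i
    have hGn : 0 ≤ G (i + 1) := (norm_nonneg _).trans (hGi _ (left_mem_Icc.2 hab.le))
    have h1 := norm_integral_omega_smul_deriv_le hβ0 hβ1 hab.le (ht.strictMono (by omega : i + 1 < m + 1))
      (E := fun s => z (t i) + (s - t i) • ((t (i + 1) - t i)⁻¹ • (z (t (i + 1)) - z (t i))) - z s)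
      (E' := fun s => (t (i + 1) - t i)⁻¹ • (z (t (i + 1)) - z (t i)) - z₁ s)
      ((Continuous.continuousOn (by fun_prop)).sub (h.cont.mono fun s hs => (ht.nonneg i).trans hs.1))
      (fun v hv => (((((hasDerivAt_id v).sub_const (t i)).smul_const _).const_add (z (t i))).sub
        (h.deriv₁ v (hpos v hv))).congr_deriv (by simp))
      ((intervalIntegrable_const).sub (h.intervalIntegrable_deriv hσ (ht.nonneg i) hab.le))
      (by simp) (by
        have : t (i + 1) - t i ≠ 0 := (sub_pos.2 hab).ne'
        rw [smul_smul, mul_inv_cancel₀ this, one_smul]; abel) hGi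
    refine h1.trans ?_
    have h2 := omega_sub_le_kernelL1_sub hβ0 hβ1 ht (by omega : i + 1 < m + 1)
    have h3 := mul_le_mul_of_nonneg_left h2 hGn
    linarith

/-- Convergence of the `L1` scheme for a single mode. -/
theorem scalar_convergenceL1 (hβ0 : 0 < β) (hβ1 : β < 1) (hσ : 0 < σ) (hσ1 : σ ≤ 1) {T r : ℝ} (hT : 0 < T)
    (hr : 1 ≤ r) : ∃ C : ℝ, 0 < C ∧ ∀ (K μ : ℝ) (z z₁ z₂ z₃ : ℝ → ℂ) (g : ℝ → ℂ) (N : ℕ) (Z : ℕ → ℂ),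
    PowerRegular K σ z z₁ z₂ z₃ → 1 ≤ N →
    (∀ s ∈ Ioc 0 T, ∫ u in (0 : ℝ)..s, omega (1 - β) (s - u) • z₁ u = Complex.I * μ * z s + g s) →
    Z 0 = z 0 →
    (∀ n < N, ∑ i ∈ Finset.range (n + 1), kernelL1 β (gradedMesh T r N) (n + 1) (i + 1) • (Z (i + 1) - Z i) =
      Complex.I * μ * Z (n + 1) + g (gradedMesh T r N (n + 1))) →
    ∀ n, 1 ≤ n → n ≤ N → ‖z (gradedMesh T r N n) - Z n‖ ≤ C * K * (N : ℝ) ^ (-min (r * σ) (2 - β)) := by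
  set c := max r (2 ^ r) with hc
  have hc1 : 1 ≤ c := hr.trans (le_max_left _ _)
  set D : ℝ := 4 + 5 / σ + c ^ 4 with hD
  have hD0 : 0 < D := by positivity
  refine ⟨2 * (2 * (2 * D) / (1 - β) * T ^ σ), by have : 0 < 1 - β := by linarith
                                                  positivity, ?_⟩
  intro K μ z z₁ z₂ z₃ g N Z h hN heq hZ0 hZ n hn1 hnN
  set t := gradedMesh T r N with htd
  have ht : IsGraded c t := gradedMesh_isGraded T r hT hr N hN
  have hK := h.K_nonneg
  have htN : t N = T := gradedMesh_last T r N hN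
  set G₀ : ℕ → ℝ := fun k => D * K * (t k ^ σ * (k : ℝ) ^ (-(2 : ℝ))) with hG₀
  have hG₀n : ∀ k, 0 ≤ G₀ k := fun k => by have := ht.nonneg k
                                           positivity
  have hcons := norm_consistencyL1_le h hσ hσ1 hβ0 hβ1 ht G₀
    (by
      have h0 := ht.pos 0
      simp only [zero_add] at h0
      simp only [hG₀, Nat.cast_one, Real.one_rpow, mul_one]
      refine mul_le_mul_of_nonneg_right (mul_le_mul_of_nonneg_right ?_ hK) (by positivity)
      rw [hD]; have : 0 < c ^ 4 := by positivity
      linarith)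
    (fun i => by
      have h1 := ht.rpow_mul_pow_le (σ := σ) (D := c) (H := t (i + 2) - t (i + 1)) hσ.le 2 (by push_cast; linarith) i
        (sub_nonneg.2 (ht.lt_succ _).le) (by have := ht.step_mul_le (i + 1); push_cast at this ⊢; exact this)
      have h2 : 0 ≤ t (i + 2) ^ σ * ((i + 2 : ℕ) : ℝ) ^ (-(2 : ℝ)) := by have := ht.nonneg (i + 2); positivity
      simp only [hG₀]
      push_cast at h1 h2 ⊢
      have h3 : c ^ 2 * c ^ 2 ≤ D := by rw [hD, ← pow_add]; norm_num; positivity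
      calc K * t (i + 1) ^ (σ - 2) * (t (i + 2) - t (i + 1)) ^ 2
          = K * (t (i + 1) ^ (σ - 2) * (t (i + 2) - t (i + 1)) ^ 2) := by ring
        _ ≤ K * (c ^ 2 * c ^ 2 * (t (i + 2) ^ σ * ((i : ℝ) + 2) ^ (-(2 : ℝ)))) := by gcongr
        _ ≤ K * (D * (t (i + 2) ^ σ * ((i : ℝ) + 2) ^ (-(2 : ℝ)))) := by gcongr
        _ = _ := by ring)
  have hstab := scheme_stability 0 μ (2 * (2 * D) / (1 - β) * T ^ σ * K * (N : ℝ) ^ (-min (r * σ) (2 - β))) N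
    (kernelL1 β t) (fun k => z (t k) - Z k)
    (fun n => ∑ i ∈ Finset.range n, kernelL1 β t n (i + 1) • (z (t (i + 1)) - z (t i)) -
      ∫ s in (0 : ℝ)..(t n), omega (1 - β) (t n - s) • z₁ s)
    (fun k => if k = 0 then 0 else 2 * G₀ k) (fun _ => 0) le_rfl zero_le_one (kernelL1_zero t)
    (fun n _ k hk => kernelL1_mono hβ0 hβ1 ht hk)
    (fun n _ => by simpa using kernelL1_mono hβ0 hβ1 ht (Nat.lt_succ_self n))
    (fun n _ => by
      rw [kernelL1_self hβ1 ht]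
      exact div_pos (omega_pos hβ1 (sub_pos.2 (ht.lt_succ n))) (by linarith))
    (by simp [hZ0, ht.zero]) (by simp)
    (fun k => by split_ifs; exacts [le_rfl, mul_nonneg zero_le_two (hG₀n k)])
    ?_ ?_ ?_ n hn1 hnN
  · refine hstab.trans_eq (by ring)
  · intro n hn
    have h1 := heq (t (n + 1)) ⟨ht.pos n, by rw [← htN]; exact ht.strictMono.monotone hn⟩
    have h2 := hZ n hn
    simp only [zero_smul, zero_add, sub_zero, one_smul]
    rw [h1]
    have : ∀ i, kernelL1 β t (n + 1) (i + 1) • (z (t (i + 1)) - Z (i + 1) - (z (t i) - Z i)) =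
        kernelL1 β t (n + 1) (i + 1) • (z (t (i + 1)) - z (t i)) - kernelL1 β t (n + 1) (i + 1) • (Z (i + 1) - Z i) := by
      intro i; rw [← smul_sub]; congr 1; abel
    simp_rw [this]
    rw [Finset.sum_sub_distrib, h2]; ring
  · intro n hn
    refine (hcons n).trans ?_
    rw [add_zero, Finset.sum_range_succ' _ n]
    simp only [Nat.add_eq_zero_iff, one_ne_zero, and_false, if_false, if_true, mul_zero, add_zero]
    have h1 := mul_nonneg ((omega_nonneg hβ1 (sub_nonneg.2 (ht.lt_succ n).le)).trans
      (omega_le_kernelL1 hβ0 hβ1 ht (Nat.lt_succ_self n))) (hG₀n (n + 1))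
    linarith
  · intro n hn
    simp only [Nat.add_eq_zero_iff, one_ne_zero, and_false, if_false, add_zero]
    have hβ' : 0 < 1 - β := by linarith
    have h1 := omega_le_kernelL1 hβ0 hβ1 ht (Nat.succ_pos n)
    rw [ht.zero, sub_zero, zero_add] at h1
    have h2 := omega_step_le hβ0 hβ1 ht n
    have h3 := gradedMesh_rate T r σ (2 - β) hT N (n + 1) (by omega) hn
    rw [← htd] at h3
    have hw : 0 ≤ omega (1 - β) (t (n + 1)) := omega_nonneg hβ1 (ht.pos n).le
    have hn0 : (0 : ℝ) < ((n + 1 : ℕ) : ℝ) := by positivity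
    have e1 : ((n + 1 : ℕ) : ℝ) ^ β * ((n + 1 : ℕ) : ℝ) ^ (-(2 : ℝ)) = ((n + 1 : ℕ) : ℝ) ^ (-(2 - β)) := by
      rw [← Real.rpow_add hn0]; congr 1; ring
    rw [kernelL1_self hβ1 ht]
    calc 2 * (omega (1 - β) (t (n + 1) - t n) / (1 - β) * (2 * G₀ (n + 1)))
        ≤ 2 * ((((n + 1 : ℕ) : ℝ) ^ β * omega (1 - β) (t (n + 1))) / (1 - β) * (2 * G₀ (n + 1))) := by
          have := hG₀n (n + 1)
          gcongr
      _ = 2 * (2 * D) / (1 - β) * K * (t (n + 1) ^ σ * (((n + 1 : ℕ) : ℝ) ^ β * ((n + 1 : ℕ) : ℝ) ^ (-(2 : ℝ)))) * omega (1 - β) (t (n + 1)) := by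
          simp only [hG₀]; ring
      _ ≤ 2 * (2 * D) / (1 - β) * K * (T ^ σ * (N : ℝ) ^ (-min (r * σ) (2 - β))) * kernelL1 β t (n + 1) 1 := by
          rw [e1]
          gcongr
      _ = _ := by ring

end L1
end SFOR

namespace SFOR
open MeasureTheory Set

/-! ### The Alikhanov formula -/

variable {β θ : ℝ} {c : ℝ} {t : ℕ → ℝ}

theorem kernelAlikhanov_zero (t : ℕ → ℝ) (n : ℕ) : kernelAlikhanov β θ t n 0 = 0 := by
  simp [kernelAlikhanov, alikhanovA, alikhanovB, stepSize]

theorem alikhanovA_of_lt (t : ℕ → ℝ) {n i : ℕ} (hi : i + 1 < n) : alikhanovA β θ t n (i + 1) =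
    (t (i + 1) - t i)⁻¹ * ∫ s in (t i)..(t (i + 1)), omega (1 - β) (offsetTime θ t n - s) := by
  simp [alikhanovA, stepSize, hi.ne]

theorem alikhanovA_self (t : ℕ → ℝ) (m : ℕ) : alikhanovA β θ t (m + 1) (m + 1) =
    (t (m + 1) - t m)⁻¹ * ∫ s in (t m)..(offsetTime θ t (m + 1)), omega (1 - β) (offsetTime θ t (m + 1) - s) := by
  simp [alikhanovA, stepSize]

theorem alikhanovB_succ (t : ℕ → ℝ) (n i : ℕ) : alikhanovB β θ t n (i + 1) =
    (2 / ((t (i + 1) - t i) * ((t (i + 1) - t i) + (t (i + 2) - t (i + 1))))) *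
      ∫ s in (t i)..(t (i + 1)), (s - (t i + t (i + 1)) / 2) * omega (1 - β) (offsetTime θ t n - s) := by
  simp [alikhanovB, stepSize]

theorem stepRatio_succ (t : ℕ → ℝ) (i : ℕ) :
    stepRatio t (i + 1) = (t (i + 1) - t i) / (t (i + 2) - t (i + 1)) := by
  simp [stepRatio, stepSize]

theorem offsetTime_succ (t : ℕ → ℝ) (m : ℕ) :
    offsetTime θ t (m + 1) = t m + (1 - θ) * (t (m + 1) - t m) := by
  simp [offsetTime]; ring

theorem lt_offsetTime (hθ1 : θ < 1) (ht : IsGraded c t) {m k : ℕ} (hk : k ≤ m) :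
    t k < offsetTime θ t (m + 1) := by
  rw [offsetTime_succ]
  have h1 := ht.strictMono.monotone hk
  have := mul_pos (sub_pos.2 hθ1) (sub_pos.2 (ht.lt_succ m))
  linarith

theorem offsetTime_le (hθ0 : 0 ≤ θ) (ht : IsGraded c t) (m : ℕ) :
    offsetTime θ t (m + 1) ≤ t (m + 1) := by
  rw [offsetTime_succ]
  have := mul_nonneg hθ0 (sub_pos.2 (ht.lt_succ m)).le
  linarith

theorem stepRatio_nonneg (ht : IsGraded c t) (i : ℕ) : 0 ≤ stepRatio t (i + 1) := by
  rw [stepRatio_succ]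
  exact div_nonneg (sub_pos.2 (ht.lt_succ i)).le (sub_pos.2 (ht.lt_succ (i + 1))).le

theorem stepRatio_le_one (ht : IsGraded c t) (i : ℕ) : stepRatio t (i + 1) ≤ 1 := by
  rw [stepRatio_succ, div_le_one (sub_pos.2 (ht.lt_succ (i + 1)))]
  exact ht.step_mono i

theorem alikhanov_subset (hθ1 : θ < 1) (ht : IsGraded c t) {m k : ℕ} (hk : k ≤ m) (a : ℝ) :
    Icc a (t k) ⊆ Iio (offsetTime θ t (m + 1)) :=
  fun _ hs => hs.2.trans_lt (lt_offsetTime hθ1 ht hk)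

theorem alikhanovB_nonneg (hβ0 : 0 < β) (hβ1 : β < 1) (hθ1 : θ < 1) (ht : IsGraded c t) {m i : ℕ}
    (hi : i < m) : 0 ≤ alikhanovB β θ t (m + 1) (i + 1) := by
  have h1 := sub_pos.2 (ht.lt_succ i)
  have h2 := sub_pos.2 (ht.lt_succ (i + 1))
  rw [alikhanovB_succ]
  refine mul_nonneg (by positivity) (integral_sub_midpoint_mul_nonneg (ht.lt_succ i).le ?_)
  exact (monotoneOn_omega_sub hβ0 hβ1 _).mono (alikhanov_subset hθ1 ht hi _)

theorem le_alikhanovA_sub_alikhanovB (hβ0 : 0 < β) (hβ1 : β < 1) (hθ1 : θ < 1) (ht : IsGraded c t) {m i : ℕ}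
    (hi : i < m) : omega (1 - β) (offsetTime θ t (m + 1) - t i) ≤
      alikhanovA β θ t (m + 1) (i + 1) - alikhanovB β θ t (m + 1) (i + 1) := by
  have h1 := sub_pos.2 (ht.lt_succ i)
  have hmono := ht.step_mono i
  set x := offsetTime θ t (m + 1)
  set a := t i
  set b := t (i + 1)
  set w := omega (1 - β) (x - a)
  have hab : a ≤ b := (ht.lt_succ i).le
  have hwm : MonotoneOn (fun s => omega (1 - β) (x - s)) (Icc a b) :=
    (monotoneOn_omega_sub hβ0 hβ1 _).mono (alikhanov_subset hθ1 ht hi _)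
  have hwi := intervalIntegrable_omega_sub hβ1 x a b
  set I := ∫ s in a..b, (s - (a + b) / 2) * omega (1 - β) (x - s) with hI
  set J := ∫ s in a..b, omega (1 - β) (x - s) with hJ
  have hI0 : 0 ≤ I := integral_sub_midpoint_mul_nonneg hab hwm
  have hIJ : I ≤ (b - a) / 2 * (J - (b - a) * w) := by
    have e1 : I = ∫ s in a..b, (s - (a + b) / 2) * (omega (1 - β) (x - s) - w) := by
      simp_rw [mul_sub]
      rw [intervalIntegral.integral_sub (hwi.continuousOn_mul (by fun_prop))
        (by apply Continuous.intervalIntegrable; fun_prop), intervalIntegral.integral_mul_const,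
        intervalIntegral_sub_midpoint]
      simp [hI]
    have e2 : (b - a) / 2 * (J - (b - a) * w) = ∫ s in a..b, (b - a) / 2 * (omega (1 - β) (x - s) - w) := by
      rw [intervalIntegral.integral_const_mul, intervalIntegral.integral_sub hwi (by simp)]
      simp [hJ]
    rw [e1, e2]
    refine intervalIntegral.integral_mono_on hab ((hwi.sub (by simp)).continuousOn_mul (by fun_prop))
      ((hwi.sub (by simp)).const_mul _) fun s hs => ?_
    refine mul_le_mul_of_nonneg_right (by linarith [hs.2]) (sub_nonneg.2 ?_)
    exact hwm (left_mem_Icc.2 hab) hs hs.1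
  rw [alikhanovA_of_lt t (by omega), alikhanovB_succ]
  have hb : 2 / ((b - a) * ((b - a) + (t (i + 2) - b))) * I ≤ (b - a)⁻¹ * (1 / 2 * (J - (b - a) * w)) := by
    calc 2 / ((b - a) * ((b - a) + (t (i + 2) - b))) * I ≤ 2 / ((b - a) * ((b - a) + (b - a))) * I := by
          gcongr
      _ ≤ 2 / ((b - a) * ((b - a) + (b - a))) * ((b - a) / 2 * (J - (b - a) * w)) := by gcongr
      _ = _ := by field_simp; ring
  have hJw : 0 ≤ J - (b - a) * w := sub_nonneg.2 (le_integral_of_monotoneOn hab hwm)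
  have : 0 ≤ (b - a)⁻¹ * (1 / 2 * (J - (b - a) * w)) := by positivity
  have e3 : (b - a)⁻¹ * J - w = 2 * ((b - a)⁻¹ * (1 / 2 * (J - (b - a) * w))) := by field_simp
  show w ≤ (b - a)⁻¹ * J - 2 / ((b - a) * ((b - a) + (t (i + 2) - b))) * I
  linarith

theorem alikhanovA_le (hβ0 : 0 < β) (hβ1 : β < 1) (hθ1 : θ < 1) (ht : IsGraded c t) {m i : ℕ}
    (hi : i < m) : alikhanovA β θ t (m + 1) (i + 1) ≤
      (omega (1 - β) (offsetTime θ t (m + 1) - t i) + omega (1 - β) (offsetTime θ t (m + 1) - t (i + 1))) / 2 := by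
  rw [alikhanovA_of_lt t (by omega), inv_mul_le_iff₀ (sub_pos.2 (ht.lt_succ i))]
  exact integral_le_of_convexOn (ht.lt_succ i) ((convexOn_omega_sub hβ0 hβ1 _).subset
    (alikhanov_subset hθ1 ht hi _) (convex_Icc _ _)) (intervalIntegrable_omega_sub hβ1 _ _ _)

theorem stepRatio_mul_alikhanovB_le (hβ0 : 0 < β) (hβ1 : β < 1) (hθ1 : θ < 1) (ht : IsGraded c t) {m i : ℕ}
    (hi : i + 1 < m) : stepRatio t (i + 1) * alikhanovB β θ t (m + 1) (i + 1) ≤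
      (omega (1 - β) (offsetTime θ t (m + 1) - t (i + 2)) -
        omega (1 - β) (offsetTime θ t (m + 1) - t (i + 1))) / 12 := by
  have h1 := sub_pos.2 (ht.lt_succ i)
  have h2 := sub_pos.2 (ht.lt_succ (i + 1))
  have hmono := ht.step_mono i
  have h := integral_sub_midpoint_mul_le_of_convexOn (ht.lt_succ i).le (ht.lt_succ (i + 1))
    ((convexOn_omega_sub hβ0 hβ1 (offsetTime θ t (m + 1))).subset
      (alikhanov_subset hθ1 ht (by omega : i + 2 ≤ m) _) (convex_Icc _ _))
    (intervalIntegrable_omega_sub hβ1 _ _ _)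
  have hw := monotoneOn_omega_sub hβ0 hβ1 (offsetTime θ t (m + 1)) (lt_offsetTime hθ1 ht (by omega : i + 1 ≤ m))
    (lt_offsetTime hθ1 ht (by omega : i + 2 ≤ m)) (ht.lt_succ (i + 1)).le
  rw [alikhanovB_succ, stepRatio_succ]
  simp only at h hw
  have e : i + 1 + 1 = i + 2 := rfl
  rw [e] at h hw h2
  set p := t (i + 1) - t i with hp
  set q := t (i + 2) - t (i + 1) with hq
  set W := omega (1 - β) (offsetTime θ t (m + 1) - t (i + 2)) - omega (1 - β) (offsetTime θ t (m + 1) - t (i + 1)) with hW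
  have hW0 : 0 ≤ W := sub_nonneg.2 hw
  calc p / q * (2 / (p * (p + q)) * _) ≤ p / q * (2 / (p * (p + q)) * (W / q * (p ^ 3 / 12))) := by
        gcongr
    _ = W / 12 * (2 * p ^ 3 / (q ^ 2 * (p + q))) := by field_simp
    _ ≤ W / 12 * 1 := by
        refine mul_le_mul_of_nonneg_left ?_ (by positivity)
        rw [div_le_one (by positivity)]
        have : p * p ^ 2 ≤ q * p ^ 2 := by gcongr
        nlinarith [mul_self_nonneg p, mul_le_mul hmono hmono h1.le h2.le, mul_pos h1 h2]
    _ = W / 12 := mul_one _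

theorem kernelAlikhanov_of_lt (t : ℕ → ℝ) {m i : ℕ} (hi : i < m) :
    kernelAlikhanov β θ t (m + 1) (i + 1) = alikhanovA β θ t (m + 1) (i + 1) +
      (if i = 0 then 0 else stepRatio t i * alikhanovB β θ t (m + 1) i) - alikhanovB β θ t (m + 1) (i + 1) := by
  rcases i with _ | i <;> simp [kernelAlikhanov, hi]

theorem kernelAlikhanov_self (t : ℕ → ℝ) (m : ℕ) :
    kernelAlikhanov β θ t (m + 1) (m + 1) = alikhanovA β θ t (m + 1) (m + 1) +
      (if m = 0 then 0 else stepRatio t m * alikhanovB β θ t (m + 1) m) := by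
  rcases m with _ | m <;> simp [kernelAlikhanov]

theorem ratio_term_nonneg (hβ0 : 0 < β) (hβ1 : β < 1) (hθ1 : θ < 1) (ht : IsGraded c t) {m i : ℕ}
    (hi : i ≤ m) : 0 ≤ (if i = 0 then 0 else stepRatio t i * alikhanovB β θ t (m + 1) i) := by
  rcases i with _ | i
  · simp
  · simpa using mul_nonneg (stepRatio_nonneg ht i) (alikhanovB_nonneg hβ0 hβ1 hθ1 ht hi)

theorem kernelAlikhanov_le (hβ0 : 0 < β) (hβ1 : β < 1) (hθ1 : θ < 1) (ht : IsGraded c t) {m i : ℕ}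
    (hi : i < m) : kernelAlikhanov β θ t (m + 1) (i + 1) ≤
      omega (1 - β) (offsetTime θ t (m + 1) - t (i + 1)) - 5 / 12 *
        (omega (1 - β) (offsetTime θ t (m + 1) - t (i + 1)) - omega (1 - β) (offsetTime θ t (m + 1) - t i)) := by
  rw [kernelAlikhanov_of_lt t hi]
  have h1 := alikhanovA_le hβ0 hβ1 hθ1 ht hi
  have h2 := alikhanovB_nonneg hβ0 hβ1 hθ1 ht hi
  have hw := monotoneOn_omega_sub hβ0 hβ1 (offsetTime θ t (m + 1)) (lt_offsetTime hθ1 ht hi.le)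
    (lt_offsetTime hθ1 ht hi) (ht.lt_succ i).le
  simp only at hw
  rcases i with _ | i
  · simp only [if_true]; linarith
  · have h3 := stepRatio_mul_alikhanovB_le hβ0 hβ1 hθ1 ht hi
    simp only [Nat.add_eq_zero_iff, one_ne_zero, and_false, if_false]
    have e : i + 1 + 1 = i + 2 := rfl
    rw [e] at *
    linarith

theorem alikhanovA_self_eq (hβ1 : β < 1) (hθ1 : θ < 1) (ht : IsGraded c t) (m : ℕ) :
    alikhanovA β θ t (m + 1) (m + 1) =
      (1 - θ) / (1 - β) * omega (1 - β) (offsetTime θ t (m + 1) - t m) := by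
  have hτ := sub_pos.2 (ht.lt_succ m)
  rw [alikhanovA_self, integral_omega_sub_eq hβ1 (lt_offsetTime hθ1 ht le_rfl)]
  have : offsetTime θ t (m + 1) - t m = (1 - θ) * (t (m + 1) - t m) := by rw [offsetTime_succ]; ring
  nth_rewrite 1 [this]
  field_simp

theorem le_kernelAlikhanov (hβ0 : 0 < β) (hβ1 : β < 1) (hθβ : θ ≤ β) (ht : IsGraded c t) {m i : ℕ}
    (hi : i ≤ m) : omega (1 - β) (offsetTime θ t (m + 1) - t i) ≤ kernelAlikhanov β θ t (m + 1) (i + 1) := by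
  have hθ1 : θ < 1 := by linarith
  have h0 := ratio_term_nonneg hβ0 hβ1 hθ1 ht hi
  rcases hi.lt_or_eq with hi | rfl
  · rw [kernelAlikhanov_of_lt t hi]
    have := le_alikhanovA_sub_alikhanovB hβ0 hβ1 hθ1 ht hi
    linarith
  · rw [kernelAlikhanov_self, alikhanovA_self_eq hβ1 hθ1 ht]
    have hw := omega_nonneg hβ1 (sub_pos.2 (lt_offsetTime hθ1 ht (le_refl i))).le
    have : 1 ≤ (1 - θ) / (1 - β) := by rw [le_div_iff₀ (by linarith)]; linarith
    nlinarith

theorem omega_sub_le_kernelAlikhanov_sub (hβ0 : 0 < β) (hβ1 : β < 1) (hθβ : θ ≤ β) (ht : IsGraded c t) {m i : ℕ}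
    (hi : i < m) : 5 / 12 * (omega (1 - β) (offsetTime θ t (m + 1) - t (i + 1)) -
      omega (1 - β) (offsetTime θ t (m + 1) - t i)) ≤
      kernelAlikhanov β θ t (m + 1) (i + 2) - kernelAlikhanov β θ t (m + 1) (i + 1) := by
  have h1 := kernelAlikhanov_le hβ0 hβ1 (by linarith : θ < 1) ht hi
  have h2 := le_kernelAlikhanov hβ0 hβ1 hθβ ht hi
  have e : i + 1 + 1 = i + 2 := rfl
  rw [e] at h2
  linarith

theorem kernelAlikhanov_mono (hβ0 : 0 < β) (hβ1 : β < 1) (hθβ : θ ≤ β) (ht : IsGraded c t) {m k : ℕ}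
    (hk : k ≤ m) : kernelAlikhanov β θ t (m + 1) k ≤ kernelAlikhanov β θ t (m + 1) (k + 1) := by
  have hθ1 : θ < 1 := by linarith
  rcases k with _ | i
  · rw [kernelAlikhanov_zero]
    exact (omega_nonneg hβ1 (sub_pos.2 (lt_offsetTime hθ1 ht hk)).le).trans (le_kernelAlikhanov hβ0 hβ1 hθβ ht hk)
  · have h1 := omega_sub_le_kernelAlikhanov_sub hβ0 hβ1 hθβ ht hk
    have hw := monotoneOn_omega_sub hβ0 hβ1 (offsetTime θ t (m + 1)) (lt_offsetTime hθ1 ht (by omega : i ≤ m))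
      (lt_offsetTime hθ1 ht hk) (ht.lt_succ i).le
    simp only at hw
    have e : i + 1 + 1 = i + 2 := rfl
    rw [e]; linarith

theorem kernelAlikhanov_offset (hβ0 : 0 < β) (hβ1 : β < 1) (hθβ : θ = β / 2) (ht : IsGraded c t) (m : ℕ) :
    (1 - θ) * kernelAlikhanov β θ t (m + 1) m ≤ (1 - 2 * θ) * kernelAlikhanov β θ t (m + 1) (m + 1) := by
  have hθ1 : θ < 1 := by linarith
  have hw0 := omega_nonneg hβ1 (sub_pos.2 (lt_offsetTime hθ1 ht (le_refl m))).le
  have h1 : (1 - θ) * omega (1 - β) (offsetTime θ t (m + 1) - t m) ≤ (1 - 2 * θ) * kernelAlikhanov β θ t (m + 1) (m + 1) := by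
    rw [kernelAlikhanov_self, alikhanovA_self_eq hβ1 hθ1 ht]
    have h0 := ratio_term_nonneg hβ0 hβ1 hθ1 ht (le_refl m)
    have e : 1 - 2 * θ = 1 - β := by rw [hθβ]; ring
    have : (1 - 2 * θ) * ((1 - θ) / (1 - β) * omega (1 - β) (offsetTime θ t (m + 1) - t m)) =
        (1 - θ) * omega (1 - β) (offsetTime θ t (m + 1) - t m) := by
      rw [e]; have : 1 - β ≠ 0 := by linarith
      field_simp
    rw [mul_add, this]
    have := mul_nonneg (by linarith : 0 ≤ 1 - 2 * θ) h0
    linarith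
  refine le_trans (mul_le_mul_of_nonneg_left ?_ (by linarith)) h1
  rcases m with _ | i
  · rwa [kernelAlikhanov_zero]
  · refine (kernelAlikhanov_le hβ0 hβ1 hθ1 ht (Nat.lt_succ_self i)).trans ?_
    have hw := monotoneOn_omega_sub hβ0 hβ1 (offsetTime θ t (i + 1 + 1)) (lt_offsetTime hθ1 ht (by omega : i ≤ i + 1))
      (lt_offsetTime hθ1 ht le_rfl) (ht.lt_succ i).le
    simp only at hw
    linarith

theorem kernelAlikhanov_self_le (hβ0 : 0 < β) (hβ1 : β < 1) (hθ0 : 0 ≤ θ) (hθβ : θ ≤ 1 / 2) (ht : IsGraded c t) (m : ℕ) :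
    kernelAlikhanov β θ t (m + 1) (m + 1) ≤
      (1 / (1 - β) + 1) * (2 * (((m + 1 : ℕ) : ℝ) ^ β * omega (1 - β) (t (m + 1)))) := by
  have hθ1 : θ < 1 := by linarith
  have hβ' : 0 < 1 - β := by linarith
  have hτ := sub_pos.2 (ht.lt_succ m)
  set w := omega (1 - β) (offsetTime θ t (m + 1) - t m) with hw
  have hw0 : 0 ≤ w := omega_nonneg hβ1 (sub_pos.2 (lt_offsetTime hθ1 ht (le_refl m))).le
  have h1 : kernelAlikhanov β θ t (m + 1) (m + 1) ≤ (1 / (1 - β) + 1) * w := by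
    rw [kernelAlikhanov_self, alikhanovA_self_eq hβ1 hθ1 ht, add_mul, one_mul]
    refine add_le_add (mul_le_mul_of_nonneg_right (by gcongr; linarith) hw0) ?_
    rcases m with _ | i
    · simpa using hw0
    · simp only [Nat.add_eq_zero_iff, one_ne_zero, and_false, if_false]
      have a0 := alikhanovB_nonneg hβ0 hβ1 hθ1 ht (Nat.lt_succ_self i)
      have a1 := le_alikhanovA_sub_alikhanovB hβ0 hβ1 hθ1 ht (Nat.lt_succ_self i)
      have a2 := alikhanovA_le hβ0 hβ1 hθ1 ht (Nat.lt_succ_self i)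
      have a3 := omega_nonneg hβ1 (sub_pos.2 (lt_offsetTime hθ1 ht (by omega : i ≤ i + 1))).le
      have a4 := mul_le_mul_of_nonneg_right (stepRatio_le_one ht i) a0
      have a5 := monotoneOn_omega_sub hβ0 hβ1 (offsetTime θ t (i + 1 + 1)) (lt_offsetTime hθ1 ht (by omega : i ≤ i + 1))
        (lt_offsetTime hθ1 ht le_rfl) (ht.lt_succ i).le
      simp only at a5
      linarith
  refine h1.trans (mul_le_mul_of_nonneg_left ?_ (by positivity))
  have h2 : w ≤ omega (1 - β) ((t (m + 1) - t m) / 2) := by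
    refine omega_anti hβ0 hβ1 (by positivity) ?_
    rw [offsetTime_succ]
    nlinarith
  refine h2.trans ?_
  rw [omega_div _ _ two_pos hτ]
  have h3 : (2 : ℝ) ^ β ≤ 2 := by
    calc (2 : ℝ) ^ β ≤ 2 ^ (1 : ℝ) := Real.rpow_le_rpow_of_exponent_le (by norm_num) hβ1.le
      _ = 2 := Real.rpow_one 2
  exact mul_le_mul h3 (omega_step_le hβ0 hβ1 ht m) (omega_nonneg hβ1 hτ.le) (by norm_num)

/-! ### Quadratic interpolation -/

/-- The slope of the derivative of the quadratic interpolant through `a < b < d`. -/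
def quadCurvature (a b d : ℝ) (za zb zd : ℂ) : ℂ :=
  (2 / ((b - a) * ((b - a) + (d - b)))) • (((b - a) / (d - b)) • (zd - zb) - (zb - za))

/-- Error of quadratic interpolation, stable under perturbation by quadratic polynomials. -/
theorem norm_quadratic_error_le {z : ℝ → ℂ} {a b d s δ : ℝ} (hab : a < b) (hbd : b - a ≤ d - b)
    (hs : s ∈ Icc a b) (A B C : ℂ)
    (hδ : ∀ u ∈ Icc a d, ‖z u - A - (u - a) • B - ((u - a) ^ 2 / 2) • C‖ ≤ δ) :
    ‖z a + (s - a) • ((b - a)⁻¹ • (z b - z a)) +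
      ((s - a) * (s - b) / 2) • quadCurvature a b d (z a) (z b) (z d) - z s‖ ≤ 6 * δ := by
  have hp : 0 < b - a := sub_pos.2 hab
  have hq : 0 < d - b := hp.trans_le hbd
  set y : ℝ → ℂ := fun u => z u - A - (u - a) • B - ((u - a) ^ 2 / 2) • C with hy
  have ha := hδ a ⟨le_rfl, by linarith⟩
  have hb := hδ b ⟨hab.le, by linarith⟩
  have hd := hδ d ⟨by linarith, le_rfl⟩
  have hss := hδ s ⟨hs.1, by linarith [hs.2]⟩
  change ‖y a‖ ≤ δ at ha
  change ‖y b‖ ≤ δ at hb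
  change ‖y d‖ ≤ δ at hd
  change ‖y s‖ ≤ δ at hss
  have e : z a + (s - a) • ((b - a)⁻¹ • (z b - z a)) +
      ((s - a) * (s - b) / 2) • quadCurvature a b d (z a) (z b) (z d) - z s =
      y a + (s - a) • ((b - a)⁻¹ • (y b - y a)) +
      ((s - a) * (s - b) / 2) • quadCurvature a b d (y a) (y b) (y d) - y s := by
    have hp' : ((b : ℂ) - a) ≠ 0 := by exact_mod_cast hp.ne'
    have hq' : ((d : ℂ) - b) ≠ 0 := by exact_mod_cast hq.ne'
    have hpq : ((b : ℂ) - a) + (d - b) ≠ 0 := by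
      have : (b - a) + (d - b) ≠ 0 := by linarith
      exact_mod_cast this
    simp only [hy, quadCurvature, Complex.real_smul]
    push_cast
    have hpq2 : (d : ℂ) - a ≠ 0 := by convert hpq using 1; ring
    have hpq3 : (b : ℂ) - a + (d - b) = d - a := by ring
    rw [hpq3]
    field_simp
    ring
  rw [e]
  have h1 : ‖(s - a) • ((b - a)⁻¹ • (y b - y a))‖ ≤ 2 * δ := by
    rw [norm_smul, norm_smul, norm_inv, Real.norm_of_nonneg (sub_nonneg.2 hs.1), Real.norm_of_nonneg hp.le, ← mul_assoc]
    refine (mul_le_of_le_one_left (norm_nonneg _) ?_).trans ((norm_sub_le _ _).trans (by linarith))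
    rw [← div_eq_mul_inv, div_le_one hp]; linarith [hs.2]
  have h2 : ‖((s - a) * (s - b) / 2) • quadCurvature a b d (y a) (y b) (y d)‖ ≤ 2 * δ := by
    rw [quadCurvature, smul_smul, norm_smul]
    have h3 : ‖((b - a) / (d - b)) • (y d - y b) - (y b - y a)‖ ≤ 4 * δ := by
      have h4 : ‖((b - a) / (d - b)) • (y d - y b)‖ ≤ 2 * δ := by
        rw [norm_smul, Real.norm_of_nonneg (div_nonneg hp.le hq.le)]
        refine (mul_le_of_le_one_left (norm_nonneg _) ((div_le_one hq).2 hbd)).trans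
          ((norm_sub_le _ _).trans (by linarith))
      refine (norm_sub_le _ _).trans ?_
      have := norm_sub_le (y b) (y a)
      linarith
    have h5 : ‖(s - a) * (s - b) / 2 * (2 / ((b - a) * ((b - a) + (d - b))))‖ ≤ 1 / 2 := by
      rw [Real.norm_eq_abs, abs_mul, abs_div, abs_mul, abs_of_nonneg (sub_nonneg.2 hs.1),
        abs_of_nonpos (by linarith [hs.2] : s - b ≤ 0), abs_of_pos (by positivity : (0 : ℝ) < 2),
        abs_of_pos (by positivity : 0 < 2 / ((b - a) * ((b - a) + (d - b))))]
      have h6 : (s - a) * -(s - b) ≤ (b - a) * (b - a) :=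
        mul_le_mul (by linarith [hs.2]) (by linarith [hs.1]) (by linarith [hs.2]) hp.le
      rw [div_mul_div_comm, div_le_div_iff₀ (by positivity) (by norm_num)]
      nlinarith [mul_le_mul_of_nonneg_left hbd hp.le]
    have := mul_le_mul h5 h3 (norm_nonneg _) (by norm_num)
    linarith
  have t1 := norm_sub_le (y a + (s - a) • ((b - a)⁻¹ • (y b - y a)) +
      ((s - a) * (s - b) / 2) • quadCurvature a b d (y a) (y b) (y d)) (y s)
  have t2 := norm_add_le (y a + (s - a) • ((b - a)⁻¹ • (y b - y a)))
      (((s - a) * (s - b) / 2) • quadCurvature a b d (y a) (y b) (y d))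
  have t3 := norm_add_le (y a) ((s - a) • ((b - a)⁻¹ • (y b - y a)))
  linarith

end SFOR

namespace SFOR
open MeasureTheory Set

variable {β θ : ℝ} {c : ℝ} {t : ℕ → ℝ} {K σ : ℝ} {z z₁ z₂ z₃ : ℝ → ℂ}

theorem sum_kernelAlikhanov (t : ℕ → ℝ) (m : ℕ) (f : ℕ → ℂ) :
    ∑ i ∈ Finset.range (m + 1), kernelAlikhanov β θ t (m + 1) (i + 1) • f i =
      ∑ i ∈ Finset.range m, (alikhanovA β θ t (m + 1) (i + 1) • f i +
        alikhanovB β θ t (m + 1) (i + 1) • (stepRatio t (i + 1) • f (i + 1) - f i)) +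
      alikhanovA β θ t (m + 1) (m + 1) • f m := by
  have h1 : ∑ i ∈ Finset.range m, kernelAlikhanov β θ t (m + 1) (i + 1) • f i =
      ∑ i ∈ Finset.range m, (alikhanovA β θ t (m + 1) (i + 1) • f i - alikhanovB β θ t (m + 1) (i + 1) • f i) +
      ∑ i ∈ Finset.range m, (if i = 0 then 0 else stepRatio t i * alikhanovB β θ t (m + 1) i) • f i := by
    rw [← Finset.sum_add_distrib]
    refine Finset.sum_congr rfl fun i hi => ?_
    rw [kernelAlikhanov_of_lt t (Finset.mem_range.1 hi), sub_smul, add_smul]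
    abel
  have h2 : ∑ i ∈ Finset.range (m + 1), (if i = 0 then 0 else stepRatio t i * alikhanovB β θ t (m + 1) i) • f i =
      ∑ i ∈ Finset.range m, (alikhanovB β θ t (m + 1) (i + 1) * stepRatio t (i + 1)) • f (i + 1) := by
    rw [Finset.sum_range_succ']
    simp [mul_comm]
  have h3 : ∑ i ∈ Finset.range m, (alikhanovA β θ t (m + 1) (i + 1) • f i +
        alikhanovB β θ t (m + 1) (i + 1) • (stepRatio t (i + 1) • f (i + 1) - f i)) =
      ∑ i ∈ Finset.range m, (alikhanovA β θ t (m + 1) (i + 1) • f i - alikhanovB β θ t (m + 1) (i + 1) • f i) +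
      ∑ i ∈ Finset.range m, (alikhanovB β θ t (m + 1) (i + 1) * stepRatio t (i + 1)) • f (i + 1) := by
    rw [← Finset.sum_add_distrib]
    refine Finset.sum_congr rfl fun i hi => ?_
    rw [smul_sub, smul_smul]; abel
  rw [Finset.sum_range_succ, h1, h3, ← h2, Finset.sum_range_succ, kernelAlikhanov_self, add_smul]
  abel

/-- Consistency of the quadratic formula on an interior interval. -/
theorem norm_interior_consistency_le (h : PowerRegular K σ z z₁ z₂ z₃) (hσ : 0 < σ) (hσ1 : σ ≤ 1)
    (hβ0 : 0 < β) (hβ1 : β < 1) (hθ1 : θ < 1) (ht : IsGraded c t) {G : ℕ → ℝ}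
    (hG1 : K / σ * t 2 ^ σ ≤ G 1)
    (hG : ∀ i, 2 * (K * t (i + 1) ^ (σ - 3) * (t (i + 3) - t (i + 1)) ^ 3) ≤ G (i + 2)) {m i : ℕ} (hi : i < m) :
    ‖alikhanovA β θ t (m + 1) (i + 1) • (z (t (i + 1)) - z (t i)) +
        alikhanovB β θ t (m + 1) (i + 1) • (stepRatio t (i + 1) • (z (t (i + 2)) - z (t (i + 1))) - (z (t (i + 1)) - z (t i))) -
      ∫ s in (t i)..(t (i + 1)), omega (1 - β) (offsetTime θ t (m + 1) - s) • z₁ s‖ ≤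
    6 * G (i + 1) * (omega (1 - β) (offsetTime θ t (m + 1) - t (i + 1)) - omega (1 - β) (offsetTime θ t (m + 1) - t i)) := by
  set x := offsetTime θ t (m + 1) with hx
  have hK := h.K_nonneg
  have hab := ht.lt_succ i
  have hbd := ht.step_mono i
  have ha := ht.nonneg i
  have hbx : t (i + 1) < x := lt_offsetTime hθ1 ht hi
  set p := (t (i + 1) - t i)⁻¹ • (z (t (i + 1)) - z (t i)) with hp
  set κ := quadCurvature (t i) (t (i + 1)) (t (i + 2)) (z (t i)) (z (t (i + 1))) (z (t (i + 2))) with hκ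
  have hwi := intervalIntegrable_omega_sub hβ1 x (t i) (t (i + 1))
  have hterm : alikhanovA β θ t (m + 1) (i + 1) • (z (t (i + 1)) - z (t i)) +
        alikhanovB β θ t (m + 1) (i + 1) • (stepRatio t (i + 1) • (z (t (i + 2)) - z (t (i + 1))) - (z (t (i + 1)) - z (t i))) -
      ∫ s in (t i)..(t (i + 1)), omega (1 - β) (x - s) • z₁ s =
      ∫ s in (t i)..(t (i + 1)), omega (1 - β) (x - s) • (p + (s - (t i + t (i + 1)) / 2) • κ - z₁ s) := by
    have e : ∀ s, omega (1 - β) (x - s) • (p + (s - (t i + t (i + 1)) / 2) • κ - z₁ s) =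
        (omega (1 - β) (x - s) • p + ((s - (t i + t (i + 1)) / 2) * omega (1 - β) (x - s)) • κ) - omega (1 - β) (x - s) • z₁ s := by
      intro s
      rw [smul_sub _ (p + _), smul_add, smul_smul _ (s - (t i + t (i + 1)) / 2) κ, mul_comm (omega _ _)]
    have hm : IntervalIntegrable (fun s => (s - (t i + t (i + 1)) / 2) * omega (1 - β) (x - s)) volume (t i) (t (i + 1)) :=
      hwi.continuousOn_mul (by fun_prop)
    simp_rw [e]
    rw [intervalIntegral.integral_sub ((hwi.smul_continuousOn continuousOn_const).add (hm.smul_continuousOn continuousOn_const))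
      (h.intervalIntegrable_omega_smul_deriv hσ hβ1 ha hab.le hbx.le),
      intervalIntegral.integral_add (hwi.smul_continuousOn continuousOn_const) (hm.smul_continuousOn continuousOn_const),
      intervalIntegral.integral_smul_const, intervalIntegral.integral_smul_const, alikhanovA_of_lt t (by omega),
      alikhanovB_succ, hp, hκ, quadCurvature, stepRatio_succ, smul_smul, smul_smul, mul_comm, mul_comm (2 / _)]
  have hE : ∀ s ∈ Icc (t i) (t (i + 1)), ‖z (t i) + (s - t i) • p + ((s - t i) * (s - t (i + 1)) / 2) • κ - z s‖ ≤ 6 * G (i + 1) := by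
    intro s hs
    rcases i with _ | i
    · refine norm_quadratic_error_le hab hbd hs (z 0) 0 0 fun u hu => ?_
      simp only [smul_zero, sub_zero]
      rw [ht.zero] at hu
      refine (h.norm_sub_zero_le hσ hu.1).trans (le_trans ?_ hG1)
      exact mul_le_mul_of_nonneg_left (Real.rpow_le_rpow hu.1 hu.2 hσ.le) (by positivity)
    · refine norm_quadratic_error_le hab hbd hs (z (t (i + 1))) (z₁ (t (i + 1))) (z₂ (t (i + 1))) fun u hu => ?_
      refine (h.taylor_bounds hσ1 (ht.pos i) hu).2.trans (le_trans ?_ (hG i))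
      have h0 : 0 ≤ K * t (i + 1) ^ (σ - 3) * (t (i + 3) - t (i + 1)) ^ 3 := by
        have h2 := (ht.pos i).le
        have h3 : 0 ≤ t (i + 3) - t (i + 1) := sub_nonneg.2 (ht.strictMono.monotone (by omega))
        positivity
      have e : i + 1 + 2 = i + 3 := rfl
      rw [e]; linarith
  rw [hterm]
  refine norm_integral_omega_smul_deriv_le hβ0 hβ1 hab.le hbx
    (E := fun s => z (t i) + (s - t i) • p + ((s - t i) * (s - t (i + 1)) / 2) • κ - z s)
    (E' := fun s => p + (s - (t i + t (i + 1)) / 2) • κ - z₁ s) ?_ ?_ ?_ ?_ ?_ hE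
  · exact (Continuous.continuousOn (by fun_prop)).sub (h.cont.mono fun s hs => ha.trans hs.1)
  · intro v hv
    have e1 : HasDerivAt (fun s => (s - t i) * (s - t (i + 1)) / 2) (v - (t i + t (i + 1)) / 2) v := by
      have := (((hasDerivAt_id v).sub_const (t i)).mul ((hasDerivAt_id v).sub_const (t (i + 1)))).div_const 2
      refine this.congr_deriv ?_
      simp; ring
    have e2 := (((((hasDerivAt_id v).sub_const (t i)).smul_const p).const_add (z (t i))).add (e1.smul_const κ)).sub
        (h.deriv₁ v (ha.trans_lt hv.1))
    exact e2.congr_deriv (by simp)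
  · exact (Continuous.intervalIntegrable (by fun_prop) _ _).sub (h.intervalIntegrable_deriv hσ ha hab.le)
  · simp
  · have : t (i + 1) - t i ≠ 0 := (sub_pos.2 hab).ne'
    simp only [hp]
    rw [smul_smul, mul_inv_cancel₀ this, one_smul]; simp

/-- Consistency of the Alikhanov formula on the last interval. -/
theorem norm_last_consistency_le (h : PowerRegular K σ z z₁ z₂ z₃) (hσ : 0 < σ) (hσ1 : σ ≤ 1)
    (hβ0 : 0 < β) (hβ1 : β < 1) (hθβ : θ = β / 2) (ht : IsGraded c t) {G : ℕ → ℝ}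
    (hG1 : (4 + 5 / σ) * K * t 1 ^ σ ≤ G 1)
    (hG : ∀ i, 2 * (K * t (i + 1) ^ (σ - 3) * (t (i + 3) - t (i + 1)) ^ 3) ≤ G (i + 2)) (m : ℕ) :
    ‖alikhanovA β θ t (m + 1) (m + 1) • (z (t (m + 1)) - z (t m)) -
      ∫ s in (t m)..(offsetTime θ t (m + 1)), omega (1 - β) (offsetTime θ t (m + 1) - s) • z₁ s‖ ≤
    alikhanovA β θ t (m + 1) (m + 1) * G (m + 1) := by
  have hθ1 : θ < 1 := by linarith
  set x := offsetTime θ t (m + 1) with hx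
  have hK := h.K_nonneg
  have hab := ht.lt_succ m
  have hτ : 0 < t (m + 1) - t m := sub_pos.2 hab
  have hax : t m < x := lt_offsetTime hθ1 ht le_rfl
  have hxb : x ≤ t (m + 1) := offsetTime_le (by linarith) ht m
  have hxe : x = t m + (1 - θ) * (t (m + 1) - t m) := offsetTime_succ t m
  set p := (t (m + 1) - t m)⁻¹ • (z (t (m + 1)) - z (t m)) with hp
  have hwi := intervalIntegrable_omega_sub hβ1 x (t m) x
  have hzi := h.intervalIntegrable_omega_smul_deriv hσ hβ1 (ht.nonneg m) hax.le (le_refl x)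
  have hI : 0 ≤ ∫ s in (t m)..x, omega (1 - β) (x - s) :=
    intervalIntegral.integral_nonneg hax.le fun s hs => omega_nonneg hβ1 (by linarith [hs.2])
  have hterm : alikhanovA β θ t (m + 1) (m + 1) • (z (t (m + 1)) - z (t m)) -
      ∫ s in (t m)..x, omega (1 - β) (x - s) • z₁ s =
      ∫ s in (t m)..x, omega (1 - β) (x - s) • (p - z₁ s) := by
    simp_rw [smul_sub _ p]
    rw [intervalIntegral.integral_sub (hwi.smul_continuousOn continuousOn_const) hzi,
      intervalIntegral.integral_smul_const, alikhanovA_self, smul_smul, mul_comm]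
  rw [hterm, alikhanovA_self]
  rcases m with _ | m
  · rw [zero_add] at *
    rw [ht.zero, sub_zero] at *
    have h1 := h.norm_first_interval_le (β := β) hσ hσ1 hβ0 hβ1 hτ (x := x) (by rw [hxe]; nlinarith)
    rw [hp]
    refine h1.trans ?_
    rw [mul_comm]
    exact mul_le_mul_of_nonneg_left hG1 (mul_nonneg (inv_nonneg.2 hτ.le) hI)
  · have ha := ht.pos m
    set a := t (m + 1) with haa
    set H := t (m + 1 + 1) - a with hH
    have hmom : ∫ s in a..x, omega (1 - β) (x - s) * (s - (a + H / 2)) = 0 := by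
      have := integral_omega_sub_mul_midpoint hβ0 hβ1 (a := a) hτ
      rw [← hθβ, ← hxe] at this
      exact this
    have hmi : IntervalIntegrable (fun s => omega (1 - β) (x - s) * (s - (a + H / 2))) volume a x :=
      hwi.mul_continuousOn (by fun_prop)
    have e : ∫ s in a..x, omega (1 - β) (x - s) • (p - z₁ s) =
        ∫ s in a..x, omega (1 - β) (x - s) • (p + (s - (a + H / 2)) • z₂ a - z₁ s) := by
      have e1 : ∀ s, omega (1 - β) (x - s) • (p + (s - (a + H / 2)) • z₂ a - z₁ s) =
          omega (1 - β) (x - s) • (p - z₁ s) + (omega (1 - β) (x - s) * (s - (a + H / 2))) • z₂ a := by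
        intro s
        rw [mul_smul, ← smul_add]; congr 1; abel
      simp_rw [e1]
      rw [intervalIntegral.integral_add ?_ (hmi.smul_continuousOn continuousOn_const),
        intervalIntegral.integral_smul_const, hmom, zero_smul, add_zero]
      simp_rw [smul_sub _ p]
      exact (hwi.smul_continuousOn continuousOn_const).sub hzi
    rw [e]
    have h1 : ‖∫ s in a..x, omega (1 - β) (x - s) • (p + (s - (a + H / 2)) • z₂ a - z₁ s)‖ ≤
        ∫ s in a..x, (2 * (K * a ^ (σ - 3) * H ^ 2)) * omega (1 - β) (x - s) := by
      refine intervalIntegral.norm_integral_le_of_norm_le hax.le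
        (Filter.Eventually.of_forall fun s hs => ?_) (hwi.const_mul _)
      have hw := omega_nonneg hβ1 (sub_nonneg.2 hs.2)
      rw [norm_smul, Real.norm_of_nonneg hw, mul_comm]
      exact mul_le_mul_of_nonneg_right
        (h.norm_avg_add_sub_deriv_le hσ1 ha hab ⟨hs.1.le, hs.2.trans hxb⟩) hw
    refine h1.trans ?_
    rw [intervalIntegral.integral_const_mul]
    have hG' : 2 * (K * a ^ (σ - 3) * H ^ 3) ≤ G (m + 1 + 1) := by
      refine le_trans ?_ (hG m)
      have h3 : H ≤ t (m + 3) - a := sub_le_sub_right (ht.lt_succ (m + 2)).le _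
      gcongr
    have h2 := mul_le_mul_of_nonneg_left hG' (mul_nonneg (inv_nonneg.2 hτ.le) hI)
    refine le_trans (le_of_eq ?_) h2
    field_simp

theorem norm_consistencyAlikhanov_le (h : PowerRegular K σ z z₁ z₂ z₃) (hσ : 0 < σ) (hσ1 : σ ≤ 1)
    (hβ0 : 0 < β) (hβ1 : β < 1) (hθβ : θ = β / 2) (ht : IsGraded c t) {G : ℕ → ℝ} (hGn : ∀ k, 0 ≤ G k)
    (hG1 : (4 + 5 / σ) * K * t 1 ^ σ ≤ G 1) (hG1' : K / σ * t 2 ^ σ ≤ G 1)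
    (hG : ∀ i, 2 * (K * t (i + 1) ^ (σ - 3) * (t (i + 3) - t (i + 1)) ^ 3) ≤ G (i + 2)) (m : ℕ) :
    ‖∑ i ∈ Finset.range (m + 1), kernelAlikhanov β θ t (m + 1) (i + 1) • (z (t (i + 1)) - z (t i)) -
      ∫ s in (0 : ℝ)..(offsetTime θ t (m + 1)), omega (1 - β) (offsetTime θ t (m + 1) - s) • z₁ s‖ ≤
    kernelAlikhanov β θ t (m + 1) (m + 1) * G (m + 1) +
      ∑ i ∈ Finset.range m, (kernelAlikhanov β θ t (m + 1) (i + 2) - kernelAlikhanov β θ t (m + 1) (i + 1)) * (15 * G (i + 1)) := by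
  have hθ1 : θ < 1 := by linarith
  rw [sum_kernelAlikhanov t m (fun i => z (t (i + 1)) - z (t i)),
    caputo_integral_split h hσ hβ1 ht m (lt_offsetTime hθ1 ht (le_refl m)).le, add_sub_add_comm,
    ← Finset.sum_sub_distrib, add_comm]
  refine (norm_add_le _ _).trans (add_le_add ?_ ((norm_sum_le _ _).trans (Finset.sum_le_sum fun i hi => ?_)))
  · refine (norm_last_consistency_le h hσ hσ1 hβ0 hβ1 hθβ ht hG1 hG m).trans ?_
    refine mul_le_mul_of_nonneg_right ?_ (hGn _)
    rw [kernelAlikhanov_self]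
    have := ratio_term_nonneg hβ0 hβ1 hθ1 ht (le_refl m)
    linarith
  · have hi' := Finset.mem_range.1 hi
    refine (norm_interior_consistency_le h hσ hσ1 hβ0 hβ1 hθ1 ht hG1' hG hi').trans ?_
    have h2 := mul_le_mul_of_nonneg_left (omega_sub_le_kernelAlikhanov_sub hβ0 hβ1 (by linarith : θ ≤ β) ht hi') (hGn (i + 1))
    have h3 := kernelAlikhanov_mono hβ0 hβ1 (by linarith : θ ≤ β) ht (Nat.succ_le_of_lt hi')
    have h4 := mul_nonneg (sub_nonneg.2 h3) (hGn (i + 1))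
    change 0 ≤ (kernelAlikhanov β θ t (m + 1) (i + 2) - kernelAlikhanov β θ t (m + 1) (i + 1)) * _ at h4
    linarith

/-- Convergence of the Alikhanov scheme for a single mode. -/
theorem scalar_convergenceAlikhanov (hβ0 : 0 < β) (hβ1 : β < 1) (hσ : 0 < σ) (hσ1 : σ ≤ 1) {T r : ℝ} (hT : 0 < T)
    (hr : 1 ≤ r) : ∃ C : ℝ, 0 < C ∧ ∀ (K μ : ℝ) (z z₁ z₂ z₃ : ℝ → ℂ) (g : ℝ → ℂ) (N : ℕ) (Z : ℕ → ℂ),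
    PowerRegular K σ z z₁ z₂ z₃ → 1 ≤ N → 0 ≤ μ →
    (∀ s ∈ Ioc 0 T, ∫ u in (0 : ℝ)..s, omega (1 - β) (s - u) • z₁ u = Complex.I * μ * z s + g s) →
    Z 0 = z 0 →
    (∀ n < N, ∑ i ∈ Finset.range (n + 1), kernelAlikhanov β (β / 2) (gradedMesh T r N) (n + 1) (i + 1) • (Z (i + 1) - Z i) =
      Complex.I * μ * ((β / 2) • Z n + (1 - β / 2) • Z (n + 1)) + g (offsetTime (β / 2) (gradedMesh T r N) (n + 1))) →
    ∀ n, 1 ≤ n → n ≤ N → ‖z (gradedMesh T r N n) - Z n‖ ≤ C * (K * (1 + μ)) * (N : ℝ) ^ (-min (r * σ) 2) := by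
  set c := max r (2 ^ r) with hc
  have hc1 : 1 ≤ c := hr.trans (le_max_left _ _)
  set θ := β / 2 with hθ
  have hθ0 : 0 ≤ θ := by positivity
  have hθ1 : θ < 1 := by linarith
  have hβ' : 0 < 1 - β := by linarith
  set D : ℝ := 4 + 5 / σ + c / σ + 2 * (c ^ 3 * (2 * c ^ 2) ^ 3) + c ^ 4 with hD
  have hD0 : 0 < D := by positivity
  have hT0 : 0 < omega (1 - β) T := omega_pos hβ1 hT
  set C₁ := 60 * (1 / (1 - β) + 1) * D * T ^ σ with hC₁
  set C₂ := D * T ^ σ / omega (1 - β) T with hC₂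
  refine ⟨2 * (C₁ + C₂), by positivity, ?_⟩
  intro K μ z z₁ z₂ z₃ g N Z h hN hμ heq hZ0 hZ n hn1 hnN
  set t := gradedMesh T r N with htd
  have ht : IsGraded c t := gradedMesh_isGraded T r hT hr N hN
  have hK := h.K_nonneg
  have htN : t N = T := gradedMesh_last T r N hN
  set q := (N : ℝ) ^ (-min (r * σ) 2) with hq
  set G₀ : ℕ → ℝ := fun k => D * K * (t k ^ σ * (k : ℝ) ^ (-(3 : ℝ))) with hG₀
  have hG₀n : ∀ k, 0 ≤ G₀ k := fun k => by have := ht.nonneg k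
                                           positivity
  have ht1 : 0 < t 1 := ht.pos 0
  have hcons := norm_consistencyAlikhanov_le h hσ hσ1 hβ0 hβ1 hθ ht hG₀n
    (by
      simp only [hG₀, Nat.cast_one, Real.one_rpow, mul_one]
      refine mul_le_mul_of_nonneg_right (mul_le_mul_of_nonneg_right ?_ hK) (by positivity)
      have : 0 ≤ c / σ + 2 * (c ^ 3 * (2 * c ^ 2) ^ 3) + c ^ 4 := by positivity
      rw [hD]; linarith)
    (by
      simp only [hG₀, Nat.cast_one, Real.one_rpow, mul_one]
      have h2 : t 2 ^ σ ≤ c * t 1 ^ σ := by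
        calc t 2 ^ σ ≤ (c * t 1) ^ σ := Real.rpow_le_rpow (ht.nonneg 2) (ht.succ_le 0) hσ.le
          _ = c ^ σ * t 1 ^ σ := Real.mul_rpow (by linarith) ht1.le
          _ ≤ c ^ (1 : ℝ) * t 1 ^ σ := by gcongr
          _ = _ := by rw [Real.rpow_one]
      calc K / σ * t 2 ^ σ ≤ K / σ * (c * t 1 ^ σ) := by gcongr
        _ = (c / σ) * K * t 1 ^ σ := by ring
        _ ≤ D * K * t 1 ^ σ := by
          gcongr
          have : 0 ≤ 4 + 5 / σ + 2 * (c ^ 3 * (2 * c ^ 2) ^ 3) + c ^ 4 := by positivity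
          rw [hD]; linarith)
    (fun i => by
      have h1 := ht.rpow_mul_pow_le (σ := σ) (D := 2 * c ^ 2) (H := t (i + 3) - t (i + 1)) hσ.le 3 (by push_cast; linarith) i
        (sub_nonneg.2 (ht.strictMono.monotone (by omega)))
        (by
          have a1 := ht.step_mul_le (i + 2)
          have a2 := ht.step_mono (i + 1)
          have a3 := ht.succ_le (i + 1)
          have a4 := sub_pos.2 (ht.lt_succ (i + 2))
          push_cast at a1 ⊢
          have e1 : i + 2 + 1 = i + 3 := rfl
          have e2 : i + 1 + 2 = i + 3 := rfl
          have e3 : i + 1 + 1 = i + 2 := rfl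
          rw [e1] at a1 a4
          rw [e2, e3] at a2
          rw [e2, e3] at a3
          have hi0 : (0 : ℝ) ≤ i := Nat.cast_nonneg i
          calc (t (i + 3) - t (i + 1)) * ((i : ℝ) + 1 + 1) ≤ (2 * (t (i + 3) - t (i + 2))) * ((i : ℝ) + 2 + 1) :=
                mul_le_mul (by linarith) (by linarith) (by positivity) (by linarith)
            _ ≤ 2 * (c * t (i + 3)) := by linarith
            _ ≤ 2 * (c * (c * t (i + 2))) := by gcongr
            _ = _ := by ring)
      have h2 : 0 ≤ t (i + 2) ^ σ * ((i + 2 : ℕ) : ℝ) ^ (-(3 : ℝ)) := by have := ht.nonneg (i + 2); positivity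
      simp only [hG₀]
      push_cast at h1 h2 ⊢
      have h3 : 2 * (c ^ 3 * (2 * c ^ 2) ^ 3) ≤ D := by
        have : 0 ≤ 4 + 5 / σ + c / σ + c ^ 4 := by positivity
        rw [hD]; linarith
      calc 2 * (K * t (i + 1) ^ (σ - 3) * (t (i + 3) - t (i + 1)) ^ 3)
          = 2 * (K * (t (i + 1) ^ (σ - 3) * (t (i + 3) - t (i + 1)) ^ 3)) := by ring
        _ ≤ 2 * (K * (c ^ 3 * (2 * c ^ 2) ^ 3 * (t (i + 2) ^ σ * ((i : ℝ) + 2) ^ (-(3 : ℝ))))) := by gcongr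
        _ = K * ((2 * (c ^ 3 * (2 * c ^ 2) ^ 3)) * (t (i + 2) ^ σ * ((i : ℝ) + 2) ^ (-(3 : ℝ)))) := by ring
        _ ≤ K * (D * (t (i + 2) ^ σ * ((i : ℝ) + 2) ^ (-(3 : ℝ)))) := by gcongr
        _ = _ := by ring)
  have hint : ∀ m, ‖θ • z (t m) + (1 - θ) • z (t (m + 1)) - z (offsetTime θ t (m + 1))‖ ≤
      D * K * (t (m + 1) ^ σ * ((m + 1 : ℕ) : ℝ) ^ (-(2 : ℝ))) := by
    intro m
    have hτ := sub_pos.2 (ht.lt_succ m)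
    have e : θ • z (t m) + (1 - θ) • z (t (m + 1)) = z (t m) + (offsetTime θ t (m + 1) - t m) •
        ((t (m + 1) - t m)⁻¹ • (z (t (m + 1)) - z (t m))) := by
      rw [offsetTime_succ, add_sub_cancel_left, smul_smul, mul_assoc, mul_inv_cancel₀ hτ.ne', mul_one, smul_sub,
        sub_smul, sub_smul, one_smul, one_smul]
      abel
    rw [e]
    refine norm_linear_error_le h hσ hσ1 (ht.nonneg m) (ht.lt_succ m) ?_ ?_
      ⟨(lt_offsetTime hθ1 ht le_rfl).le, offsetTime_le hθ0 ht m⟩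
    · intro h0
      rcases m with _ | m
      · simp only [zero_add, Nat.cast_one, Real.one_rpow, mul_one]
        calc 2 * (K / σ) * t 1 ^ σ = (2 / σ) * K * t 1 ^ σ := by ring
          _ ≤ D * K * t 1 ^ σ := by
            gcongr
            have : 0 ≤ 4 + 3 / σ + c / σ + 2 * (c ^ 3 * (2 * c ^ 2) ^ 3) + c ^ 4 := by positivity
            have e5 : D - 2 / σ = 4 + 3 / σ + c / σ + 2 * (c ^ 3 * (2 * c ^ 2) ^ 3) + c ^ 4 := by rw [hD]; ring
            linarith
      · exact absurd h0 (ht.pos m).ne'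
    · intro h0
      rcases m with _ | i
      · exact absurd ht.zero h0.ne'
      · have h1 := ht.rpow_mul_pow_le (σ := σ) (D := c) (H := t (i + 2) - t (i + 1)) hσ.le 2 (by push_cast; linarith) i
          (sub_nonneg.2 (ht.lt_succ _).le) (by have := ht.step_mul_le (i + 1); push_cast at this ⊢; exact this)
        have h2 : 0 ≤ t (i + 2) ^ σ * ((i + 2 : ℕ) : ℝ) ^ (-(2 : ℝ)) := by have := ht.nonneg (i + 2); positivity
        have e3 : i + 1 + 1 = i + 2 := rfl
        rw [e3]
        have h3 : c ^ 2 * c ^ 2 ≤ D := by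
          have : 0 ≤ 4 + 5 / σ + c / σ + 2 * (c ^ 3 * (2 * c ^ 2) ^ 3) := by positivity
          rw [hD, ← pow_add]; norm_num; linarith
        push_cast at h1 h2 ⊢
        calc K * t (i + 1) ^ (σ - 2) * (t (i + 2) - t (i + 1)) ^ 2
            = K * (t (i + 1) ^ (σ - 2) * (t (i + 2) - t (i + 1)) ^ 2) := by ring
          _ ≤ K * (c ^ 2 * c ^ 2 * (t (i + 2) ^ σ * ((i : ℝ) + 2) ^ (-(2 : ℝ)))) := by gcongr
          _ ≤ K * (D * (t (i + 2) ^ σ * ((i : ℝ) + 2) ^ (-(2 : ℝ)))) := by gcongr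
          _ = _ := by ring
  have hstab := scheme_stability θ μ ((C₁ + C₂ * μ) * K * q) N
    (kernelAlikhanov β θ t) (fun k => z (t k) - Z k)
    (fun n => (∑ i ∈ Finset.range n, kernelAlikhanov β θ t n (i + 1) • (z (t (i + 1)) - z (t i)) -
      ∫ s in (0 : ℝ)..(offsetTime θ t n), omega (1 - β) (offsetTime θ t n - s) • z₁ s) -
      Complex.I * μ * (θ • z (t (n - 1)) + (1 - θ) • z (t n) - z (offsetTime θ t n)))
    (fun k => if k = 0 then 0 else 15 * G₀ k)
    (fun k => μ * (D * K * (t k ^ σ * (k : ℝ) ^ (-(2 : ℝ))))) hθ0 hθ1.le (kernelAlikhanov_zero t)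
    (fun n _ k hk => by
      obtain ⟨m, rfl⟩ : ∃ m, n = m + 1 := ⟨n - 1, by omega⟩
      exact kernelAlikhanov_mono hβ0 hβ1 (by linarith) ht (by omega))
    (fun n _ => kernelAlikhanov_offset hβ0 hβ1 hθ ht n)
    (fun n _ => (omega_pos hβ1 (sub_pos.2 (lt_offsetTime hθ1 ht (le_refl n)))).trans_le
      (le_kernelAlikhanov hβ0 hβ1 (by linarith) ht le_rfl))
    (by simp [hZ0, ht.zero]) (by simp)
    (fun k => by split_ifs; exacts [le_rfl, mul_nonneg (by norm_num) (hG₀n k)])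
    ?_ ?_ ?_ n hn1 hnN
  · refine hstab.trans ?_
    have h0 : (C₁ + C₂ * μ) * K * q ≤ (C₁ + C₂) * (K * (1 + μ)) * q := by
      have : (C₁ + C₂) * (K * (1 + μ)) * q - (C₁ + C₂ * μ) * K * q = (C₂ + C₁ * μ) * K * q := by ring
      have : 0 ≤ (C₂ + C₁ * μ) * K * q := by positivity
      linarith
    calc _ ≤ 2 * ((C₁ + C₂) * (K * (1 + μ)) * q) := by linarith
      _ = _ := by ring
  · intro n hn
    have hx0 : 0 < offsetTime θ t (n + 1) := by
      have := lt_offsetTime hθ1 ht (Nat.zero_le n); rwa [ht.zero] at this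
    have h1 := heq (offsetTime θ t (n + 1)) ⟨hx0, by
      rw [← htN]; exact (offsetTime_le hθ0 ht n).trans (ht.strictMono.monotone hn)⟩
    have h2 := hZ n hn
    simp only [Nat.add_sub_cancel]
    rw [h1]
    have : ∀ i, kernelAlikhanov β θ t (n + 1) (i + 1) • (z (t (i + 1)) - Z (i + 1) - (z (t i) - Z i)) =
        kernelAlikhanov β θ t (n + 1) (i + 1) • (z (t (i + 1)) - z (t i)) - kernelAlikhanov β θ t (n + 1) (i + 1) • (Z (i + 1) - Z i) := by
      intro i; rw [← smul_sub]; congr 1; abel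
    simp_rw [this]
    rw [Finset.sum_sub_distrib, h2, smul_sub, smul_sub]; ring
  · intro n hn
    refine (norm_sub_le _ _).trans (add_le_add ?_ ?_)
    · refine (hcons n).trans ?_
      rw [Finset.sum_range_succ' _ n]
      simp only [Nat.add_eq_zero_iff, one_ne_zero, and_false, if_false, if_true, mul_zero, add_zero]
      have h1 := mul_nonneg ((omega_nonneg hβ1 (sub_pos.2 (lt_offsetTime hθ1 ht (le_refl n))).le).trans
        (le_kernelAlikhanov hβ0 hβ1 (by linarith) ht le_rfl)) (hG₀n (n + 1))
      linarith
    · rw [norm_mul, norm_mul, Complex.norm_I, one_mul, Complex.norm_real, Real.norm_of_nonneg hμ]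
      exact mul_le_mul_of_nonneg_left (hint n) hμ
  · intro n hn
    simp only [Nat.add_eq_zero_iff, one_ne_zero, and_false, if_false]
    have hw : 0 < omega (1 - β) (t (n + 1)) := omega_pos hβ1 (ht.pos n)
    have hx0 : 0 < offsetTime θ t (n + 1) := by
      have := lt_offsetTime hθ1 ht (Nat.zero_le n); rwa [ht.zero] at this
    have h1 := le_kernelAlikhanov hβ0 hβ1 (by linarith : θ ≤ β) ht (Nat.zero_le n)
    rw [ht.zero, sub_zero, zero_add] at h1
    have h1' : omega (1 - β) (t (n + 1)) ≤ kernelAlikhanov β θ t (n + 1) 1 :=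
      (omega_anti hβ0 hβ1 hx0 (offsetTime_le hθ0 ht n)).trans h1
    have hTt : omega (1 - β) T ≤ kernelAlikhanov β θ t (n + 1) 1 :=
      (omega_anti hβ0 hβ1 (ht.pos n) (by rw [← htN]; exact ht.strictMono.monotone hn)).trans h1'
    have h2 := kernelAlikhanov_self_le hβ0 hβ1 hθ0 (by linarith) ht n
    have h3 := gradedMesh_rate T r σ 2 hT N (n + 1) (by omega) hn
    rw [← htd, ← hq] at h3
    have hn0 : (0 : ℝ) < ((n + 1 : ℕ) : ℝ) := by positivity
    have hn1' : (1 : ℝ) ≤ ((n + 1 : ℕ) : ℝ) := by exact_mod_cast Nat.succ_le_succ (Nat.zero_le n)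
    have e1 : ((n + 1 : ℕ) : ℝ) ^ β * ((n + 1 : ℕ) : ℝ) ^ (-(3 : ℝ)) ≤ ((n + 1 : ℕ) : ℝ) ^ (-(2 : ℝ)) := by
      rw [← Real.rpow_add hn0]
      exact Real.rpow_le_rpow_of_exponent_le hn1' (by linarith)
    have htn := ht.nonneg (n + 1)
    have hb1 : 2 * (kernelAlikhanov β θ t (n + 1) (n + 1) * (15 * G₀ (n + 1))) ≤ C₁ * K * q * kernelAlikhanov β θ t (n + 1) 1 := by
      calc 2 * (kernelAlikhanov β θ t (n + 1) (n + 1) * (15 * G₀ (n + 1)))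
          ≤ 2 * (((1 / (1 - β) + 1) * (2 * (((n + 1 : ℕ) : ℝ) ^ β * omega (1 - β) (t (n + 1))))) * (15 * G₀ (n + 1))) := by
            have := hG₀n (n + 1)
            gcongr
        _ = 60 * (1 / (1 - β) + 1) * D * K * (t (n + 1) ^ σ * (((n + 1 : ℕ) : ℝ) ^ β * ((n + 1 : ℕ) : ℝ) ^ (-(3 : ℝ)))) * omega (1 - β) (t (n + 1)) := by
            simp only [hG₀]; ring
        _ ≤ 60 * (1 / (1 - β) + 1) * D * K * (t (n + 1) ^ σ * ((n + 1 : ℕ) : ℝ) ^ (-(2 : ℝ))) * kernelAlikhanov β θ t (n + 1) 1 := by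
            gcongr
        _ ≤ 60 * (1 / (1 - β) + 1) * D * K * (T ^ σ * q) * kernelAlikhanov β θ t (n + 1) 1 := by
            have := hw.le.trans h1'
            gcongr
        _ = _ := by rw [hC₁]; ring
    have hb2 : μ * (D * K * (t (n + 1) ^ σ * ((n + 1 : ℕ) : ℝ) ^ (-(2 : ℝ)))) ≤ C₂ * μ * K * q * kernelAlikhanov β θ t (n + 1) 1 := by
      calc μ * (D * K * (t (n + 1) ^ σ * ((n + 1 : ℕ) : ℝ) ^ (-(2 : ℝ)))) ≤ μ * (D * K * (T ^ σ * q)) := by gcongr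
        _ = C₂ * μ * K * q * omega (1 - β) T := by rw [hC₂]; field_simp
        _ ≤ _ := by gcongr
    calc _ ≤ _ := add_le_add hb1 hb2
      _ = _ := by ring

end SFOR

namespace SFOR
open MeasureTheory Set Filter Topology
open scoped FourierTransform

/-! ### The Laplace transform of a power and the Bromwich integral of `1 / Γ` -/

theorem integrableOn_rpow_mul_exp {a r : ℝ} (ha : 0 < a) (hr : 0 < r) :
    IntegrableOn (fun u : ℝ => u ^ (a - 1) * Real.exp (-(r * u))) (Ioi 0) := by
  have := integrableOn_rpow_mul_exp_neg_mul_rpow (p := 1) (s := a - 1) (b := r) (by linarith)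
    one_pos hr
  simpa using this

theorem norm_rpow_mul_cexp {a u : ℝ} (hu : 0 < u) (p : ℂ) :
    ‖((u ^ a : ℝ) : ℂ) * Complex.exp (-(p * u))‖ = u ^ a * Real.exp (-(p.re * u)) := by
  rw [norm_mul, Complex.norm_exp, Complex.norm_real, Real.norm_of_nonneg (by positivity)]
  simp

theorem continuousOn_rpow_mul_cexp (a : ℝ) (p : ℂ) :
    ContinuousOn (fun u : ℝ => ((u ^ a : ℝ) : ℂ) * Complex.exp (-(p * u))) (Ioi 0) := by
  refine ContinuousOn.mul ?_ (by fun_prop)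
  exact Complex.continuous_ofReal.comp_continuousOn
    (continuousOn_id.rpow_const fun u hu => Or.inl (ne_of_gt hu))

theorem integrableOn_rpow_mul_cexp {a : ℝ} (ha : 0 < a) {p : ℂ} (hp : 0 < p.re) :
    IntegrableOn (fun u : ℝ => ((u ^ (a - 1) : ℝ) : ℂ) * Complex.exp (-(p * u))) (Ioi 0) := by
  refine Integrable.mono' (integrableOn_rpow_mul_exp ha hp)
    ((continuousOn_rpow_mul_cexp _ p).aestronglyMeasurable measurableSet_Ioi) ?_
  exact (ae_restrict_iff' measurableSet_Ioi).2
    (Eventually.of_forall fun u hu => (norm_rpow_mul_cexp hu p).le)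

theorem differentiableOn_laplace_rpow {a : ℝ} (ha : 0 < a) :
    DifferentiableOn ℂ
      (fun p : ℂ => ∫ u in Ioi (0 : ℝ), ((u ^ (a - 1) : ℝ) : ℂ) * Complex.exp (-(p * u)))
      {p | 0 < p.re} := by
  intro p hp
  have hp : 0 < p.re := hp
  refine DifferentiableAt.differentiableWithinAt (HasDerivAt.differentiableAt (f' := ∫ u in Ioi (0 : ℝ),
    ((u ^ (a - 1) : ℝ) : ℂ) * (Complex.exp (-(p * u)) * (-u))) ?_)
  refine (hasDerivAt_integral_of_dominated_loc_of_deriv_le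
    (bound := fun u => u ^ (a + 1 - 1) * Real.exp (-(p.re / 2 * u)))
    (s := Metric.ball p (p.re / 2)) (F' := fun q (u : ℝ) => ((u ^ (a - 1) : ℝ) : ℂ) * (Complex.exp (-(q * u)) * (-u)))
    (Metric.ball_mem_nhds _ (by linarith)) ?_ ?_ ?_ ?_ ?_ ?_).2
  · exact Eventually.of_forall fun q =>
      (continuousOn_rpow_mul_cexp _ q).aestronglyMeasurable measurableSet_Ioi
  · exact integrableOn_rpow_mul_cexp ha hp
  · refine ContinuousOn.aestronglyMeasurable ?_ measurableSet_Ioi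
    have := (continuousOn_rpow_mul_cexp (a - 1) p).mul
      (g := fun u : ℝ => -(u : ℂ)) (by fun_prop)
    exact this.congr fun u _ => by simp [mul_assoc]
  · refine (ae_restrict_iff' measurableSet_Ioi).2 (Eventually.of_forall fun u hu q hq => ?_)
    have hu : 0 < u := hu
    rw [← mul_assoc, norm_mul, norm_rpow_mul_cexp hu, norm_neg, Complex.norm_real,
      Real.norm_of_nonneg hu.le, mul_right_comm, ← Real.rpow_add_one hu.ne',
      show a - 1 + 1 = a + 1 - 1 by ring]
    have h1 : p.re / 2 ≤ q.re := by
      have h2 := (Complex.abs_re_le_norm (q - p)).trans_lt (mem_ball_iff_norm.1 hq)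
      rw [Complex.sub_re, abs_lt] at h2
      linarith [h2.1]
    gcongr
  · exact integrableOn_rpow_mul_exp (by linarith) (by linarith)
  · refine Eventually.of_forall fun u q _ => ?_
    have : HasDerivAt (fun q : ℂ => -(q * u)) (-u) q := by
      simpa using ((hasDerivAt_id q).mul_const (u : ℂ)).fun_neg
    exact this.cexp.const_mul _

theorem laplace_rpow {a : ℝ} (ha : 0 < a) {p : ℂ} (hp : 0 < p.re) :
    ∫ u in Ioi (0 : ℝ), ((u ^ (a - 1) : ℝ) : ℂ) * Complex.exp (-(p * u)) =
      Real.Gamma a * p ^ (-(a : ℂ)) := by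
  have hopen : IsOpen {p : ℂ | 0 < p.re} := isOpen_lt continuous_const Complex.continuous_re
  have hconv : Convex ℝ {p : ℂ | 0 < p.re} := convex_halfSpace_re_gt 0
  have hf := (differentiableOn_laplace_rpow ha).analyticOnNhd hopen
  have hg : AnalyticOnNhd ℂ (fun p : ℂ => Real.Gamma a * p ^ (-(a : ℂ))) {p : ℂ | 0 < p.re} := by
    refine DifferentiableOn.analyticOnNhd (fun q hq => ?_) hopen
    have hq : q ∈ Complex.slitPlane := Or.inl hq
    exact ((differentiableAt_id.cpow_const hq).const_mul _).differentiableWithinAt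
  refine hf.eqOn_of_preconnected_of_frequently_eq hg hconv.isPreconnected (z₀ := 1)
    (by simp) ?_ hp
  have hreal : ∀ᶠ r : ℝ in 𝓝[≠] 1, ∫ u in Ioi (0 : ℝ), ((u ^ (a - 1) : ℝ) : ℂ) *
      Complex.exp (-((r : ℂ) * u)) = Real.Gamma a * (r : ℂ) ^ (-(a : ℂ)) := by
    filter_upwards [nhdsWithin_le_nhds (lt_mem_nhds (zero_lt_one' ℝ))] with r hr
    have h := Real.integral_rpow_mul_exp_neg_mul_Ioi ha hr
    have h1 : ∀ u : ℝ, ((u ^ (a - 1) : ℝ) : ℂ) * Complex.exp (-((r : ℂ) * u)) =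
        ((u ^ (a - 1) * Real.exp (-(r * u)) : ℝ) : ℂ) := fun u => by push_cast; rfl
    simp_rw [h1]
    rw [integral_complex_ofReal, h, ← Complex.ofReal_neg, ← Complex.ofReal_cpow hr.le,
      one_div, Real.inv_rpow hr.le, Real.rpow_neg hr.le]
    push_cast
    ring
  have htend : Tendsto (fun r : ℝ => (r : ℂ)) (𝓝[≠] 1) (𝓝[≠] 1) := by
    refine tendsto_nhdsWithin_of_tendsto_nhds_of_eventually_within _ ?_ ?_
    · exact (Complex.continuous_ofReal.tendsto' 1 1 (by simp)).mono_left nhdsWithin_le_nhds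
    · filter_upwards [self_mem_nhdsWithin] with r hr
      simpa using hr
  exact htend.frequently hreal.frequently

/-- The points of the vertical line `Re p = 1`. -/
def bromwich (w : ℝ) : ℂ := 1 + 2 * Real.pi * w * Complex.I

theorem bromwich_re (w : ℝ) : (bromwich w).re = 1 := by simp [bromwich]

theorem bromwich_mem (w : ℝ) : bromwich w ∈ Complex.slitPlane := Or.inl (by simp [bromwich_re])

theorem bromwich_ne_zero (w : ℝ) : bromwich w ≠ 0 := Complex.slitPlane_ne_zero (bromwich_mem w)

theorem continuous_bromwich : Continuous bromwich := by unfold bromwich; fun_prop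

theorem one_le_norm_bromwich (w : ℝ) : 1 ≤ ‖bromwich w‖ := by
  have := Complex.re_le_norm (bromwich w)
  rwa [bromwich_re] at this

theorem norm_bromwich_pos (w : ℝ) : 0 < ‖bromwich w‖ := one_pos.trans_le (one_le_norm_bromwich w)

theorem norm_bromwich_cpow (w x : ℝ) : ‖bromwich w ^ (x : ℂ)‖ = ‖bromwich w‖ ^ x :=
  Complex.norm_cpow_real _ _

theorem continuous_bromwich_cpow (x : ℂ) : Continuous fun w => bromwich w ^ x :=
  continuous_bromwich.cpow continuous_const fun w => bromwich_mem w

theorem integrable_norm_bromwich_rpow {x : ℝ} (hx : 1 < x) :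
    Integrable fun w : ℝ => ‖bromwich w‖ ^ (-x) := by
  have h := integrable_rpow_neg_one_add_norm_sq (E := ℝ) (μ := volume) (r := x) (by simpa using hx)
  refine h.mono' ?_ (Eventually.of_forall fun w => ?_)
  · exact (continuous_bromwich.norm.rpow_const
      fun w => Or.inl (norm_bromwich_pos w).ne').aestronglyMeasurable
  · rw [Real.norm_of_nonneg (Real.rpow_nonneg (norm_nonneg _) _)]
    have h0 : 0 < 1 + ‖w‖ ^ 2 := by positivity
    have h1 : (1 + ‖w‖ ^ 2) ≤ ‖bromwich w‖ ^ 2 := by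
      rw [Complex.sq_norm, Complex.normSq_apply, bromwich_re]
      have : (bromwich w).im = 2 * Real.pi * w := by simp [bromwich]
      rw [this, Real.norm_eq_abs, sq_abs]
      have hpi : 1 ≤ 2 * Real.pi := by linarith [Real.pi_gt_three]
      nlinarith [mul_nonneg (by nlinarith : 0 ≤ (2 * Real.pi) ^ 2 - 1) (sq_nonneg w)]
    have h2 : ‖bromwich w‖ ^ (-x) = (‖bromwich w‖ ^ 2) ^ (-x / 2) := by
      rw [← Real.rpow_natCast, ← Real.rpow_mul (norm_nonneg _)]
      congr 1; push_cast; ring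
    rw [h2]
    exact Real.rpow_le_rpow_of_nonpos h0 h1 (by linarith)

theorem integral_bromwich {x : ℝ} (hx : 1 < x) :
    ∫ w : ℝ, Complex.exp (bromwich w) * bromwich w ^ (-(x : ℂ)) = 1 / Real.Gamma x := by
  have hx0 : 0 < x := by linarith
  have hΓ : (Real.Gamma x : ℂ) ≠ 0 := by exact_mod_cast (Real.Gamma_pos_of_pos hx0).ne'
  set f : ℝ → ℂ := (Ioi 0).indicator
    fun u : ℝ => ((u ^ (x - 1) : ℝ) : ℂ) * Complex.exp (-(1 * u)) with hf
  have hfi : Integrable f := by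
    rw [hf, integrable_indicator_iff measurableSet_Ioi]
    exact integrableOn_rpow_mul_cexp hx0 (by simp)
  have hF : 𝓕 f = fun w => Real.Gamma x * bromwich w ^ (-(x : ℂ)) := by
    ext w
    rw [Real.fourier_real_eq_integral_exp_smul,
      ← laplace_rpow hx0 (p := bromwich w) (by simp [bromwich_re]),
      ← integral_indicator measurableSet_Ioi]
    refine integral_congr_ae (Eventually.of_forall fun u => ?_)
    by_cases hu : u ∈ Ioi (0 : ℝ)
    · simp only [hf, indicator_of_mem hu, smul_eq_mul, bromwich]
      rw [mul_left_comm, ← Complex.exp_add]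
      congr 2
      push_cast
      ring
    · simp [hf, indicator_of_notMem hu]
  have hFi : Integrable (𝓕 f) := by
    rw [hF]
    refine ((integrable_norm_bromwich_rpow hx).mono' ?_ ?_).const_mul _
    · exact (continuous_bromwich_cpow _).aestronglyMeasurable
    · refine Eventually.of_forall fun w => ?_
      rw [← Complex.ofReal_neg, norm_bromwich_cpow]
  have hcont : ContinuousAt f 1 := by
    have : ContinuousAt (fun u : ℝ => ((u ^ (x - 1) : ℝ) : ℂ) * Complex.exp (-(1 * u))) 1 :=
      (continuousOn_rpow_mul_cexp (x - 1) 1).continuousAt (Ioi_mem_nhds one_pos)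
    refine this.congr ?_
    filter_upwards [Ioi_mem_nhds (zero_lt_one' ℝ)] with u hu
    simp only [hf, indicator_of_mem hu]
  have hinv := hfi.fourierInv_fourier_eq hFi hcont
  rw [Real.fourierInv_eq', hF] at hinv
  have h1 : f 1 = Complex.exp (-1) := by simp [hf]
  rw [h1] at hinv
  rw [eq_div_iff hΓ, ← integral_mul_const]
  have h2 := congrArg (fun z => Complex.exp 1 * z) hinv
  simp only [← Complex.exp_add, ← integral_const_mul] at h2
  rw [add_neg_cancel, Complex.exp_zero] at h2
  rw [← h2]
  refine integral_congr_ae (Eventually.of_forall fun w => ?_)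
  simp only [smul_eq_mul, bromwich, Complex.exp_add]
  have : Complex.exp (2 * Real.pi * w * Complex.I) =
      Complex.exp (((2 * Real.pi * inner ℝ w 1 : ℝ) : ℂ) * Complex.I) := by simp
  rw [this]
  ring

end SFOR

namespace SFOR
open MeasureTheory Set Filter Topology

/-! ### The Mittag-Leffler function -/

/-- The two-parameter Mittag-Leffler function `∑ ζ^k / Γ(β k + a)`. -/
def mittagLeffler (β a : ℝ) (ζ : ℂ) : ℂ := ∑' k : ℕ, ζ ^ k / (Real.Gamma (β * k + a) : ℂ)

theorem rpow_mul_exp_le_Gamma {x R : ℝ} (hx : 0 ≤ x) (hR : 0 ≤ R) :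
    R ^ x * Real.exp (-R) ≤ Real.Gamma (x + 1) := by
  rw [Real.Gamma_eq_integral (by linarith), ← integral_exp_neg_Ioi R, ← integral_const_mul]
  have hint := Real.GammaIntegral_convergent (s := x + 1) (by linarith)
  refine (setIntegral_mono_on (g := fun u => Real.exp (-u) * u ^ (x + 1 - 1))
    ((integrableOn_exp_neg_Ioi R).const_mul _) (hint.mono_set (Ioi_subset_Ioi hR))
    measurableSet_Ioi fun u hu => ?_).trans
    (setIntegral_mono_set hint ?_ (Ioi_subset_Ioi hR).eventuallyLE)
  · rw [add_sub_cancel_right, mul_comm]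
    have hu : R < u := hu
    gcongr
  · refine (ae_restrict_iff' measurableSet_Ioi).2 (Eventually.of_forall fun u hu => ?_)
    have hu : 0 < u := hu
    simp only [Pi.zero_apply]
    positivity

theorem one_div_Gamma_le {x R : ℝ} (hx : 0 < x) (hR : 0 < R) :
    1 / Real.Gamma x ≤ x * Real.exp R * R ^ (-x) := by
  have h := rpow_mul_exp_le_Gamma hx.le hR.le
  rw [Real.Gamma_add_one hx.ne', Real.exp_neg] at h
  have hΓ := Real.Gamma_pos_of_pos hx
  rw [div_le_iff₀ hΓ, Real.rpow_neg hR.le]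
  have h1 : 0 < R ^ x := Real.rpow_pos_of_pos hR x
  have h2 := Real.exp_pos R
  have h3 : R ^ x ≤ x * Real.Gamma x * Real.exp R := by
    rwa [← div_eq_mul_inv, div_le_iff₀ h2] at h
  calc (1 : ℝ) = R ^ x * (R ^ x)⁻¹ := (mul_inv_cancel₀ h1.ne').symm
    _ ≤ x * Real.Gamma x * Real.exp R * (R ^ x)⁻¹ := by gcongr
    _ = _ := by ring

theorem summable_pow_div_Gamma {β a : ℝ} (hβ : 0 < β) (ha : 0 < a) {ρ : ℝ} (hρ : 0 ≤ ρ) :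
    Summable fun k : ℕ => ρ ^ k / Real.Gamma (β * k + a) := by
  set R : ℝ := (2 * ρ + 1) ^ (1 / β) with hR
  have hR0 : 0 < R := by positivity
  have hRβ : R ^ β = 2 * ρ + 1 := by
    rw [hR, ← Real.rpow_mul (by positivity), one_div_mul_cancel hβ.ne', Real.rpow_one]
  have hmaj : Summable fun k : ℕ => (β * k + a) * Real.exp R * R ^ (-a) * (1 / 2 : ℝ) ^ k := by
    have h1 : Summable fun k : ℕ => (k : ℝ) ^ 1 * (1 / 2 : ℝ) ^ k :=
      summable_pow_mul_geometric_of_norm_lt_one 1 (by norm_num)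
    have h2 : Summable fun k : ℕ => (1 / 2 : ℝ) ^ k :=
      summable_geometric_of_lt_one (by norm_num) (by norm_num)
    refine ((h1.mul_left (β * Real.exp R * R ^ (-a))).add
      (h2.mul_left (a * Real.exp R * R ^ (-a)))).congr fun k => ?_
    ring
  refine Summable.of_nonneg_of_le (fun k => ?_) (fun k => ?_) hmaj
  · have := Real.Gamma_pos_of_pos (s := β * k + a) (by positivity)
    positivity
  · have hx : 0 < β * k + a := by positivity
    have h := one_div_Gamma_le hx hR0
    have h2 : R ^ (-(β * k + a)) = R ^ (-a) * ((2 * ρ + 1)⁻¹) ^ k := by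
      rw [neg_add, add_comm, Real.rpow_add hR0, Real.rpow_neg hR0.le (β * k), Real.rpow_mul hR0.le,
        hRβ, Real.rpow_natCast, inv_pow]
    calc ρ ^ k / Real.Gamma (β * k + a) = ρ ^ k * (1 / Real.Gamma (β * k + a)) := by ring
      _ ≤ ρ ^ k * ((β * k + a) * Real.exp R * R ^ (-(β * k + a))) := by gcongr
      _ = (β * k + a) * Real.exp R * R ^ (-a) * (ρ * (2 * ρ + 1)⁻¹) ^ k := by
        rw [h2, mul_pow]; ring
      _ ≤ _ := by
        gcongr
        rw [← div_eq_mul_inv, div_le_div_iff₀ (by positivity) (by norm_num)]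
        linarith

theorem norm_mittagLeffler_term {β a : ℝ} (hβ : 0 < β) (ha : 0 < a) (ζ : ℂ) (k : ℕ) :
    ‖ζ ^ k / (Real.Gamma (β * k + a) : ℂ)‖ = ‖ζ‖ ^ k / Real.Gamma (β * k + a) := by
  have := Real.Gamma_pos_of_pos (s := β * k + a) (by positivity)
  rw [norm_div, norm_pow, Complex.norm_real, Real.norm_of_nonneg this.le]

theorem hasSum_mittagLeffler {β a : ℝ} (hβ : 0 < β) (ha : 0 < a) (ζ : ℂ) :
    HasSum (fun k : ℕ => ζ ^ k / (Real.Gamma (β * k + a) : ℂ)) (mittagLeffler β a ζ) :=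
  (Summable.of_norm (by
    simpa only [norm_mittagLeffler_term hβ ha] using
      summable_pow_div_Gamma hβ ha (norm_nonneg ζ))).hasSum

theorem differentiable_mittagLeffler {β a : ℝ} (hβ : 0 < β) (ha : 0 < a) :
    Differentiable ℂ (mittagLeffler β a) := by
  intro ζ
  have hd : DifferentiableOn ℂ (mittagLeffler β a) (Metric.ball 0 (‖ζ‖ + 1)) := by
    refine Complex.differentiableOn_tsum_of_summable_norm
      (summable_pow_div_Gamma hβ ha (by positivity : 0 ≤ ‖ζ‖ + 1)) (fun k => by fun_prop)
      Metric.isOpen_ball fun k ξ hξ => ?_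
    rw [norm_mittagLeffler_term hβ ha]
    have := Real.Gamma_pos_of_pos (s := β * k + a) (by positivity)
    rw [mem_ball_zero_iff] at hξ
    gcongr
  exact hd.differentiableAt (Metric.isOpen_ball.mem_nhds (by simp))

/-- Peeling off the first term of the series. -/
theorem mittagLeffler_eq {β a : ℝ} (hβ : 0 < β) (ha : 0 < a) (ζ : ℂ) :
    mittagLeffler β a ζ = 1 / (Real.Gamma a : ℂ) + ζ * mittagLeffler β (a + β) ζ := by
  have h1 := (hasSum_mittagLeffler hβ ha ζ)
  have h2 := (hasSum_nat_add_iff' 1).2 h1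
  have h3 := (hasSum_mittagLeffler hβ (add_pos ha hβ) ζ).mul_left ζ
  have h4 : (fun k : ℕ => ζ ^ (k + 1) / (Real.Gamma (β * (k + 1 : ℕ) + a) : ℂ)) =
      fun k : ℕ => ζ * (ζ ^ k / (Real.Gamma (β * k + (a + β)) : ℂ)) := by
    ext k
    rw [show β * ((k + 1 : ℕ) : ℝ) + a = β * k + (a + β) by push_cast; ring]
    ring
  rw [h4] at h2
  have := h2.unique h3
  simp only [Finset.range_one, Finset.sum_singleton, pow_zero, Nat.cast_zero, mul_zero,
    zero_add] at this
  rw [← this]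
  ring

/-! ### The Bromwich representation in a half plane -/

/-- The unit vector `η` such that `Re (η p ^ β)` is coercive on `Re p = 1`. -/
def rotation (β : ℝ) : ℂ := Complex.exp (((1 - β) * Real.pi / 4 : ℝ) * Complex.I)

/-- The coercivity constant of `Re (η p ^ β)`. -/
def coercivity (β : ℝ) : ℝ := Real.cos (β * Real.pi / 2 + (1 - β) * Real.pi / 4)

theorem norm_rotation (β : ℝ) : ‖rotation β‖ = 1 := Complex.norm_exp_ofReal_mul_I _

theorem coercivity_pos {β : ℝ} (hβ : 0 < β) (hβ1 : β < 1) : 0 < coercivity β := by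
  have := Real.pi_pos
  refine Real.cos_pos_of_mem_Ioo ⟨?_, ?_⟩ <;> nlinarith

theorem coercivity_le_re {β : ℝ} (hβ : 0 < β) (hβ1 : β < 1) (w : ℝ) :
    coercivity β * ‖bromwich w‖ ^ β ≤ (rotation β * bromwich w ^ (β : ℂ)).re := by
  have hpi := Real.pi_pos
  have hψ : 0 < (1 - β) * Real.pi / 4 := by
    have := mul_pos (sub_pos.2 hβ1) hpi; linarith
  have harg : |(bromwich w).arg| ≤ Real.pi / 2 :=
    Complex.abs_arg_le_pi_div_two_iff.2 (by simp [bromwich_re])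
  have e : (rotation β * bromwich w ^ (β : ℂ)).re = ‖bromwich w‖ ^ β *
      Real.cos ((bromwich w).arg * β + (1 - β) * Real.pi / 4) := by
    rw [Complex.mul_re, Complex.cpow_ofReal_re, Complex.cpow_ofReal_im, rotation,
      Complex.exp_ofReal_mul_I_re, Complex.exp_ofReal_mul_I_im, Real.cos_add]
    ring
  rw [e, mul_comm]
  refine mul_le_mul_of_nonneg_left ?_ (Real.rpow_nonneg (norm_nonneg _) _)
  rw [coercivity, ← Real.cos_abs ((bromwich w).arg * β + _)]
  have hb : β * Real.pi / 2 + (1 - β) * Real.pi / 4 ≤ Real.pi := by nlinarith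
  refine Real.cos_le_cos_of_nonneg_of_le_pi (abs_nonneg _) hb ((abs_add_le _ _).trans ?_)
  rw [abs_mul, abs_of_pos hβ, abs_of_pos hψ]
  nlinarith

/-- The integrand of the Bromwich representation of the Mittag-Leffler function. -/
def bromwichIntegrand (β b : ℝ) (ζ : ℂ) (w : ℝ) : ℂ :=
  Complex.exp (bromwich w) * bromwich w ^ ((β - b : ℝ) : ℂ) / (bromwich w ^ (β : ℂ) - ζ)

theorem le_norm_bromwich_cpow_sub {β : ℝ} (hβ : 0 < β) (hβ1 : β < 1) {ζ : ℂ} {d : ℝ}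
    (hζ : (rotation β * ζ).re ≤ d) (w : ℝ) :
    coercivity β * ‖bromwich w‖ ^ β - d ≤ ‖bromwich w ^ (β : ℂ) - ζ‖ := by
  have h1 := coercivity_le_re hβ hβ1 w
  have h2 := Complex.re_le_norm (rotation β * (bromwich w ^ (β : ℂ) - ζ))
  rw [norm_mul, norm_rotation, one_mul, mul_sub, Complex.sub_re] at h2
  linarith

theorem half_coercivity_le {β : ℝ} (hβ : 0 < β) (hβ1 : β < 1) {ζ : ℂ}
    (hζ : (rotation β * ζ).re < coercivity β / 2) (w : ℝ) :
    coercivity β / 2 * ‖bromwich w‖ ^ β ≤ ‖bromwich w ^ (β : ℂ) - ζ‖ := by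
  have h1 := le_norm_bromwich_cpow_sub hβ hβ1 hζ.le w
  have h2 := Real.one_le_rpow (one_le_norm_bromwich w) hβ.le
  have := coercivity_pos hβ hβ1
  nlinarith

theorem norm_exp_bromwich (w : ℝ) : ‖Complex.exp (bromwich w)‖ = Real.exp 1 := by
  rw [Complex.norm_exp, bromwich_re]

theorem norm_bromwichIntegrand (β b : ℝ) (ζ : ℂ) (w : ℝ) :
    ‖bromwichIntegrand β b ζ w‖ =
      Real.exp 1 * ‖bromwich w‖ ^ (β - b) / ‖bromwich w ^ (β : ℂ) - ζ‖ := by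
  rw [bromwichIntegrand, norm_div, norm_mul, norm_exp_bromwich, norm_bromwich_cpow]

theorem norm_bromwichIntegrand_le {β b : ℝ} {ζ : ℂ} {d : ℝ} (hd : 0 < d) {w : ℝ}
    (h : d * ‖bromwich w‖ ^ β ≤ ‖bromwich w ^ (β : ℂ) - ζ‖) :
    ‖bromwichIntegrand β b ζ w‖ ≤ Real.exp 1 / d * ‖bromwich w‖ ^ (-b) := by
  have hp := norm_bromwich_pos w
  have hpos : 0 < d * ‖bromwich w‖ ^ β := by positivity
  rw [norm_bromwichIntegrand]
  calc _ ≤ Real.exp 1 * ‖bromwich w‖ ^ (β - b) / (d * ‖bromwich w‖ ^ β) := by gcongr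
    _ = _ := by
      rw [sub_eq_add_neg, Real.rpow_add hp]
      field_simp

theorem continuous_bromwichIntegrand {β b : ℝ} {ζ : ℂ}
    (h : ∀ w, bromwich w ^ (β : ℂ) - ζ ≠ 0) : Continuous (bromwichIntegrand β b ζ) := by
  refine Continuous.div ?_ ?_ h
  · exact (Complex.continuous_exp.comp continuous_bromwich).mul (continuous_bromwich_cpow _)
  · exact (continuous_bromwich_cpow _).sub continuous_const

theorem bromwich_cpow_sub_ne_zero {β : ℝ} (hβ : 0 < β) (hβ1 : β < 1) {ζ : ℂ}
    (hζ : (rotation β * ζ).re < coercivity β / 2) (w : ℝ) : bromwich w ^ (β : ℂ) - ζ ≠ 0 := by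
  have h := half_coercivity_le hβ hβ1 hζ w
  have := coercivity_pos hβ hβ1
  have hp := norm_bromwich_pos w
  exact norm_pos_iff.1 (lt_of_lt_of_le (by positivity) h)

theorem integrable_bromwichIntegrand {β b : ℝ} (hβ : 0 < β) (hβ1 : β < 1) (hb : 1 < b) {ζ : ℂ}
    (hζ : (rotation β * ζ).re < coercivity β / 2) : Integrable (bromwichIntegrand β b ζ) :=
  ((integrable_norm_bromwich_rpow hb).const_mul _).mono'
    (continuous_bromwichIntegrand (bromwich_cpow_sub_ne_zero hβ hβ1 hζ)).aestronglyMeasurable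
    (Eventually.of_forall fun w => norm_bromwichIntegrand_le
      (half_pos (coercivity_pos hβ hβ1)) (half_coercivity_le hβ hβ1 hζ w))

theorem isOpen_halfPlane (η : ℂ) (d : ℝ) : IsOpen {ζ : ℂ | (η * ζ).re < d} :=
  isOpen_lt (by fun_prop) continuous_const

theorem convex_halfPlane (η : ℂ) (d : ℝ) : Convex ℝ {ζ : ℂ | (η * ζ).re < d} := by
  refine convex_halfSpace_lt (f := fun ζ : ℂ => (η * ζ).re) ⟨fun x y => ?_, fun c x => ?_⟩ d
  · simp [mul_add]
  · simp; ring

theorem differentiableOn_integral_bromwichIntegrand {β b : ℝ} (hβ : 0 < β) (hβ1 : β < 1)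
    (hb : 1 < b) : DifferentiableOn ℂ (fun ζ => ∫ w, bromwichIntegrand β b ζ w)
      {ζ | (rotation β * ζ).re < coercivity β / 2} := by
  intro ζ hζ
  have hc := coercivity_pos hβ hβ1
  refine DifferentiableAt.differentiableWithinAt (HasDerivAt.differentiableAt (f' := ∫ w,
    bromwichIntegrand β b ζ w / (bromwich w ^ (β : ℂ) - ζ)) ?_)
  refine (hasDerivAt_integral_of_dominated_loc_of_deriv_le
    (bound := fun w => Real.exp 1 / (coercivity β / 2) * ‖bromwich w‖ ^ (-b) / (coercivity β / 2))
    (F' := fun ξ w => bromwichIntegrand β b ξ w / (bromwich w ^ (β : ℂ) - ξ))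
    ((isOpen_halfPlane _ _).mem_nhds hζ) ?_ ?_ ?_ ?_ ?_ ?_).2
  · filter_upwards [(isOpen_halfPlane _ _).mem_nhds hζ] with ξ hξ
    exact (continuous_bromwichIntegrand
      (bromwich_cpow_sub_ne_zero hβ hβ1 hξ)).aestronglyMeasurable
  · exact integrable_bromwichIntegrand hβ hβ1 hb hζ
  · refine Continuous.aestronglyMeasurable (Continuous.div (continuous_bromwichIntegrand
      (bromwich_cpow_sub_ne_zero hβ hβ1 hζ)) ?_ (bromwich_cpow_sub_ne_zero hβ hβ1 hζ))
    exact (continuous_bromwich_cpow _).sub continuous_const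
  · refine Eventually.of_forall fun w ξ hξ => ?_
    have h := half_coercivity_le hβ hβ1 hξ w
    have h2 := Real.one_le_rpow (one_le_norm_bromwich w) hβ.le
    have h3 : coercivity β / 2 ≤ ‖bromwich w ^ (β : ℂ) - ξ‖ := by nlinarith
    have h4 := norm_bromwichIntegrand_le (b := b) (half_pos hc) h
    rw [norm_div]
    have := norm_bromwich_pos w
    gcongr
  · exact ((integrable_norm_bromwich_rpow hb).const_mul _).div_const _
  · refine Eventually.of_forall fun w ξ hξ => ?_
    have hne := bromwich_cpow_sub_ne_zero hβ hβ1 hξ w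
    have h1 : HasDerivAt (fun ξ : ℂ => bromwich w ^ (β : ℂ) - ξ) (-1) ξ :=
      (hasDerivAt_id ξ).const_sub _
    have h2 := (h1.fun_inv hne).const_mul
      (Complex.exp (bromwich w) * bromwich w ^ ((β - b : ℝ) : ℂ))
    refine h2.congr_deriv ?_
    simp only [bromwichIntegrand]
    field_simp

theorem integral_bromwichIntegrand_of_norm_lt {β b : ℝ} (hβ : 0 < β) (hb : 1 < b)
    {ζ : ℂ} (hζ : ‖ζ‖ < 1 / 2) : ∫ w, bromwichIntegrand β b ζ w = mittagLeffler β b ζ := by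
  have hterm : ∀ (k : ℕ) (w : ℝ), ‖ζ ^ k * (Complex.exp (bromwich w) *
      bromwich w ^ (-((β * k + b : ℝ) : ℂ)))‖ ≤
      (1 / 2) ^ k * (Real.exp 1 * ‖bromwich w‖ ^ (-b)) := by
    intro k w
    rw [norm_mul, norm_pow, norm_mul, norm_exp_bromwich, ← Complex.ofReal_neg,
      norm_bromwich_cpow]
    have h1 : ‖bromwich w‖ ^ (-(β * k + b)) ≤ ‖bromwich w‖ ^ (-b) :=
      Real.rpow_le_rpow_of_exponent_le (one_le_norm_bromwich w)
        (by have : 0 ≤ β * k := by positivity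
            linarith)
    gcongr
  have hcont : ∀ k : ℕ, Continuous fun w : ℝ => ζ ^ k * (Complex.exp (bromwich w) *
      bromwich w ^ (-((β * k + b : ℝ) : ℂ))) := fun k =>
    continuous_const.mul
      ((Complex.continuous_exp.comp continuous_bromwich).mul (continuous_bromwich_cpow _))
  have hI := (integrable_norm_bromwich_rpow hb).const_mul (Real.exp 1)
  have hint : ∀ k : ℕ, Integrable fun w : ℝ => ζ ^ k * (Complex.exp (bromwich w) *
      bromwich w ^ (-((β * k + b : ℝ) : ℂ))) := fun k =>
    (hI.const_mul _).mono' (hcont k).aestronglyMeasurable (Eventually.of_forall (hterm k))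
  have hsum : Summable fun k : ℕ => ∫ w, ‖ζ ^ k * (Complex.exp (bromwich w) *
      bromwich w ^ (-((β * k + b : ℝ) : ℂ)))‖ := by
    refine Summable.of_nonneg_of_le (fun k => integral_nonneg fun w => norm_nonneg _)
      (fun k => (integral_mono (hint k).norm (hI.const_mul _) (hterm k)).trans_eq
        (integral_const_mul _ _)) ?_
    exact (summable_geometric_of_lt_one (by norm_num) (by norm_num)).mul_right _
  have h := hasSum_integral_of_summable_integral_norm hint hsum
  have h1 : ∀ k : ℕ, ∫ w, ζ ^ k * (Complex.exp (bromwich w) *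
      bromwich w ^ (-((β * k + b : ℝ) : ℂ))) = ζ ^ k / (Real.Gamma (β * k + b) : ℂ) := by
    intro k
    rw [integral_const_mul, integral_bromwich, mul_one_div]
    have : 0 ≤ β * k := by positivity
    linarith
  simp only [h1] at h
  have h2 : ∀ w, ∑' k : ℕ, ζ ^ k * (Complex.exp (bromwich w) *
      bromwich w ^ (-((β * k + b : ℝ) : ℂ))) = bromwichIntegrand β b ζ w := by
    intro w
    have hp := bromwich_ne_zero w
    have hpβ : bromwich w ^ (β : ℂ) ≠ 0 := by simp [Complex.cpow_eq_zero_iff, hp]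
    have hlt : ‖ζ / bromwich w ^ (β : ℂ)‖ < 1 := by
      rw [norm_div, norm_bromwich_cpow]
      have := Real.one_le_rpow (one_le_norm_bromwich w) hβ.le
      rw [div_lt_one (by linarith)]
      linarith
    have h3 := (hasSum_geometric_of_norm_lt_one hlt).mul_left
      (Complex.exp (bromwich w) * bromwich w ^ (-(b : ℂ)))
    refine (h3.congr_fun ?_).tsum_eq.trans ?_
    · intro k
      have h4 : bromwich w ^ (-((β * k + b : ℝ) : ℂ)) =
          bromwich w ^ (-(b : ℂ)) * ((bromwich w ^ (β : ℂ)) ^ k)⁻¹ := by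
        rw [← Complex.cpow_nat_mul, ← Complex.cpow_neg, ← Complex.cpow_add _ _ hp]
        congr 1
        push_cast
        ring
      rw [h4, div_pow]
      ring
    · rw [bromwichIntegrand, Complex.ofReal_sub, sub_eq_add_neg (β : ℂ), Complex.cpow_add _ _ hp]
      have h5 : bromwich w ^ (β : ℂ) - ζ ≠ 0 := by
        intro h0
        rw [sub_eq_zero.1 h0, div_self (sub_eq_zero.1 h0 ▸ hpβ)] at hlt
        simp at hlt
      have h6 : (1 - ζ / bromwich w ^ (β : ℂ)) = (bromwich w ^ (β : ℂ) - ζ) / bromwich w ^ (β : ℂ) := by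
        field_simp
      rw [h6, inv_div]
      ring
  rw [mittagLeffler, h.tsum_eq]
  exact integral_congr_ae (Eventually.of_forall fun w => (h2 w).symm)

/-- The Bromwich representation of the Mittag-Leffler function. -/
theorem integral_bromwichIntegrand {β b : ℝ} (hβ : 0 < β) (hβ1 : β < 1) (hb : 1 < b) {ζ : ℂ}
    (hζ : (rotation β * ζ).re < coercivity β / 2) :
    ∫ w, bromwichIntegrand β b ζ w = mittagLeffler β b ζ := by
  have hopen := isOpen_halfPlane (rotation β) (coercivity β / 2)
  refine ((differentiableOn_integral_bromwichIntegrand hβ hβ1 hb).analyticOnNhd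
    hopen).eqOn_of_preconnected_of_eventuallyEq
    ((differentiable_mittagLeffler hβ (by linarith)).differentiableOn.analyticOnNhd hopen)
    (convex_halfPlane _ _).isPreconnected (z₀ := 0) ?_ ?_ hζ
  · simpa using coercivity_pos hβ hβ1
  · filter_upwards [Metric.ball_mem_nhds (0 : ℂ) (by norm_num : (0 : ℝ) < 1 / 2)] with ξ hξ
    exact integral_bromwichIntegrand_of_norm_lt hβ hb (mem_ball_zero_iff.1 hξ)

end SFOR

namespace SFOR
open MeasureTheory Set Filter Topology

/-! ### Bounds of the Mittag-Leffler function in a half plane -/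

theorem re_rotation_lt {β : ℝ} (hβ : 0 < β) (hβ1 : β < 1) {ζ : ℂ}
    (hζ : (rotation β * ζ).re ≤ 0) : (rotation β * ζ).re < coercivity β / 2 :=
  hζ.trans_lt (half_pos (coercivity_pos hβ hβ1))

theorem exists_norm_mittagLeffler_le {β b : ℝ} (hβ : 0 < β) (hβ1 : β < 1) (hb : 1 < b) :
    ∃ C, 0 < C ∧ ∀ ζ : ℂ, (rotation β * ζ).re ≤ 0 → ‖mittagLeffler β b ζ‖ ≤ C := by
  have hc := coercivity_pos hβ hβ1
  have hI := (integrable_norm_bromwich_rpow hb).const_mul (Real.exp 1 / coercivity β)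
  refine ⟨(∫ w : ℝ, Real.exp 1 / coercivity β * ‖bromwich w‖ ^ (-b)) + 1, ?_, fun ζ hζ => ?_⟩
  · have : 0 ≤ ∫ w : ℝ, Real.exp 1 / coercivity β * ‖bromwich w‖ ^ (-b) :=
      integral_nonneg fun w => by positivity
    linarith
  · rw [← integral_bromwichIntegrand hβ hβ1 hb (re_rotation_lt hβ hβ1 hζ)]
    have := norm_integral_le_of_norm_le hI (f := bromwichIntegrand β b ζ)
      (Eventually.of_forall fun w => norm_bromwichIntegrand_le hc (by
        simpa using le_norm_bromwich_cpow_sub hβ hβ1 hζ w))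
    linarith

theorem exists_norm_mul_mittagLeffler_le {β κ : ℝ} (hβ : 0 < β) (hβ1 : β < 1) (hκ : 0 < κ)
    (hκ1 : κ < 1) : ∃ C, 0 < C ∧ ∀ ζ : ℂ, (rotation β * ζ).re ≤ 0 →
      ‖ζ * mittagLeffler β (1 + β) ζ‖ ≤ C * ‖ζ‖ ^ κ := by
  have hc := coercivity_pos hβ hβ1
  set c := coercivity β with hcdef
  have hb : 1 < 1 + β * κ := by have := mul_pos hβ hκ; linarith
  set d : ℝ := c ^ κ * (1 / (1 + 1 / c)) ^ (1 - κ) with hd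
  have hd0 : 0 < d := by positivity
  have hI := integrable_norm_bromwich_rpow hb
  refine ⟨Real.exp 1 / d * (∫ w : ℝ, ‖bromwich w‖ ^ (-(1 + β * κ))) + 1, ?_, fun ζ hζ => ?_⟩
  · have : 0 ≤ ∫ w : ℝ, ‖bromwich w‖ ^ (-(1 + β * κ)) := integral_nonneg fun w => by positivity
    positivity
  · rcases eq_or_ne ζ 0 with rfl | hζ0
    · simp [Real.zero_rpow hκ.ne']
    have hζ0 : 0 < ‖ζ‖ := norm_pos_iff.2 hζ0
    rw [← integral_bromwichIntegrand hβ hβ1 (by linarith) (re_rotation_lt hβ hβ1 hζ),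
      ← integral_const_mul]
    have hle : ∀ w, ‖ζ * bromwichIntegrand β (1 + β) ζ w‖ ≤
        Real.exp 1 / d * ‖ζ‖ ^ κ * ‖bromwich w‖ ^ (-(1 + β * κ)) := by
      intro w
      have hp := norm_bromwich_pos w
      have h1 : c * ‖bromwich w‖ ^ β ≤ ‖bromwich w ^ (β : ℂ) - ζ‖ := by
        simpa using le_norm_bromwich_cpow_sub hβ hβ1 hζ w
      set D := ‖bromwich w ^ (β : ℂ) - ζ‖ with hD
      have hD0 : 0 < D := lt_of_lt_of_le (by positivity) h1
      have h2 : ‖ζ‖ ≤ (1 + 1 / c) * D := by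
        have h3 : ‖ζ‖ ≤ ‖bromwich w‖ ^ β + D := by
          have h4 := norm_sub_le (bromwich w ^ (β : ℂ)) (bromwich w ^ (β : ℂ) - ζ)
          rwa [sub_sub_cancel, norm_bromwich_cpow] at h4
        have h5 : ‖bromwich w‖ ^ β ≤ 1 / c * D := by
          rw [one_div, inv_mul_eq_div, le_div_iff₀ hc]; linarith
        linarith
      have h6 : d * ‖bromwich w‖ ^ (β * κ) * ‖ζ‖ ^ (1 - κ) ≤ D := by
        calc d * ‖bromwich w‖ ^ (β * κ) * ‖ζ‖ ^ (1 - κ)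
            = (c * ‖bromwich w‖ ^ β) ^ κ * (1 / (1 + 1 / c) * ‖ζ‖) ^ (1 - κ) := by
              rw [Real.mul_rpow hc.le (by positivity), Real.mul_rpow (by positivity) hζ0.le,
                ← Real.rpow_mul hp.le, hd]
              ring
          _ ≤ D ^ κ * D ^ (1 - κ) := by
              have h7 : 1 / (1 + 1 / c) * ‖ζ‖ ≤ D := by
                rw [one_div, inv_mul_eq_div, div_le_iff₀ (by positivity)]; linarith
              have : 0 ≤ 1 - κ := by linarith
              gcongr
          _ = D := by rw [← Real.rpow_add hD0, add_sub_cancel, Real.rpow_one]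
      rw [norm_mul, norm_bromwichIntegrand, show β - (1 + β) = -1 by ring, ← hD]
      have h8 : 0 < d * ‖bromwich w‖ ^ (β * κ) * ‖ζ‖ ^ (1 - κ) := by positivity
      calc ‖ζ‖ * (Real.exp 1 * ‖bromwich w‖ ^ (-1 : ℝ) / D)
          ≤ ‖ζ‖ * (Real.exp 1 * ‖bromwich w‖ ^ (-1 : ℝ) /
            (d * ‖bromwich w‖ ^ (β * κ) * ‖ζ‖ ^ (1 - κ))) := by gcongr
        _ = _ := by
          rw [neg_add, Real.rpow_add hp, Real.rpow_neg hp.le (β * κ), Real.rpow_sub hζ0,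
            Real.rpow_one]
          field_simp
    have := norm_integral_le_of_norm_le (hI.const_mul (Real.exp 1 / d * ‖ζ‖ ^ κ))
      (Eventually.of_forall hle)
    rw [integral_const_mul (Real.exp 1 / d * ‖ζ‖ ^ κ)] at this
    have h9 : 0 ≤ ‖ζ‖ ^ κ := by positivity
    refine this.trans ?_
    rw [add_mul, one_mul]
    linarith

/-! ### The modes and their derivatives -/

/-- The part of the solution of `∂_t^β z = i μ z + c t^(1-2β)`, `z(0) = z₀`, that vanishes
at `t = 0`. -/
def modeIncrement (β μ : ℝ) (z₀ c t : ℂ) : ℂ :=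
  z₀ * (Complex.I * μ * t ^ (β : ℂ) * mittagLeffler β (1 + β) (Complex.I * μ * t ^ (β : ℂ))) +
    c * Real.Gamma (2 - 2 * β) *
      (t ^ ((1 - β : ℝ) : ℂ) * mittagLeffler β (2 - β) (Complex.I * μ * t ^ (β : ℂ)))

theorem exists_sector_radius {β : ℝ} (hβ : 0 < β) (hβ1 : β < 1) : ∃ ρ, 0 < ρ ∧ ρ ≤ 1 / 2 ∧
    ∀ (s : ℝ) (t : ℂ), 0 < s → ‖t - s‖ ≤ ρ * s → ∀ μ : ℝ, 0 ≤ μ →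
      (rotation β * (Complex.I * μ * t ^ (β : ℂ))).re ≤ 0 := by
  have hpi := Real.pi_pos
  set ψ := (1 - β) * Real.pi / 4 with hψ
  have hψ0 : 0 < ψ := by have := mul_pos (sub_pos.2 hβ1) hpi; rw [hψ]; linarith
  have hψ1 : ψ ≤ Real.pi / 4 := by rw [hψ]; nlinarith
  have hcont : ContinuousAt Complex.arg 1 := Complex.continuousAt_arg (by simp)
  obtain ⟨δ, hδ, h⟩ := Metric.continuousAt_iff.1 hcont ψ hψ0
  refine ⟨min (δ / 2) (1 / 2), by positivity, min_le_right _ _, fun s t hs ht μ hμ => ?_⟩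
  have harg : |t.arg| < ψ := by
    have h1 : dist (t / s) 1 < δ := by
      have hs' : (s : ℂ) ≠ 0 := by exact_mod_cast hs.ne'
      rw [dist_eq_norm, div_sub_one hs', norm_div, Complex.norm_real, Real.norm_of_nonneg hs.le,
        div_lt_iff₀ hs]
      refine ht.trans_lt (mul_lt_mul_of_pos_right ?_ hs)
      exact (min_le_left _ _).trans_lt (by linarith)
    have h2 := h h1
    have h3 : (t / s).arg = t.arg := by
      rw [div_eq_inv_mul, ← Complex.ofReal_inv, Complex.arg_real_mul _ (inv_pos.2 hs)]
    rwa [h3, Complex.arg_one, Real.dist_eq, sub_zero] at h2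
  have e : (rotation β * (Complex.I * μ * t ^ (β : ℂ))).re =
      -(μ * ‖t‖ ^ β * Real.sin (t.arg * β + ψ)) := by
    have h1 : (t ^ (β : ℂ)).re = ‖t‖ ^ β * Real.cos (t.arg * β) := Complex.cpow_ofReal_re _ _
    have h2 : (t ^ (β : ℂ)).im = ‖t‖ ^ β * Real.sin (t.arg * β) := Complex.cpow_ofReal_im _ _
    have h3 : (rotation β).re = Real.cos ψ := Complex.exp_ofReal_mul_I_re _
    have h4 : (rotation β).im = Real.sin ψ := Complex.exp_ofReal_mul_I_im _
    rw [Real.sin_add]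
    simp only [Complex.mul_re, Complex.mul_im, Complex.I_re, Complex.I_im, Complex.ofReal_re,
      Complex.ofReal_im, h1, h2, h3, h4]
    ring
  rw [e, neg_nonpos]
  have h5 : |t.arg * β| ≤ ψ := by
    rw [abs_mul, abs_of_pos hβ]
    nlinarith [abs_nonneg t.arg]
  have h6 := abs_le.1 h5
  have : 0 ≤ Real.sin (t.arg * β + ψ) :=
    Real.sin_nonneg_of_nonneg_of_le_pi (by linarith) (by linarith)
  positivity

theorem differentiableOn_modeIncrement {β : ℝ} (hβ : 0 < β) (hβ1 : β < 1) (μ : ℝ) (z₀ c : ℂ) :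
    DifferentiableOn ℂ (modeIncrement β μ z₀ c) Complex.slitPlane := by
  intro t ht
  have h1 : DifferentiableAt ℂ (fun t : ℂ => Complex.I * μ * t ^ (β : ℂ)) t :=
    (differentiableAt_id.cpow_const ht).const_mul _
  have h2 : DifferentiableAt ℂ (fun t : ℂ => t ^ ((1 - β : ℝ) : ℂ)) t :=
    differentiableAt_id.cpow_const ht
  have h3 := ((differentiable_mittagLeffler hβ (a := 1 + β) (by linarith)) _).fun_comp' t h1
  have h4 := ((differentiable_mittagLeffler hβ (a := 2 - β) (by linarith)) _).fun_comp' t h1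
  exact (((h1.mul h3).const_mul _).add ((h2.mul h4).const_mul _)).differentiableWithinAt

theorem exists_norm_modeIncrement_le {β : ℝ} (hβ : 1 / 2 < β) (hβ1 : β < 1) :
    ∃ C, 0 < C ∧ ∀ (μ : ℝ) (z₀ c t : ℂ), 0 ≤ μ →
      (rotation β * (Complex.I * μ * t ^ (β : ℂ))).re ≤ 0 →
      ‖modeIncrement β μ z₀ c t‖ ≤ C * (μ ^ (1 / β - 1) * ‖z₀‖ + ‖c‖) * ‖t‖ ^ (1 - β) := by
  have hβ0 : 0 < β := by linarith
  have hκ : 0 < 1 / β - 1 := by rw [sub_pos, lt_div_iff₀ hβ0]; linarith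
  have hκ1 : 1 / β - 1 < 1 := by rw [sub_lt_iff_lt_add, div_lt_iff₀ hβ0]; linarith
  obtain ⟨C₁, hC₁, h₁⟩ := exists_norm_mul_mittagLeffler_le hβ0 hβ1 hκ hκ1
  obtain ⟨C₂, hC₂, h₂⟩ := exists_norm_mittagLeffler_le hβ0 hβ1 (b := 2 - β) (by linarith)
  have hΓ : 0 < Real.Gamma (2 - 2 * β) := Real.Gamma_pos_of_pos (by linarith)
  refine ⟨C₁ + C₂ * Real.Gamma (2 - 2 * β), by positivity, fun μ z₀ c t hμ hre => ?_⟩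
  have e1 := h₁ _ hre
  have e2 := h₂ _ hre
  have e3 : ‖Complex.I * μ * t ^ (β : ℂ)‖ ^ (1 / β - 1) = μ ^ (1 / β - 1) * ‖t‖ ^ (1 - β) := by
    rw [norm_mul, norm_mul, Complex.norm_I, one_mul, Complex.norm_real, Real.norm_of_nonneg hμ,
      Complex.norm_cpow_real, Real.mul_rpow hμ (by positivity), ← Real.rpow_mul (norm_nonneg _)]
    congr 2
    field_simp
  rw [e3] at e1
  rw [modeIncrement]
  refine (norm_add_le _ _).trans ?_
  rw [norm_mul z₀, norm_mul (c * _), norm_mul c, norm_mul (t ^ _) (mittagLeffler _ _ _),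
    Complex.norm_cpow_real, Complex.norm_real, Real.norm_of_nonneg hΓ.le]
  have hp : 0 ≤ ‖t‖ ^ (1 - β) := by positivity
  have hq : 0 ≤ μ ^ (1 / β - 1) := by positivity
  calc _ ≤ ‖z₀‖ * (C₁ * (μ ^ (1 / β - 1) * ‖t‖ ^ (1 - β))) +
        ‖c‖ * Real.Gamma (2 - 2 * β) * (‖t‖ ^ (1 - β) * C₂) := by gcongr
    _ ≤ _ := by
      have h3 : 0 ≤ ‖z₀‖ * (C₂ * Real.Gamma (2 - 2 * β) * (μ ^ (1 / β - 1) * ‖t‖ ^ (1 - β))) := by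
        positivity
      have h4 : 0 ≤ ‖c‖ * (C₁ * ‖t‖ ^ (1 - β)) := by positivity
      linarith

theorem exists_norm_iteratedDeriv_modeIncrement_le {β : ℝ} (hβ : 1 / 2 < β) (hβ1 : β < 1) :
    ∃ C, 0 < C ∧ ∀ (μ : ℝ) (z₀ c : ℂ) (m : ℕ) (s : ℝ), 0 ≤ μ → m ≤ 3 → 0 < s →
      ‖iteratedDeriv m (modeIncrement β μ z₀ c) s‖ ≤
        C * (μ ^ (1 / β - 1) * ‖z₀‖ + ‖c‖) * s ^ (1 - β - m) := by
  have hβ0 : 0 < β := by linarith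
  obtain ⟨C, hC, h⟩ := exists_norm_modeIncrement_le hβ hβ1
  obtain ⟨ρ, hρ, hρ2, hsec⟩ := exists_sector_radius hβ0 hβ1
  refine ⟨6 * C * 2 ^ (1 - β) / ρ ^ 3, by positivity, fun μ z₀ c m s hμ hm hs => ?_⟩
  set K := μ ^ (1 / β - 1) * ‖z₀‖ + ‖c‖ with hK
  have hK0 : 0 ≤ K := by positivity
  have hsub : Metric.closedBall (s : ℂ) (ρ * s) ⊆ Complex.slitPlane := by
    intro t ht
    left
    rw [mem_closedBall_iff_norm] at ht
    have h1 := (Complex.abs_re_le_norm (t - s)).trans ht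
    rw [Complex.sub_re, Complex.ofReal_re, abs_le] at h1
    nlinarith [h1.1]
  have hcl : DiffContOnCl ℂ (modeIncrement β μ z₀ c) (Metric.ball s (ρ * s)) :=
    ((differentiableOn_modeIncrement hβ0 hβ1 μ z₀ c).mono
      ((Metric.closure_ball_subset_closedBall).trans hsub)).diffContOnCl
  have hbd : ∀ t ∈ Metric.sphere (s : ℂ) (ρ * s), ‖modeIncrement β μ z₀ c t‖ ≤
      C * K * (2 * s) ^ (1 - β) := by
    intro t ht
    rw [mem_sphere_iff_norm] at ht
    refine (h μ z₀ c t hμ (hsec s t hs ht.le μ hμ)).trans ?_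
    have h2 : ‖t‖ ≤ 2 * s := by
      have h3 := norm_add_le (t - s) (s : ℂ)
      rw [sub_add_cancel, ht, Complex.norm_real, Real.norm_of_nonneg hs.le] at h3
      nlinarith
    have : 0 ≤ 1 - β := by linarith
    gcongr
  refine (Complex.norm_iteratedDeriv_le_of_forall_mem_sphere_norm_le m (by positivity) hcl
    hbd).trans ?_
  have h6 : ((m.factorial : ℕ) : ℝ) ≤ 6 := by
    exact_mod_cast (Nat.factorial_le hm : m.factorial ≤ Nat.factorial 3)
  have h7 : ρ ^ 3 ≤ ρ ^ m := pow_le_pow_of_le_one hρ.le (by linarith) hm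
  have h8 : s ^ (1 - β - m) = s ^ (1 - β) / s ^ m := by
    rw [Real.rpow_sub hs, Real.rpow_natCast]
  rw [h8, Real.mul_rpow (by norm_num) hs.le, mul_pow]
  calc _ ≤ 6 * (C * K * (2 ^ (1 - β) * s ^ (1 - β))) / (ρ ^ 3 * s ^ m) := by gcongr
    _ = _ := by field_simp

theorem modeIncrement_zero {β : ℝ} (hβ : 0 < β) (hβ1 : β < 1) (μ : ℝ) (z₀ c : ℂ) :
    modeIncrement β μ z₀ c 0 = 0 := by
  have h1 : (β : ℂ) ≠ 0 := by exact_mod_cast hβ.ne'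
  have h2 : ((1 - β : ℝ) : ℂ) ≠ 0 := by exact_mod_cast (by linarith : 1 - β ≠ 0)
  rw [modeIncrement, Complex.zero_cpow h1, Complex.zero_cpow h2]
  simp

theorem continuous_modeIncrement {β : ℝ} (hβ : 0 < β) (hβ1 : β < 1) (μ : ℝ) (z₀ c : ℂ) :
    Continuous fun t : ℝ => modeIncrement β μ z₀ c t := by
  have h1 : Continuous fun t : ℝ => Complex.I * μ * (t : ℂ) ^ (β : ℂ) :=
    continuous_const.mul (Complex.continuous_ofReal_cpow_const (by simpa))
  have h2 : Continuous fun t : ℝ => (t : ℂ) ^ ((1 - β : ℝ) : ℂ) :=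
    Complex.continuous_ofReal_cpow_const (by rw [Complex.ofReal_re]; linarith)
  have h3 := (differentiable_mittagLeffler hβ (a := 1 + β) (by linarith)).continuous.comp h1
  have h4 := (differentiable_mittagLeffler hβ (a := 2 - β) (by linarith)).continuous.comp h1
  exact (continuous_const.mul (h1.mul h3)).add (continuous_const.mul (h2.mul h4))

/-- The modes are power regular, uniformly in the frequency. -/
theorem exists_powerRegular_mode {β : ℝ} (hβ : 1 / 2 < β) (hβ1 : β < 1) :
    ∃ C, 0 < C ∧ ∀ (μ : ℝ) (z₀ c : ℂ), 0 ≤ μ → ∃ z₁ z₂ z₃ : ℝ → ℂ,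
      PowerRegular (C * (μ ^ (1 / β - 1) * ‖z₀‖ + ‖c‖)) (1 - β)
        (fun t : ℝ => z₀ + modeIncrement β μ z₀ c t) z₁ z₂ z₃ := by
  have hβ0 : 0 < β := by linarith
  obtain ⟨C, hC, h⟩ := exists_norm_iteratedDeriv_modeIncrement_le hβ hβ1
  refine ⟨C, hC, fun μ z₀ c hμ => ?_⟩
  set F := modeIncrement β μ z₀ c with hF
  have hopen := Complex.isOpen_slitPlane
  have hA : AnalyticOnNhd ℂ F Complex.slitPlane :=
    (differentiableOn_modeIncrement hβ0 hβ1 μ z₀ c).analyticOnNhd hopen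
  have hmem : ∀ t : ℝ, 0 < t → (t : ℂ) ∈ Complex.slitPlane := fun t ht =>
    Complex.ofReal_mem_slitPlane.2 ht
  have hd : ∀ m : ℕ, ∀ t : ℝ, 0 < t →
      HasDerivAt (fun s : ℝ => iteratedDeriv m F s) (iteratedDeriv (m + 1) F t) t := by
    intro m t ht
    have h1 : AnalyticAt ℂ (iteratedDeriv m F) t := by
      rw [iteratedDeriv_eq_iterate]
      exact (hA.iterated_deriv m) t (hmem t ht)
    rw [iteratedDeriv_succ]
    exact h1.differentiableAt.hasDerivAt.comp_ofReal
  refine ⟨fun t => iteratedDeriv 1 F t, fun t => iteratedDeriv 2 F t,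
    fun t => iteratedDeriv 3 F t, ?_, fun t ht => ?_, fun t ht => hd 1 t ht, fun t ht => hd 2 t ht,
    fun t ht => ?_, fun t ht => ?_, fun t ht => ?_⟩
  · exact (continuous_const.add (continuous_modeIncrement hβ0 hβ1 μ z₀ c)).continuousOn
  · have := (hd 0 t ht).const_add z₀
    simpa only [iteratedDeriv_zero] using this
  · simpa using h μ z₀ c 1 t hμ (by norm_num) ht
  · simpa using h μ z₀ c 2 t hμ (by norm_num) ht
  · simpa using h μ z₀ c 3 t hμ (by norm_num) ht

end SFOR

namespace SFOR
open MeasureTheory Set Filter Topology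

/-! ### Fractional integrals -/

theorem omega_nonneg_of_pos {δ u : ℝ} (hδ : 0 < δ) (hu : 0 ≤ u) : 0 ≤ omega δ u :=
  div_nonneg (Real.rpow_nonneg hu _) (Real.Gamma_pos_of_pos hδ).le

theorem omega_pos_of_pos {δ u : ℝ} (hδ : 0 < δ) (hu : 0 < u) : 0 < omega δ u :=
  div_pos (Real.rpow_pos_of_pos hu _) (Real.Gamma_pos_of_pos hδ)

theorem omega_one (u : ℝ) : omega 1 u = 1 := by simp [omega]

theorem measurable_omega (δ : ℝ) : Measurable (omega δ) := by
  unfold omega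
  fun_prop

/-- The semigroup property of fractional integration. -/
theorem integral_omega_mul_omega {a b t : ℝ} (ha : 0 < a) (hb : 0 < b) (ht : 0 < t) :
    ∫ s in (0 : ℝ)..t, omega a (t - s) * omega b s = omega (a + b) t := by
  have hΓa := (Real.Gamma_pos_of_pos ha).ne'
  have hΓb := (Real.Gamma_pos_of_pos hb).ne'
  have hΓ := (Real.Gamma_pos_of_pos (add_pos ha hb)).ne'
  have h1 := Complex.betaIntegral_scaled (b : ℂ) (a : ℂ) ht
  have h2 := Complex.Gamma_mul_Gamma_eq_betaIntegral (s := (b : ℂ)) (t := (a : ℂ)) (by simpa)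
    (by simpa)
  have h3 : ∫ x in (0 : ℝ)..t, (x : ℂ) ^ ((b : ℂ) - 1) * ((t : ℂ) - x) ^ ((a : ℂ) - 1) =
      ((∫ x in (0 : ℝ)..t, x ^ (b - 1) * (t - x) ^ (a - 1) : ℝ) : ℂ) := by
    rw [← intervalIntegral.integral_ofReal]
    refine intervalIntegral.integral_congr_ae (Eventually.of_forall fun x hx => ?_)
    rw [uIoc_of_le ht.le] at hx
    rw [Complex.ofReal_mul, Complex.ofReal_cpow hx.1.le, Complex.ofReal_cpow (sub_nonneg.2 hx.2)]
    push_cast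
    rfl
  have h4 : (t : ℂ) ^ ((b : ℂ) + a - 1) = ((t ^ (b + a - 1) : ℝ) : ℂ) := by
    rw [Complex.ofReal_cpow ht.le]; push_cast; rfl
  rw [h3, h4] at h1
  rw [Complex.Gamma_ofReal, Complex.Gamma_ofReal, ← Complex.ofReal_add, Complex.Gamma_ofReal,
    ← Complex.ofReal_mul] at h2
  have hΓ' : ((Real.Gamma (b + a) : ℝ) : ℂ) ≠ 0 := by rw [add_comm]; exact_mod_cast hΓ
  have h5 : Complex.betaIntegral b a = ((Real.Gamma b * Real.Gamma a / Real.Gamma (b + a) : ℝ) : ℂ) := by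
    rw [Complex.ofReal_div, h2]
    field_simp
  rw [h5, ← Complex.ofReal_mul, Complex.ofReal_inj] at h1
  have h6 : ∀ s, omega a (t - s) * omega b s =
      (1 / (Real.Gamma a * Real.Gamma b)) * (s ^ (b - 1) * (t - s) ^ (a - 1)) := by
    intro s
    simp only [omega]
    field_simp
  simp_rw [h6]
  rw [intervalIntegral.integral_const_mul, h1, omega, add_comm a b]
  rw [add_comm] at hΓ
  field_simp

theorem intervalIntegrable_omega_mul_omega {a b t : ℝ} (ha : 0 < a) (hb : 0 < b) (ht : 0 < t) :
    IntervalIntegrable (fun s => omega a (t - s) * omega b s) volume 0 t := by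
  refine intervalIntegral.intervalIntegrable_of_integral_ne_zero ?_
  rw [integral_omega_mul_omega ha hb ht]
  exact (omega_pos_of_pos (add_pos ha hb) ht).ne'

/-- The function `t ^ (a-1) E_{β,a}(l t ^ β)`. -/
def mittagLefflerKernel (β a : ℝ) (l : ℂ) (t : ℝ) : ℂ :=
  ((t ^ (a - 1) : ℝ) : ℂ) * mittagLeffler β a (l * ((t ^ β : ℝ) : ℂ))

theorem hasSum_mittagLefflerKernel {β a : ℝ} (hβ : 0 < β) (ha : 0 < a) (l : ℂ) {t : ℝ}
    (ht : 0 < t) : HasSum (fun k : ℕ => l ^ k * (omega (β * k + a) t : ℂ))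
      (mittagLefflerKernel β a l t) := by
  have h := (hasSum_mittagLeffler hβ ha (l * ((t ^ β : ℝ) : ℂ))).mul_left ((t ^ (a - 1) : ℝ) : ℂ)
  refine h.congr_fun fun k => ?_
  rw [omega, show β * k + a - 1 = (a - 1) + β * k by ring, Real.rpow_add ht, Real.rpow_mul ht.le,
    Real.rpow_natCast]
  push_cast
  ring

theorem summable_norm_mul_omega {β a : ℝ} (hβ : 0 < β) (ha : 0 < a) {l : ℝ} (hl : 0 ≤ l) {t : ℝ}
    (ht : 0 < t) : Summable fun k : ℕ => l ^ k * omega (β * k + a) t := by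
  have h := (summable_pow_div_Gamma hβ ha (ρ := l * t ^ β) (by positivity)).mul_left (t ^ (a - 1))
  refine h.congr fun k => ?_
  rw [omega, show β * k + a - 1 = (a - 1) + β * k by ring, Real.rpow_add ht, Real.rpow_mul ht.le,
    Real.rpow_natCast]
  ring

/-- Fractional integration of order `δ` raises the second parameter by `δ`. -/
theorem integral_omega_mul_mittagLefflerKernel {β a δ : ℝ} (hβ : 0 < β) (ha : 0 < a) (hδ : 0 < δ)
    (l : ℂ) {t : ℝ} (ht : 0 < t) :
    ∫ s in (0 : ℝ)..t, (omega δ (t - s) : ℂ) * mittagLefflerKernel β a l s =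
      mittagLefflerKernel β (a + δ) l t := by
  have hk : ∀ k : ℕ, 0 < β * k + a := fun k => by positivity
  set F : ℕ → ℝ → ℂ := fun k s => l ^ k * ((omega δ (t - s) * omega (β * k + a) s : ℝ) : ℂ) with hF
  have hint : ∀ k, Integrable (F k) (volume.restrict (Ioc 0 t)) := fun k =>
    ((intervalIntegrable_iff_integrableOn_Ioc_of_le ht.le).1
      (intervalIntegrable_omega_mul_omega hδ (hk k) ht)).ofReal.const_mul _
  have hval : ∀ k, ∫ s in Ioc 0 t, F k s = l ^ k * (omega (β * k + (a + δ)) t : ℂ) := by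
    intro k
    rw [hF, integral_const_mul, integral_complex_ofReal, ← intervalIntegral.integral_of_le ht.le,
      integral_omega_mul_omega hδ (hk k) ht]
    congr 3; ring
  have hnorm : ∀ k, ∫ s in Ioc 0 t, ‖F k s‖ = ‖l‖ ^ k * omega (β * k + (a + δ)) t := by
    intro k
    have : ∀ s ∈ Ioc 0 t, ‖F k s‖ = ‖l‖ ^ k * (omega δ (t - s) * omega (β * k + a) s) := by
      intro s hs
      rw [hF, norm_mul, norm_pow, Complex.norm_real, Real.norm_of_nonneg]
      exact mul_nonneg (omega_nonneg_of_pos hδ (sub_nonneg.2 hs.2))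
        (omega_nonneg_of_pos (hk k) hs.1.le)
    rw [setIntegral_congr_fun measurableSet_Ioc this, integral_const_mul,
      ← intervalIntegral.integral_of_le ht.le, integral_omega_mul_omega hδ (hk k) ht]
    congr 2; ring
  have hsum : Summable fun k => ∫ s in Ioc 0 t, ‖F k s‖ := by
    simp_rw [hnorm]
    exact summable_norm_mul_omega hβ (by positivity) (norm_nonneg l) ht
  have h := hasSum_integral_of_summable_integral_norm hint hsum
  simp_rw [hval] at h
  rw [(hasSum_mittagLefflerKernel hβ (add_pos ha hδ) l ht).unique h,
    intervalIntegral.integral_of_le ht.le]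
  refine setIntegral_congr_fun measurableSet_Ioc fun s hs => ?_
  have h1 := (hasSum_mittagLefflerKernel hβ ha l hs.1).mul_left (omega δ (t - s) : ℂ)
  refine h1.tsum_eq.symm.trans (tsum_congr fun k => ?_)
  rw [hF]
  push_cast
  ring

theorem continuousOn_mittagLefflerKernel {β a : ℝ} (hβ : 0 < β) (ha : 0 < a) (l : ℂ) :
    ContinuousOn (mittagLefflerKernel β a l) (Ioi 0) := by
  have h1 : ContinuousOn (fun t : ℝ => ((t ^ (a - 1) : ℝ) : ℂ)) (Ioi 0) :=
    Complex.continuous_ofReal.comp_continuousOn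
      (continuousOn_id.rpow_const fun t ht => Or.inl (ne_of_gt ht))
  have h2 : Continuous fun t : ℝ => l * ((t ^ β : ℝ) : ℂ) :=
    continuous_const.mul (Complex.continuous_ofReal.comp
      (continuous_id.rpow_const fun t => Or.inr hβ.le))
  exact h1.mul ((differentiable_mittagLeffler hβ ha).continuous.comp h2).continuousOn

theorem intervalIntegrable_omega_mul_mittagLefflerKernel {β a δ : ℝ} (hβ : 0 < β) (ha : 0 < a)
    (hδ : 0 < δ) (l : ℂ) {t : ℝ} (ht : 0 < t) :
    IntervalIntegrable (fun s => (omega δ (t - s) : ℂ) * mittagLefflerKernel β a l s) volume 0 t := by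
  have h2 : Continuous fun t : ℝ => (Real.Gamma a : ℂ) * mittagLeffler β a (l * ((t ^ β : ℝ) : ℂ)) :=
    continuous_const.mul ((differentiable_mittagLeffler hβ ha).continuous.comp
      (continuous_const.mul (Complex.continuous_ofReal.comp
        (continuous_id.rpow_const fun t => Or.inr hβ.le))))
  have h1 : IntervalIntegrable (fun s => ((omega δ (t - s) * omega a s : ℝ) : ℂ)) volume 0 t := by
    have := intervalIntegrable_omega_mul_omega hδ ha ht
    rw [intervalIntegrable_iff] at this ⊢
    exact this.ofReal
  refine (h1.mul_continuousOn h2.continuousOn).congr ?_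
  intro s _
  have := (Real.Gamma_pos_of_pos ha).ne'
  have : (Real.Gamma a : ℂ) ≠ 0 := by exact_mod_cast this
  simp only [mittagLefflerKernel, omega]
  push_cast
  field_simp

theorem hasDerivAt_mittagLefflerKernel {β a : ℝ} (hβ : 0 < β) (ha : 0 < a) (l : ℂ) {t : ℝ}
    (ht : 0 < t) :
    HasDerivAt (mittagLefflerKernel β (a + 1) l) (mittagLefflerKernel β a l t) t := by
  have hcont : ContinuousAt (mittagLefflerKernel β a l) t :=
    (continuousOn_mittagLefflerKernel hβ ha l).continuousAt (Ioi_mem_nhds ht)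
  have hint := intervalIntegrable_omega_mul_mittagLefflerKernel hβ ha one_pos l ht
  have hI : ∀ s > 0, ∫ u in (0 : ℝ)..s, mittagLefflerKernel β a l u =
      mittagLefflerKernel β (a + 1) l s := by
    intro s hs
    rw [← integral_omega_mul_mittagLefflerKernel hβ ha one_pos l hs]
    simp [omega_one]
  simp only [omega_one, Complex.ofReal_one, one_mul] at hint
  have h := intervalIntegral.integral_hasDerivAt_right hint
    ((continuousOn_mittagLefflerKernel hβ ha l).stronglyMeasurableAtFilter isOpen_Ioi t ht) hcont
  refine h.congr_of_eventuallyEq ?_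
  filter_upwards [Ioi_mem_nhds ht] with s hs
  exact (hI s hs).symm

theorem modeIncrement_eq {β μ : ℝ} {z₀ c : ℂ} {t : ℝ} (ht : 0 < t) :
    modeIncrement β μ z₀ c t =
      z₀ * (Complex.I * μ) * mittagLefflerKernel β (β + 1) (Complex.I * μ) t +
        c * Real.Gamma (2 - 2 * β) * mittagLefflerKernel β (1 - β + 1) (Complex.I * μ) t := by
  rw [modeIncrement, mittagLefflerKernel, mittagLefflerKernel, ← Complex.ofReal_cpow ht.le,
    ← Complex.ofReal_cpow ht.le, add_sub_cancel_right, add_sub_cancel_right, add_comm β 1,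
    show 1 - β + 1 = 2 - β by ring]
  ring

theorem hasDerivAt_modeIncrement {β : ℝ} (hβ : 0 < β) (hβ1 : β < 1) (μ : ℝ) (z₀ c : ℂ) {t : ℝ}
    (ht : 0 < t) : HasDerivAt (fun s : ℝ => z₀ + modeIncrement β μ z₀ c s)
      (z₀ * (Complex.I * μ) * mittagLefflerKernel β β (Complex.I * μ) t +
        c * Real.Gamma (2 - 2 * β) * mittagLefflerKernel β (1 - β) (Complex.I * μ) t) t := by
  have h1 := (hasDerivAt_mittagLefflerKernel hβ hβ (Complex.I * μ) ht).const_mul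
    (z₀ * (Complex.I * μ))
  have h2 := (hasDerivAt_mittagLefflerKernel hβ (sub_pos.2 hβ1) (Complex.I * μ) ht).const_mul
    (c * Real.Gamma (2 - 2 * β))
  refine ((h1.add h2).const_add z₀).congr_of_eventuallyEq ?_
  filter_upwards [Ioi_mem_nhds ht] with s hs
  rw [modeIncrement_eq hs]
  rfl

/-- The mode solves the fractional differential equation. -/
theorem caputo_mode {β : ℝ} (hβ : 0 < β) (hβ1 : β < 1) {μ : ℝ} {z₀ c : ℂ} {z₁ : ℝ → ℂ}
    (h : ∀ t > 0, HasDerivAt (fun t : ℝ => z₀ + modeIncrement β μ z₀ c t) (z₁ t) t) {t : ℝ}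
    (ht : 0 < t) : ∫ s in (0 : ℝ)..t, omega (1 - β) (t - s) • z₁ s =
      Complex.I * μ * (z₀ + modeIncrement β μ z₀ c t) + ((t ^ (1 - 2 * β) : ℝ) : ℂ) * c := by
  set l : ℂ := Complex.I * μ with hl
  have hγ : 0 < 1 - β := sub_pos.2 hβ1
  have e1 : ∫ s in (0 : ℝ)..t, omega (1 - β) (t - s) • z₁ s = ∫ s in (0 : ℝ)..t,
      (z₀ * l * ((omega (1 - β) (t - s) : ℂ) * mittagLefflerKernel β β l s) +
        c * Real.Gamma (2 - 2 * β) *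
          ((omega (1 - β) (t - s) : ℂ) * mittagLefflerKernel β (1 - β) l s)) := by
    refine intervalIntegral.integral_congr_ae (Eventually.of_forall fun s hs => ?_)
    rw [uIoc_of_le ht.le] at hs
    rw [(h s hs.1).unique (hasDerivAt_modeIncrement hβ hβ1 μ z₀ c hs.1), Complex.real_smul]
    ring
  rw [e1, intervalIntegral.integral_add
    ((intervalIntegrable_omega_mul_mittagLefflerKernel hβ hβ hγ l ht).const_mul _)
    ((intervalIntegrable_omega_mul_mittagLefflerKernel hβ hγ hγ l ht).const_mul _),
    intervalIntegral.integral_const_mul, intervalIntegral.integral_const_mul,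
    integral_omega_mul_mittagLefflerKernel hβ hβ hγ l ht,
    integral_omega_mul_mittagLefflerKernel hβ hγ hγ l ht, modeIncrement_eq ht]
  have hΓ := (Real.Gamma_pos_of_pos (by linarith : 0 < 2 - 2 * β)).ne'
  have hΓ' : (Real.Gamma (2 - 2 * β) : ℂ) ≠ 0 := by exact_mod_cast hΓ
  have k1 : mittagLefflerKernel β (β + (1 - β)) l t = 1 + l * mittagLefflerKernel β (β + 1) l t := by
    rw [mittagLefflerKernel, mittagLefflerKernel, show β + (1 - β) = 1 by ring,
      mittagLeffler_eq hβ one_pos, add_comm 1 β]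
    simp
    ring
  have k2 : mittagLefflerKernel β (1 - β + (1 - β)) l t =
      ((t ^ (1 - 2 * β) : ℝ) : ℂ) / Real.Gamma (2 - 2 * β) +
        l * mittagLefflerKernel β (1 - β + 1) l t := by
    rw [mittagLefflerKernel, mittagLefflerKernel, mittagLeffler_eq hβ (by linarith),
      show 1 - β + (1 - β) = 2 - 2 * β by ring, show 2 - 2 * β + β = 1 - β + 1 by ring,
      show 2 - 2 * β - 1 = 1 - 2 * β by ring, show 1 - β + 1 - 1 = (1 - 2 * β) + β by ring,
      Real.rpow_add ht]
    push_cast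
    ring
  rw [k1, k2, ← hl]
  generalize (Real.Gamma (2 - 2 * β) : ℂ) = G at hΓ' ⊢
  generalize mittagLefflerKernel β (1 - β + 1) l t = x
  generalize mittagLefflerKernel β (β + 1) l t = y
  field_simp
  ring

end SFOR

namespace SFOR
open MeasureTheory Set Filter Topology

/-! ### Uniqueness for the scalar fractional differential equation -/

theorem intervalIntegrable_omega_smul_of_continuousOn {E : Type*} [NormedAddCommGroup E]
    [NormedSpace ℝ E] {β : ℝ} (hβ1 : β < 1) {T t : ℝ} {g : ℝ → E} (hg : ContinuousOn g (Ioo 0 T))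
    (hgi : IntegrableOn g (Ioo 0 T)) (ht : t ∈ Ioo 0 T) :
    IntervalIntegrable (fun s => omega (1 - β) (t - s) • g s) volume 0 t := by
  have h0 := ht.1
  have hleft : IntervalIntegrable (fun s => omega (1 - β) (t - s) • g s) volume 0 (t / 2) := by
    have h1 : IntervalIntegrable g volume 0 (t / 2) := by
      rw [intervalIntegrable_iff_integrableOn_Ioo_of_le (by linarith)]
      exact hgi.mono_set (Ioo_subset_Ioo le_rfl (by linarith [ht.2]))
    refine h1.continuousOn_smul ?_
    simp_rw [omega_one_sub]
    refine ContinuousOn.div_const (ContinuousOn.rpow_const (by fun_prop) fun s hs => Or.inl ?_) _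
    rw [uIcc_of_le (by linarith)] at hs
    linarith [hs.2]
  have hright : IntervalIntegrable (fun s => omega (1 - β) (t - s) • g s) volume (t / 2) t := by
    refine (intervalIntegrable_omega_sub hβ1 t _ _).smul_continuousOn (hg.mono ?_)
    rw [uIcc_of_le (by linarith)]
    exact fun s hs => ⟨by linarith [hs.1], hs.2.trans_lt ht.2⟩
  exact hleft.trans hright

theorem integral_omega_mul_omega_sub {β r t : ℝ} (hβ : 0 < β) (hβ1 : β < 1) (hrt : r < t) :
    ∫ s in r..t, omega β (t - s) * omega (1 - β) (s - r) = 1 := by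
  have h := integral_omega_mul_omega hβ (sub_pos.2 hβ1) (sub_pos.2 hrt)
  rw [add_sub_cancel, omega_one] at h
  have h2 := intervalIntegral.integral_comp_sub_right (a := r) (b := t)
    (fun x => omega β (t - r - x) * omega (1 - β) x) r
  rw [sub_self, h] at h2
  refine Eq.trans (intervalIntegral.integral_congr fun s _ => ?_) h2
  simp

/-- The fractional integral is the left inverse of the Caputo derivative. -/
theorem integral_omega_smul_caputo {β : ℝ} (hβ : 0 < β) (hβ1 : β < 1) {T : ℝ} {e e' : ℝ → ℂ}
    (hcont : ContinuousOn e (Icc 0 T)) (hd : ∀ t ∈ Ioo 0 T, HasDerivAt e (e' t) t)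
    (hi : IntegrableOn e' (Ioo 0 T)) {t : ℝ} (ht : t ∈ Ioo 0 T) :
    ∫ s in (0 : ℝ)..t, omega β (t - s) • ∫ r in (0 : ℝ)..s, omega (1 - β) (s - r) • e' r =
      e t - e 0 := by
  have hγ : 0 < 1 - β := sub_pos.2 hβ1
  have hit : IntegrableOn e' (Ioo 0 t) := hi.mono_set (Ioo_subset_Ioo le_rfl ht.2.le)
  set ν := volume.restrict (Ioo (0 : ℝ) t) with hν
  set k : ℝ × ℝ → ℝ := {p : ℝ × ℝ | p.2 < p.1}.indicator
    fun p => omega β (t - p.1) * omega (1 - β) (p.1 - p.2) with hk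
  have hkm : Measurable k := by
    refine Measurable.indicator ?_ (measurableSet_lt measurable_snd measurable_fst)
    exact ((measurable_omega β).comp (measurable_const.sub measurable_fst)).mul
      ((measurable_omega _).comp (measurable_fst.sub measurable_snd))
  have hk1 : ∀ r, (fun s => k (s, r)) =
      (Ioi r).indicator fun s => omega β (t - s) * omega (1 - β) (s - r) := by
    intro r; ext s; simp [hk, indicator_apply]
  have hk2 : ∀ s, (fun r => k (s, r) • e' r) = (Iio s).indicator fun r =>
      omega β (t - s) • (omega (1 - β) (s - r) • e' r) := by
    intro s; ext r
    by_cases h : r < s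
    · simp [hk, h, mul_assoc]
    · simp [hk, h]
  have hset1 : ∀ r ∈ Ioo 0 t, Ioo 0 t ∩ Ioi r = Ioo r t := by
    intro r hr; ext s; simp only [mem_inter_iff, mem_Ioo, mem_Ioi]
    exact ⟨fun h => ⟨h.2, h.1.2⟩, fun h => ⟨⟨hr.1.trans h.1, h.2⟩, h.1⟩⟩
  have hset2 : ∀ s ∈ Ioo 0 t, Ioo 0 t ∩ Iio s = Ioo 0 s := by
    intro s hs; ext r; simp only [mem_inter_iff, mem_Ioo, mem_Iio]
    exact ⟨fun h => ⟨h.1.1, h.2⟩, fun h => ⟨⟨h.1, h.2.trans hs.2⟩, h.2⟩⟩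
  have hkint : ∀ r ∈ Ioo 0 t, ∫ s, k (s, r) ∂ν = 1 := by
    intro r hr
    rw [hk1 r, hν, setIntegral_indicator measurableSet_Ioi, hset1 r hr,
      ← integral_Ioc_eq_integral_Ioo, ← intervalIntegral.integral_of_le hr.2.le,
      integral_omega_mul_omega_sub hβ hβ1 hr.2]
  have hki : ∀ r ∈ Ioo 0 t, Integrable (fun s => k (s, r)) ν := by
    intro r hr
    by_contra h
    have := hkint r hr
    rw [integral_undef h] at this
    exact zero_ne_one this
  have hk0 : ∀ s ∈ Ioo 0 t, ∀ r, 0 ≤ k (s, r) := by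
    intro s hs r
    simp only [hk, indicator_apply, mem_ofPred_eq]
    split_ifs with h
    · exact mul_nonneg (omega_nonneg_of_pos hβ (sub_nonneg.2 hs.2.le))
        (omega_nonneg_of_pos hγ (sub_nonneg.2 h.le))
    · exact le_rfl
  have hmeas : AEStronglyMeasurable (fun p : ℝ × ℝ => k p • e' p.2) (ν.prod ν) :=
    hkm.aestronglyMeasurable.smul (hit.aestronglyMeasurable.comp_snd)
  have hnorm : ∀ r ∈ Ioo 0 t, ∫ s, ‖k (s, r) • e' r‖ ∂ν = ‖e' r‖ := by
    intro r hr
    have : ∫ s, ‖k (s, r) • e' r‖ ∂ν = ∫ s, k (s, r) * ‖e' r‖ ∂ν := by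
      refine setIntegral_congr_fun measurableSet_Ioo fun s hs => ?_
      simp only [norm_smul, Real.norm_of_nonneg (hk0 s hs r)]
    rw [this, integral_mul_const, hkint r hr, one_mul]
  have hprod : Integrable (fun p : ℝ × ℝ => k p • e' p.2) (ν.prod ν) := by
    rw [integrable_prod_iff' hmeas]
    refine ⟨(ae_restrict_iff' measurableSet_Ioo).2 (Eventually.of_forall fun r hr =>
      (hki r hr).smul_const (e' r)), ?_⟩
    refine hit.norm.congr ?_
    exact (ae_restrict_iff' measurableSet_Ioo).2 (Eventually.of_forall fun r hr => (hnorm r hr).symm)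
  have hswap := integral_integral_swap (f := fun s r => k (s, r) • e' r) hprod
  have hL : ∫ s, ∫ r, k (s, r) • e' r ∂ν ∂ν =
      ∫ s in (0 : ℝ)..t, omega β (t - s) • ∫ r in (0 : ℝ)..s, omega (1 - β) (s - r) • e' r := by
    rw [intervalIntegral.integral_of_le ht.1.le, integral_Ioc_eq_integral_Ioo]
    refine setIntegral_congr_fun measurableSet_Ioo fun s hs => ?_
    rw [hk2 s, hν, setIntegral_indicator measurableSet_Iio, hset2 s hs, integral_smul,
      intervalIntegral.integral_of_le hs.1.le, integral_Ioc_eq_integral_Ioo]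
  have hR : ∫ r, ∫ s, k (s, r) • e' r ∂ν ∂ν = e t - e 0 := by
    have : ∫ r, ∫ s, k (s, r) • e' r ∂ν ∂ν = ∫ r, e' r ∂ν := by
      refine setIntegral_congr_fun measurableSet_Ioo fun r hr => ?_
      rw [integral_smul_const, hkint r hr, one_smul]
    rw [this, hν, ← integral_Ioc_eq_integral_Ioo, ← intervalIntegral.integral_of_le ht.1.le]
    refine intervalIntegral.integral_eq_sub_of_hasDerivAt_of_le ht.1.le
      (hcont.mono (Icc_subset_Icc le_rfl ht.2.le)) (fun s hs => hd s ⟨hs.1, hs.2.trans ht.2⟩) ?_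
    rwa [intervalIntegrable_iff_integrableOn_Ioo_of_le ht.1.le]
  rw [← hL, hswap, hR]

theorem eq_zero_of_caputo_eq {β : ℝ} (hβ : 0 < β) (hβ1 : β < 1) {T : ℝ} {e e' : ℝ → ℂ}
    (hT : 0 < T) (hcont : ContinuousOn e (Icc 0 T)) (hd : ∀ t ∈ Ioo 0 T, HasDerivAt e (e' t) t)
    (hi : IntegrableOn e' (Ioo 0 T)) (l : ℂ) (h0 : e 0 = 0)
    (heq : ∀ t ∈ Ioo 0 T, ∫ s in (0 : ℝ)..t, omega (1 - β) (t - s) • e' s = l * e t) :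
    ∀ t ∈ Icc 0 T, e t = 0 := by
  obtain ⟨M, hM⟩ := isCompact_Icc.exists_bound_of_continuousOn hcont
  have hvol : ∀ t ∈ Ioo 0 T, e t = ∫ s in (0 : ℝ)..t, omega β (t - s) • (l * e s) := by
    intro t ht
    have h := integral_omega_smul_caputo hβ hβ1 hcont hd hi ht
    rw [h0, sub_zero] at h
    rw [← h]
    refine intervalIntegral.integral_congr_ae (Eventually.of_forall fun s hs => ?_)
    rw [uIoc_of_le ht.1.le] at hs
    rw [heq s ⟨hs.1, hs.2.trans_lt ht.2⟩]
  have hb : ∀ k : ℕ, ∀ t ∈ Ioo 0 T, ‖e t‖ ≤ M * (‖l‖ ^ k * omega (β * k + 1) t) := by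
    intro k
    induction k with
    | zero =>
      intro t ht
      simpa [omega_one] using hM t (Ioo_subset_Icc_self ht)
    | succ k ih =>
      intro t ht
      have hk : 0 < β * k + 1 := by positivity
      rw [hvol t ht]
      refine (intervalIntegral.norm_integral_le_of_norm_le ht.1.le
        (g := fun s => ‖l‖ * (M * ‖l‖ ^ k) * (omega β (t - s) * omega (β * k + 1) s)) ?_
        ((intervalIntegrable_omega_mul_omega hβ hk ht.1).const_mul _)).trans_eq ?_
      · refine Eventually.of_forall fun s hs => ?_
        have h1 := ih s ⟨hs.1, hs.2.trans_lt ht.2⟩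
        have h2 := omega_nonneg_of_pos hβ (sub_nonneg.2 hs.2)
        rw [norm_smul, norm_mul, Real.norm_of_nonneg h2]
        calc omega β (t - s) * (‖l‖ * ‖e s‖)
            ≤ omega β (t - s) * (‖l‖ * (M * (‖l‖ ^ k * omega (β * k + 1) s))) := by gcongr
          _ = _ := by ring
      · rw [intervalIntegral.integral_const_mul, integral_omega_mul_omega hβ hk ht.1,
          show β + (β * k + 1) = β * ((k + 1 : ℕ) : ℝ) + 1 by push_cast; ring]
        ring
  have hz : EqOn e (fun _ => 0) (Ioo 0 T) := by
    intro t ht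
    have h1 := ((summable_norm_mul_omega hβ one_pos (norm_nonneg l) ht.1).mul_left
      M).tendsto_atTop_zero
    have h2 := le_of_tendsto_of_tendsto' tendsto_const_nhds h1 fun k => hb k t ht
    exact norm_le_zero_iff.1 h2
  refine hz.of_subset_closure hcont continuousOn_const Ioo_subset_Icc_self ?_
  rw [closure_Ioo hT.ne]

/-- A solution of the scalar equation is given by the Mittag-Leffler formula. -/
theorem eq_mode {β : ℝ} (hβ : 1 / 2 < β) (hβ1 : β < 1) {T : ℝ} (hT : 0 < T) {μ : ℝ} (hμ : 0 ≤ μ)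
    {c : ℂ} {ψ ψ' : ℝ → ℂ} (hcont : ContinuousOn ψ (Icc 0 T))
    (hd : ∀ t ∈ Ioo 0 T, HasDerivAt ψ (ψ' t) t) (hψ' : ContinuousOn ψ' (Ioo 0 T))
    (hi : IntegrableOn ψ' (Ioo 0 T))
    (heq : ∀ t ∈ Ioo 0 T, ∫ s in (0 : ℝ)..t, omega (1 - β) (t - s) • ψ' s =
      Complex.I * μ * ψ t + ((t ^ (1 - 2 * β) : ℝ) : ℂ) * c) :
    ∀ t ∈ Icc 0 T, ψ t = ψ 0 + modeIncrement β μ (ψ 0) c t := by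
  have hβ0 : 0 < β := by linarith
  obtain ⟨C, -, hC⟩ := exists_powerRegular_mode hβ hβ1
  obtain ⟨z₁, z₂, z₃, hz⟩ := hC μ (ψ 0) c hμ
  have hzc : ContinuousOn z₁ (Ioo 0 T) := (continuousOn_z₁ hz).mono fun t ht => ht.1
  have hzi : IntegrableOn z₁ (Ioo 0 T) :=
    (intervalIntegrable_iff_integrableOn_Ioo_of_le hT.le).1
      (hz.intervalIntegrable_deriv (sub_pos.2 hβ1) le_rfl hT.le)
  have h := eq_zero_of_caputo_eq hβ0 hβ1 (e := fun t => ψ t - (ψ 0 + modeIncrement β μ (ψ 0) c t))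
    (e' := fun t => ψ' t - z₁ t) hT (hcont.sub (hz.cont.mono fun t ht => ht.1))
    (fun t ht => (hd t ht).sub (hz.deriv₁ t ht.1)) (hi.sub hzi) (Complex.I * μ)
    (by simp [modeIncrement_zero hβ0 hβ1]) ?_
  · exact fun t ht => sub_eq_zero.1 (h t ht)
  · intro t ht
    simp_rw [smul_sub]
    rw [intervalIntegral.integral_sub
      (intervalIntegrable_omega_smul_of_continuousOn hβ1 hψ' hi ht)
      (intervalIntegrable_omega_smul_of_continuousOn hβ1 hzc hzi ht), heq t ht,
      caputo_mode hβ0 hβ1 hz.deriv₁ ht.1]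
    ring

end SFOR

namespace SFOR
open MeasureTheory Set Filter Topology

/-! ### Continuous functions as elements of `L²(0, L)` -/

theorem memLp_of_continuous (L : ℝ) {f : ℝ → ℝ} (hf : Continuous f) :
    MemLp f 2 (volume.restrict (Ioo (0 : ℝ) L)) := by
  obtain ⟨C, hC⟩ := (isCompact_Icc (a := (0 : ℝ)) (b := L)).exists_bound_of_continuousOn
    hf.continuousOn
  refine MemLp.of_bound hf.aestronglyMeasurable C ?_
  exact (ae_restrict_iff' measurableSet_Ioo).2
    (Eventually.of_forall fun x hx => hC x (Ioo_subset_Icc_self hx))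

/-- The class in `L²(0, L)` of a continuous function. -/
def ofContinuous (L : ℝ) (f : ℝ → ℝ) (hf : Continuous f) : L2 L := (memLp_of_continuous L hf).toLp f

theorem coeFn_ofContinuous {L : ℝ} {f : ℝ → ℝ} (hf : Continuous f) :
    ofContinuous L f hf =ᵐ[volume.restrict (Ioo (0 : ℝ) L)] f := MemLp.coeFn_toLp _

theorem inner_eq_integral {L : ℝ} (ψ χ : L2 L) :
    inner ℝ ψ χ = ∫ x in Ioo (0 : ℝ) L, χ x * ψ x := by
  rw [L2.inner_def]
  refine integral_congr_ae (Eventually.of_forall fun x => ?_)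
  simp

theorem inner_ofContinuous {L : ℝ} {f : ℝ → ℝ} (hf : Continuous f) (ψ : L2 L) :
    inner ℝ (ofContinuous L f hf) ψ = ∫ x in Ioo (0 : ℝ) L, ψ x * f x := by
  rw [inner_eq_integral]
  refine integral_congr_ae ?_
  filter_upwards [coeFn_ofContinuous hf] with x hx
  rw [hx]

theorem inner_ofContinuous_ofContinuous {L : ℝ} {f g : ℝ → ℝ} (hf : Continuous f)
    (hg : Continuous g) : inner ℝ (ofContinuous L f hf) (ofContinuous L g hg) =
      ∫ x in Ioo (0 : ℝ) L, f x * g x := by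
  rw [inner_ofContinuous]
  refine integral_congr_ae ?_
  filter_upwards [coeFn_ofContinuous hg] with x hx
  rw [hx, mul_comm]

/-! ### The Dirichlet and Neumann eigenfunctions -/

theorem continuous_dirichletEigenfunction (L : ℝ) (j : ℕ) :
    Continuous (dirichletEigenfunction L j) := by
  unfold dirichletEigenfunction; fun_prop

/-- The normalized cosines `√(2 / L) cos (k π x / L)`, `k = j + 1`. -/
def neumannEigenfunction (L : ℝ) (j : ℕ) (x : ℝ) : ℝ :=
  Real.sqrt (2 / L) * Real.cos (((j : ℝ) + 1) * Real.pi * x / L)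

theorem continuous_neumannEigenfunction (L : ℝ) (j : ℕ) :
    Continuous (neumannEigenfunction L j) := by
  unfold neumannEigenfunction; fun_prop

/-- The eigenfunctions as elements of `L²`. -/
def sineMode (L : ℝ) (j : ℕ) : L2 L :=
  ofContinuous L (dirichletEigenfunction L j) (continuous_dirichletEigenfunction L j)

/-- The normalized cosines as elements of `L²`. -/
def cosineMode (L : ℝ) (j : ℕ) : L2 L :=
  ofContinuous L (neumannEigenfunction L j) (continuous_neumannEigenfunction L j)

theorem eigenCoeff_eq_inner {L : ℝ} (ψ : L2 L) (j : ℕ) :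
    eigenCoeff L ψ j = inner ℝ (sineMode L j) ψ := (inner_ofContinuous _ ψ).symm

theorem integral_cos_int_mul {L : ℝ} (hL : 0 < L) {k : ℤ} (hk : k ≠ 0) :
    ∫ x in Ioo (0 : ℝ) L, Real.cos (k * Real.pi * x / L) = 0 := by
  rw [← integral_Ioc_eq_integral_Ioo, ← intervalIntegral.integral_of_le hL.le]
  have hc : (k : ℝ) * Real.pi / L ≠ 0 := by
    have : (k : ℝ) ≠ 0 := by exact_mod_cast hk
    have := Real.pi_ne_zero
    positivity
  have h := intervalIntegral.integral_comp_mul_left (a := 0) (b := L) (fun y => Real.cos y) hc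
  have e : ∀ x, (k : ℝ) * Real.pi * x / L = k * Real.pi / L * x := fun x => by ring
  simp_rw [e]
  rw [h, integral_cos, div_mul_cancel₀ _ hL.ne', Real.sin_int_mul_pi]
  simp

theorem integral_product_to_sum {L : ℝ} (hL : 0 < L) (i j : ℕ) (s : ℝ) :
    ∫ x in Ioo (0 : ℝ) L, (Real.cos (((i - j : ℤ) : ℝ) * Real.pi * x / L) +
      s * Real.cos (((i + j + 2 : ℤ) : ℝ) * Real.pi * x / L)) = if i = j then L else 0 := by
  have hi : ∀ k : ℤ, IntegrableOn (fun x => Real.cos ((k : ℝ) * Real.pi * x / L)) (Ioo 0 L) :=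
    fun k => (Continuous.integrableOn_Icc (by fun_prop)).mono_set Ioo_subset_Icc_self
  rw [integral_add (hi _) ((hi _).const_mul s), integral_const_mul,
    integral_cos_int_mul hL (k := i + j + 2) (by positivity), mul_zero, add_zero]
  split_ifs with h
  · subst h
    simp [hL.le]
  · exact integral_cos_int_mul hL (by simpa [sub_eq_zero] using h)

theorem integral_sine_mul_sine {L : ℝ} (hL : 0 < L) (i j : ℕ) :
    ∫ x in Ioo (0 : ℝ) L, dirichletEigenfunction L i x * dirichletEigenfunction L j x =
      if i = j then 1 else 0 := by
  have h := integral_product_to_sum hL i j (-1)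
  have e : ∀ x, dirichletEigenfunction L i x * dirichletEigenfunction L j x = 1 / L *
      (Real.cos (((i - j : ℤ) : ℝ) * Real.pi * x / L) +
        (-1) * Real.cos (((i + j + 2 : ℤ) : ℝ) * Real.pi * x / L)) := by
    intro x
    have hs : Real.sqrt (2 / L) * Real.sqrt (2 / L) = 2 / L := Real.mul_self_sqrt (by positivity)
    have e1 : ((i - j : ℤ) : ℝ) * Real.pi * x / L =
        ((i : ℝ) + 1) * Real.pi * x / L - ((j : ℝ) + 1) * Real.pi * x / L := by push_cast; ring
    have e2 : ((i + j + 2 : ℤ) : ℝ) * Real.pi * x / L =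
        ((i : ℝ) + 1) * Real.pi * x / L + ((j : ℝ) + 1) * Real.pi * x / L := by push_cast; ring
    rw [e1, e2, Real.cos_sub, Real.cos_add, dirichletEigenfunction, dirichletEigenfunction,
      mul_mul_mul_comm, hs]
    ring
  simp_rw [e]
  rw [integral_const_mul, h]
  split_ifs
  · field_simp
  · simp

theorem integral_cosine_mul_cosine {L : ℝ} (hL : 0 < L) (i j : ℕ) :
    ∫ x in Ioo (0 : ℝ) L, neumannEigenfunction L i x * neumannEigenfunction L j x =
      if i = j then 1 else 0 := by
  have h := integral_product_to_sum hL i j 1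
  have e : ∀ x, neumannEigenfunction L i x * neumannEigenfunction L j x = 1 / L *
      (Real.cos (((i - j : ℤ) : ℝ) * Real.pi * x / L) +
        1 * Real.cos (((i + j + 2 : ℤ) : ℝ) * Real.pi * x / L)) := by
    intro x
    have hs : Real.sqrt (2 / L) * Real.sqrt (2 / L) = 2 / L := Real.mul_self_sqrt (by positivity)
    have e1 : ((i - j : ℤ) : ℝ) * Real.pi * x / L =
        ((i : ℝ) + 1) * Real.pi * x / L - ((j : ℝ) + 1) * Real.pi * x / L := by push_cast; ring
    have e2 : ((i + j + 2 : ℤ) : ℝ) * Real.pi * x / L =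
        ((i : ℝ) + 1) * Real.pi * x / L + ((j : ℝ) + 1) * Real.pi * x / L := by push_cast; ring
    rw [e1, e2, Real.cos_sub, Real.cos_add, neumannEigenfunction, neumannEigenfunction,
      mul_mul_mul_comm, hs]
    ring
  simp_rw [e]
  rw [integral_const_mul, h]
  split_ifs
  · field_simp
  · simp

theorem orthonormal_sineMode {L : ℝ} (hL : 0 < L) : Orthonormal ℝ (sineMode L) := by
  rw [orthonormal_iff_ite]
  intro i j
  rw [sineMode, sineMode, inner_ofContinuous_ofContinuous, integral_sine_mul_sine hL]

theorem orthonormal_cosineMode {L : ℝ} (hL : 0 < L) : Orthonormal ℝ (cosineMode L) := by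
  rw [orthonormal_iff_ite]
  intro i j
  rw [cosineMode, cosineMode, inner_ofContinuous_ofContinuous, integral_cosine_mul_cosine hL]

/-! ### Completeness of the sine system -/

/-- The odd extension of a function on `(0, ∞)`. -/
def oddExtension (f : ℝ → ℝ) (x : ℝ) : ℂ := if 0 < x then (f x : ℂ) else -(f (-x) : ℂ)

theorem oddExtension_neg {f : ℝ → ℝ} {x : ℝ} (hx : 0 < x) :
    oddExtension f (-x) = -(f x : ℂ) := by
  simp [oddExtension, not_lt.2 hx.le]

theorem integral_fourier_oddExtension {L : ℝ} (hL : 0 < L) {f : ℝ → ℝ}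
    (hf : IntegrableOn f (Ioc 0 L)) (n : ℤ) :
    ∫ x in (-L)..L, fourier (-n) (x : AddCircle (L - -L)) • oddExtension f x =
      -2 * Complex.I * ((∫ x in (0 : ℝ)..L, f x * Real.sin (n * Real.pi * x / L) : ℝ) : ℂ) := by
  have hL' : (L : ℂ) ≠ 0 := by exact_mod_cast hL.ne'
  have hfour : ∀ x : ℝ, fourier (-n) (x : AddCircle (L - -L)) =
      Complex.exp (-((n * Real.pi * x / L : ℝ) : ℂ) * Complex.I) := by
    intro x
    rw [fourier_coe_apply]
    congr 1
    push_cast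
    field_simp
    ring
  have hfc : IntegrableOn (fun x => (f x : ℂ)) (Ioc 0 L) := hf.ofReal
  have hi1 : IntervalIntegrable (fun x => (f x : ℂ)) volume 0 L :=
    (intervalIntegrable_iff_integrableOn_Ioc_of_le hL.le).2 hfc
  set E : ℝ → ℂ := fun x => Complex.exp (-((n * Real.pi * x / L : ℝ) : ℂ) * Complex.I) with hE
  have hEc : Continuous E := by rw [hE]; fun_prop
  have hA : IntervalIntegrable (fun x => E x * (f x : ℂ)) volume 0 L :=
    hi1.continuousOn_mul hEc.continuousOn
  have hB : IntervalIntegrable (fun x => E (-x) * -(f x : ℂ)) volume 0 L :=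
    hi1.neg.continuousOn_mul (hEc.comp continuous_neg).continuousOn
  have hAeq : EqOn (fun x => E x * (f x : ℂ)) (fun x => E x * oddExtension f x) (Ioc 0 L) :=
    fun x hx => by simp [oddExtension, hx.1]
  have hBeq : EqOn (fun x => E (-x) * -(f x : ℂ)) (fun x => E (-x) * oddExtension f (-x)) (Ioc 0 L) :=
    fun x hx => by simp [oddExtension_neg hx.1]
  have hA' : IntervalIntegrable (fun x => E x * oddExtension f x) volume 0 L :=
    hA.congr (by rwa [uIoc_of_le hL.le])
  have hB' : IntervalIntegrable (fun x => E (-x) * oddExtension f (-x)) volume 0 L :=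
    hB.congr (by rwa [uIoc_of_le hL.le])
  have hC : IntervalIntegrable (fun x => E x * oddExtension f x) volume (-L) 0 := by
    have := (IntervalIntegrable.iff_comp_neg).1 hB'
    simpa using this.symm
  simp_rw [hfour, smul_eq_mul]
  rw [← intervalIntegral.integral_add_adjacent_intervals hC hA']
  have h1 : ∫ x in (-L)..0, E x * oddExtension f x = ∫ x in (0 : ℝ)..L, E (-x) * -(f x : ℂ) := by
    have := intervalIntegral.integral_comp_neg (a := 0) (b := L) (fun x => E x * oddExtension f x)
    rw [neg_zero] at this
    rw [← this]
    refine intervalIntegral.integral_congr_ae (Eventually.of_forall fun x hx => ?_)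
    rw [uIoc_of_le hL.le] at hx
    exact (hBeq hx).symm
  have h2 : ∫ x in (0 : ℝ)..L, E x * oddExtension f x = ∫ x in (0 : ℝ)..L, E x * (f x : ℂ) := by
    refine intervalIntegral.integral_congr_ae (Eventually.of_forall fun x hx => ?_)
    rw [uIoc_of_le hL.le] at hx
    exact (hAeq hx).symm
  rw [h1, h2, ← intervalIntegral.integral_add hB hA, ← intervalIntegral.integral_ofReal,
    ← intervalIntegral.integral_const_mul]
  refine intervalIntegral.integral_congr fun x _ => ?_
  simp only [hE]
  have e1 : Complex.exp (-((n * Real.pi * x / L : ℝ) : ℂ) * Complex.I) =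
      Complex.cos ((n * Real.pi * x / L : ℝ) : ℂ) - Complex.sin ((n * Real.pi * x / L : ℝ) : ℂ) * Complex.I := by
    rw [Complex.exp_mul_I, Complex.cos_neg, Complex.sin_neg]; ring
  have e2 : Complex.exp (-((n * Real.pi * (-x) / L : ℝ) : ℂ) * Complex.I) =
      Complex.cos ((n * Real.pi * x / L : ℝ) : ℂ) + Complex.sin ((n * Real.pi * x / L : ℝ) : ℂ) * Complex.I := by
    rw [show -((n * Real.pi * (-x) / L : ℝ) : ℂ) = ((n * Real.pi * x / L : ℝ) : ℂ) by push_cast; ring,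
      Complex.exp_mul_I]
  rw [e1, e2, Complex.ofReal_mul, Complex.ofReal_sin]
  ring

theorem eq_zero_of_eigenCoeff_eq_zero {L : ℝ} (hL : 0 < L) {ψ : L2 L}
    (h : ∀ j, eigenCoeff L ψ j = 0) : ψ = 0 := by
  have hmem : MemLp ψ 2 (volume.restrict (Ioc (0 : ℝ) L)) := by
    rw [← restrict_Ioo_eq_restrict_Ioc]; exact Lp.memLp ψ
  have hsq : IntegrableOn (fun x => (ψ x) ^ 2) (Ioc 0 L) := hmem.integrable_sq
  have hint : IntegrableOn ψ (Ioc 0 L) := hmem.integrable (by norm_num)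
  have hm : StronglyMeasurable ψ := Lp.stronglyMeasurable ψ
  have hFm : StronglyMeasurable (oddExtension ψ) := by
    refine StronglyMeasurable.ite measurableSet_Ioi ?_ ?_
    · exact Complex.continuous_ofReal.comp_stronglyMeasurable hm
    · exact (Complex.continuous_ofReal.comp_stronglyMeasurable
        (hm.comp_measurable measurable_neg)).neg
  have hFsq0 : IntervalIntegrable (fun x => ‖oddExtension ψ x‖ ^ 2) volume 0 L := by
    refine ((intervalIntegrable_iff_integrableOn_Ioc_of_le hL.le).2 hsq).congr ?_
    rw [uIoc_of_le hL.le]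
    intro x hx
    simp [oddExtension, hx.1]
  have hFsqL : IntervalIntegrable (fun x => ‖oddExtension ψ x‖ ^ 2) volume (-L) 0 := by
    have h1 : IntervalIntegrable (fun x => ‖oddExtension ψ (-x)‖ ^ 2) volume 0 L := by
      refine hFsq0.congr ?_
      rw [uIoc_of_le hL.le]
      intro x hx
      simp only [oddExtension_neg hx.1, norm_neg]
      simp [oddExtension, hx.1]
    simpa using ((IntervalIntegrable.iff_comp_neg).1 h1).symm
  have hFsq := hFsqL.trans hFsq0
  have hF2 : MemLp (oddExtension ψ) 2 (volume.restrict (Ioc (-L) L)) := by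
    rw [memLp_two_iff_integrable_sq_norm hFm.aestronglyMeasurable]
    exact (intervalIntegrable_iff_integrableOn_Ioc_of_le (by linarith)).1 hFsq
  have hs : 0 < Real.sqrt (2 / L) := Real.sqrt_pos.2 (by positivity)
  have hsin : ∀ j : ℕ, ∫ x in (0 : ℝ)..L, ψ x * Real.sin (((j : ℝ) + 1) * Real.pi * x / L) = 0 := by
    intro j
    have h1 := h j
    rw [eigenCoeff, ← integral_Ioc_eq_integral_Ioo, ← intervalIntegral.integral_of_le hL.le] at h1
    simp only [dirichletEigenfunction, mul_left_comm _ (Real.sqrt (2 / L))] at h1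
    rw [intervalIntegral.integral_const_mul] at h1
    exact (mul_eq_zero.1 h1).resolve_left hs.ne'
  have hsinZ : ∀ n : ℤ, ∫ x in (0 : ℝ)..L, ψ x * Real.sin (n * Real.pi * x / L) = 0 := by
    intro n
    obtain ⟨m, rfl | rfl⟩ := n.eq_nat_or_neg
    · rcases m with _ | j
      · simp
      · simpa using hsin j
    · rcases m with _ | j
      · simp
      · have h1 : ∀ x : ℝ, ψ x * Real.sin (((-((j + 1 : ℕ) : ℤ) : ℤ) : ℝ) * Real.pi * x / L) =
            -(ψ x * Real.sin (((j : ℝ) + 1) * Real.pi * x / L)) := by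
          intro x
          rw [← mul_neg, ← Real.sin_neg]
          congr 2
          push_cast
          ring
        simp_rw [h1]
        rw [intervalIntegral.integral_neg, hsin j, neg_zero]
  have hLL : -L < L := by linarith
  have hcoef : ∀ n : ℤ, fourierCoeffOn hLL (oddExtension ψ) n = 0 := by
    intro n
    rw [fourierCoeffOn_eq_integral, integral_fourier_oddExtension hL hint, hsinZ]
    simp
  have hP := hasSum_sq_fourierCoeffOn hLL hF2
  simp only [hcoef, norm_zero, ne_eq, OfNat.ofNat_ne_zero, not_false_eq_true, zero_pow] at hP
  have hP0 := hP.unique hasSum_zero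
  have hI : ∫ x in (-L)..L, ‖oddExtension ψ x‖ ^ 2 = 0 := by
    rw [smul_eq_mul] at hP0
    exact (mul_eq_zero.1 hP0).resolve_left (inv_ne_zero (by linarith))
  rw [← intervalIntegral.integral_add_adjacent_intervals hFsqL hFsq0] at hI
  have h1 : 0 ≤ ∫ x in (-L)..0, ‖oddExtension ψ x‖ ^ 2 :=
    intervalIntegral.integral_nonneg (by linarith) fun x _ => by positivity
  have h2 : 0 ≤ ∫ x in (0 : ℝ)..L, ‖oddExtension ψ x‖ ^ 2 :=
    intervalIntegral.integral_nonneg hL.le fun x _ => by positivity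
  have h3 : ∫ x in (0 : ℝ)..L, ‖oddExtension ψ x‖ ^ 2 = 0 := by linarith
  have h4 : inner ℝ ψ ψ = (0 : ℝ) := by
    rw [inner_eq_integral, ← integral_Ioc_eq_integral_Ioo]
    refine Eq.trans ?_ h3
    rw [intervalIntegral.integral_of_le hL.le]
    refine setIntegral_congr_fun measurableSet_Ioc fun x hx => ?_
    simp [oddExtension, hx.1, sq]
  exact inner_self_eq_zero.1 h4

/-- The Hilbert basis of Dirichlet eigenfunctions. -/
def sineBasis {L : ℝ} (hL : 0 < L) : HilbertBasis ℕ ℝ (L2 L) :=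
  HilbertBasis.mkOfOrthogonalEqBot (orthonormal_sineMode hL) (by
    rw [Submodule.eq_bot_iff]
    intro ψ hψ
    refine eq_zero_of_eigenCoeff_eq_zero hL fun j => ?_
    rw [eigenCoeff_eq_inner]
    exact (Submodule.mem_orthogonal _ _).1 hψ _ (Submodule.subset_span ⟨j, rfl⟩))

theorem coe_sineBasis {L : ℝ} (hL : 0 < L) : ⇑(sineBasis hL) = sineMode L :=
  HilbertBasis.coe_mkOfOrthogonalEqBot _ _

theorem hasSum_inner_eigenCoeff {L : ℝ} (hL : 0 < L) (ψ χ : L2 L) :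
    HasSum (fun j => eigenCoeff L ψ j * eigenCoeff L χ j) (inner ℝ ψ χ) := by
  have h := (sineBasis hL).hasSum_inner_mul_inner ψ χ
  refine h.congr_fun fun j => ?_
  rw [coe_sineBasis, real_inner_comm, ← eigenCoeff_eq_inner, ← eigenCoeff_eq_inner]

/-- Parseval's identity. -/
theorem hasSum_sq_eigenCoeff {L : ℝ} (hL : 0 < L) (ψ : L2 L) :
    HasSum (fun j => eigenCoeff L ψ j ^ 2) (‖ψ‖ ^ 2) := by
  have h := hasSum_inner_eigenCoeff hL ψ ψ
  rw [real_inner_self_eq_norm_sq] at h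
  simpa only [sq (eigenCoeff L ψ _)] using h

end SFOR

namespace SFOR
open MeasureTheory Set Filter Topology

/-! ### Cutoff functions -/

/-- A smooth function that vanishes near the end points of `[0, L]` and is `1` on
`[2δ, L - 2δ]`. -/
def cutoff (L δ x : ℝ) : ℝ :=
  Real.smoothTransition (x / δ - 1) * Real.smoothTransition ((L - x) / δ - 1)

theorem contDiff_cutoff (L δ : ℝ) : ContDiff ℝ ((⊤ : ℕ∞) : WithTop ℕ∞) (cutoff L δ) := by
  unfold cutoff
  refine ContDiff.mul ?_ ?_
  · exact Real.smoothTransition.contDiff.comp (by fun_prop)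
  · exact Real.smoothTransition.contDiff.comp (by fun_prop)

theorem cutoff_mem_Icc (L δ x : ℝ) : cutoff L δ x ∈ Icc (0 : ℝ) 1 := by
  have h1 := Real.smoothTransition.nonneg (x / δ - 1)
  have h2 := Real.smoothTransition.nonneg ((L - x) / δ - 1)
  have h3 := Real.smoothTransition.le_one (x / δ - 1)
  have h4 := Real.smoothTransition.le_one ((L - x) / δ - 1)
  exact ⟨mul_nonneg h1 h2, mul_le_one₀ h3 h2 h4⟩

theorem tsupport_cutoff_subset {L δ : ℝ} (hδ : 0 < δ) : tsupport (cutoff L δ) ⊆ Icc δ (L - δ) := by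
  refine closure_minimal (fun x hx => ?_) isClosed_Icc
  by_contra h
  refine hx ?_
  rw [mem_Icc, not_and_or, not_le, not_le] at h
  rcases h with h | h
  · rw [cutoff, Real.smoothTransition.zero_of_nonpos, zero_mul]
    rw [sub_nonpos, div_le_one hδ]; exact h.le
  · rw [cutoff, Real.smoothTransition.zero_of_nonpos (x := (L - x) / δ - 1), mul_zero]
    rw [sub_nonpos, div_le_one hδ]; linarith

theorem cutoff_eq_one {L δ x : ℝ} (hδ : 0 < δ) (h1 : 2 * δ ≤ x) (h2 : x ≤ L - 2 * δ) :
    cutoff L δ x = 1 := by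
  rw [cutoff, Real.smoothTransition.one_of_one_le, Real.smoothTransition.one_of_one_le, one_mul]
  · rw [le_sub_iff_add_le, le_div_iff₀ hδ]; linarith
  · rw [le_sub_iff_add_le, le_div_iff₀ hδ]; linarith

theorem deriv_cutoff_eq_zero {L δ x : ℝ} (hδ : 0 < δ) (h1 : 2 * δ < x) (h2 : x < L - 2 * δ) :
    deriv (cutoff L δ) x = 0 := by
  have : cutoff L δ =ᶠ[𝓝 x] fun _ => 1 := by
    filter_upwards [Ioo_mem_nhds h1 h2] with y hy
    exact cutoff_eq_one hδ hy.1.le hy.2.le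
  rw [this.deriv_eq, deriv_const]

theorem exists_abs_deriv_cutoff_le : ∃ M, 0 < M ∧ ∀ L δ x : ℝ, 0 < δ →
    |deriv (cutoff L δ) x| ≤ M / δ := by
  have hS : ContDiff ℝ 1 Real.smoothTransition := Real.smoothTransition.contDiff (n := 1)
  have hd : Continuous (deriv Real.smoothTransition) := hS.continuous_deriv le_rfl
  obtain ⟨M, hM⟩ := (isCompact_Icc (a := (0 : ℝ)) (b := 1)).exists_bound_of_continuousOn
    hd.continuousOn
  have hM' : ∀ x, |deriv Real.smoothTransition x| ≤ M := by
    intro x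
    have hM0 : 0 ≤ M := (norm_nonneg _).trans (hM 0 (by simp))
    rcases lt_or_ge x 0 with h | h
    · have : Real.smoothTransition =ᶠ[𝓝 x] fun _ => 0 := by
        filter_upwards [Iio_mem_nhds h] with y hy
        exact Real.smoothTransition.zero_of_nonpos (le_of_lt hy)
      rw [this.deriv_eq, deriv_const, abs_zero]; exact hM0
    rcases lt_or_ge 1 x with h' | h'
    · have : Real.smoothTransition =ᶠ[𝓝 x] fun _ => 1 := by
        filter_upwards [Ioi_mem_nhds h'] with y hy
        exact Real.smoothTransition.one_of_one_le (le_of_lt hy)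
      rw [this.deriv_eq, deriv_const, abs_zero]; exact hM0
    · exact hM x ⟨h, h'⟩
  refine ⟨2 * M + 1, by linarith [(abs_nonneg _).trans (hM' 0)], fun L δ x hδ => ?_⟩
  have hS' : ∀ y, HasDerivAt Real.smoothTransition (deriv Real.smoothTransition y) y := fun y =>
    (hS.differentiable one_ne_zero y).hasDerivAt
  have e1 : HasDerivAt (fun x => Real.smoothTransition (x / δ - 1))
      (deriv Real.smoothTransition (x / δ - 1) * (1 / δ)) x :=
    (hS' _).comp x (((hasDerivAt_id x).div_const δ).sub_const 1)
  have e2 : HasDerivAt (fun x => Real.smoothTransition ((L - x) / δ - 1))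
      (deriv Real.smoothTransition ((L - x) / δ - 1) * (-1 / δ)) x :=
    (hS' _).comp x ((((hasDerivAt_id x).const_sub L).div_const δ).sub_const 1)
  have e3 : deriv (cutoff L δ) x = _ := (e1.mul e2).deriv
  rw [e3]
  have n1 := Real.smoothTransition.nonneg (x / δ - 1)
  have n2 := Real.smoothTransition.nonneg ((L - x) / δ - 1)
  have l1 := Real.smoothTransition.le_one (x / δ - 1)
  have l2 := Real.smoothTransition.le_one ((L - x) / δ - 1)
  refine (abs_add_le _ _).trans ?_
  have k1 := hM' (x / δ - 1)
  have k2 := hM' ((L - x) / δ - 1)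
  rw [abs_mul, abs_mul, abs_mul, abs_mul, abs_of_nonneg n1, abs_of_nonneg n2, abs_div, abs_div,
    abs_neg, abs_one, abs_of_pos hδ]
  have hM0 := (abs_nonneg _).trans k1
  calc _ ≤ M * (1 / δ) * 1 + 1 * (M * (1 / δ)) := by gcongr
    _ = 2 * M / δ := by ring
    _ ≤ _ := by gcongr; linarith

/-! ### Weak derivatives against functions that do not vanish near the boundary -/

theorem integrableOn_mul_continuous {L : ℝ} (w : L2 L) {f : ℝ → ℝ} (hf : Continuous f) :
    IntegrableOn (fun x => w x * f x) (Ioo 0 L) := by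
  have h := (Lp.memLp w).integrable_mul (memLp_of_continuous L hf)
  exact h

theorem weakDeriv_of_tendsto {L : ℝ} {w g : L2 L} (h : HasWeakDeriv L w g) {ψ : ℝ → ℝ}
    (hψ : ContDiff ℝ ((⊤ : ℕ∞) : WithTop ℕ∞) ψ)
    (hlim : Tendsto (fun δ => ∫ x in Ioo (0 : ℝ) L, w x * ψ x * deriv (cutoff L δ) x) (𝓝[>] 0) (𝓝 0)) :
    ∫ x in Ioo (0 : ℝ) L, w x * deriv ψ x = - ∫ x in Ioo (0 : ℝ) L, g x * ψ x := by
  have hψd : Continuous (deriv ψ) := hψ.continuous_deriv (by exact_mod_cast le_top)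
  have hdom : ∀ (v : L2 L) (f : ℝ → ℝ), Continuous f →
      Tendsto (fun δ => ∫ x in Ioo (0 : ℝ) L, v x * f x * cutoff L δ x) (𝓝[>] 0)
        (𝓝 (∫ x in Ioo (0 : ℝ) L, v x * f x)) := by
    intro v f hf
    have hi := integrableOn_mul_continuous v hf
    refine tendsto_integral_filter_of_dominated_convergence (fun x => ‖v x * f x‖) ?_ ?_ hi.norm ?_
    · exact Eventually.of_forall fun δ =>
        hi.aestronglyMeasurable.mul (contDiff_cutoff L δ).continuous.aestronglyMeasurable
    · refine Eventually.of_forall fun δ => Eventually.of_forall fun x => ?_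
      have := cutoff_mem_Icc L δ x
      rw [norm_mul, Real.norm_of_nonneg this.1]
      exact mul_le_of_le_one_right (norm_nonneg _) this.2
    · refine (ae_restrict_iff' measurableSet_Ioo).2 (Eventually.of_forall fun x hx => ?_)
      refine tendsto_const_nhds.congr' ?_
      have h1 : 0 < min x (L - x) / 2 := by
        have : 0 < min x (L - x) := lt_min hx.1 (sub_pos.2 hx.2)
        positivity
      filter_upwards [Ioo_mem_nhdsGT h1] with δ hδ
      have h2 := min_le_left x (L - x)
      have h3 := min_le_right x (L - x)
      rw [cutoff_eq_one hδ.1 (by linarith [hδ.2]) (by linarith [hδ.2]), mul_one]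
  have h1 := (hdom w _ hψd).add hlim
  have h2 := (hdom g _ hψ.continuous).neg
  rw [add_zero] at h1
  refine tendsto_nhds_unique h1 (h2.congr' ?_)
  filter_upwards [self_mem_nhdsWithin] with δ hδ
  have hδ : 0 < δ := hδ
  have hχ := contDiff_cutoff L δ
  have hχd : Continuous (deriv (cutoff L δ)) := hχ.continuous_deriv (by exact_mod_cast le_top)
  have hsub : tsupport (fun x => ψ x * cutoff L δ x) ⊆ Icc δ (L - δ) :=
    (tsupport_mul_subset_right).trans (tsupport_cutoff_subset hδ)
  have hcs : HasCompactSupport (fun x => ψ x * cutoff L δ x) :=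
    HasCompactSupport.of_support_subset_isCompact isCompact_Icc
      ((subset_tsupport _).trans hsub)
  have h3 := h (fun x => ψ x * cutoff L δ x) (hψ.mul hχ) hcs
    (hsub.trans (Icc_subset_Ioo hδ (by linarith)))
  have h4 : ∀ x, deriv (fun x => ψ x * cutoff L δ x) x =
      deriv ψ x * cutoff L δ x + ψ x * deriv (cutoff L δ) x := by
    intro x
    exact deriv_fun_mul (hψ.differentiable (by simp) x) (hχ.differentiable (by simp) x)
  simp_rw [h4] at h3
  rw [← integral_add]
  · rw [show (fun x => w x * deriv ψ x * cutoff L δ x + w x * ψ x * deriv (cutoff L δ) x) =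
        fun x => w x * (deriv ψ x * cutoff L δ x + ψ x * deriv (cutoff L δ) x) by ext x; ring, h3]
    congr 2
    ext x; ring
  · have := integrableOn_mul_continuous w (hψd.mul hχ.continuous)
    refine this.congr_fun (fun x _ => ?_) measurableSet_Ioo
    simp only [Pi.mul_apply]; ring
  · have := integrableOn_mul_continuous w (hψ.continuous.mul hχd)
    refine this.congr_fun (fun x _ => ?_) measurableSet_Ioo
    simp only [Pi.mul_apply]; ring

/-- Integration by parts against a smooth function that vanishes at the end points. -/
theorem weakDeriv_of_vanishing {L : ℝ} {w g : L2 L} (h : HasWeakDeriv L w g)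
    {ψ : ℝ → ℝ} (hψ : ContDiff ℝ ((⊤ : ℕ∞) : WithTop ℕ∞) ψ) {B : ℝ}
    (h0 : ∀ x, |ψ x| ≤ B * |x|) (hB : ∀ x, |ψ x| ≤ B * |L - x|) :
    ∫ x in Ioo (0 : ℝ) L, w x * deriv ψ x = - ∫ x in Ioo (0 : ℝ) L, g x * ψ x := by
  refine weakDeriv_of_tendsto h hψ ?_
  obtain ⟨M, hM0, hM⟩ := exists_abs_deriv_cutoff_le
  have hB0 : 0 ≤ B := by
    have := (abs_nonneg _).trans (h0 1)
    simpa using this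
  have hw : IntegrableOn w (Ioo 0 L) := (Lp.memLp w).integrable (by norm_num)
  have := tendsto_integral_filter_of_dominated_convergence (μ := volume.restrict (Ioo (0 : ℝ) L))
    (l := 𝓝[>] (0 : ℝ)) (F := fun δ x => w x * ψ x * deriv (cutoff L δ) x) (f := fun _ => (0 : ℝ))
    (fun x => ‖w x‖ * (B * 2 * M)) ?_ ?_ (hw.norm.mul_const _) ?_
  · simpa using this
  · refine Eventually.of_forall fun δ => ?_
    have hχd : Continuous (deriv (cutoff L δ)) :=
      (contDiff_cutoff L δ).continuous_deriv (by exact_mod_cast le_top)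
    exact (hw.aestronglyMeasurable.mul hψ.continuous.aestronglyMeasurable).mul
      hχd.aestronglyMeasurable
  · filter_upwards [self_mem_nhdsWithin] with δ hδ
    have hδ : 0 < δ := hδ
    refine (ae_restrict_iff' measurableSet_Ioo).2 (Eventually.of_forall fun x hx => ?_)
    rw [norm_mul, norm_mul, mul_assoc]
    refine mul_le_mul_of_nonneg_left ?_ (norm_nonneg _)
    rw [Real.norm_eq_abs, Real.norm_eq_abs]
    have hk : |ψ x| ≤ B * (2 * δ) ∨ deriv (cutoff L δ) x = 0 := by
      rcases le_or_gt x (2 * δ) with h1 | h1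
      · left
        refine (h0 x).trans (mul_le_mul_of_nonneg_left ?_ hB0)
        rwa [abs_of_pos hx.1]
      rcases le_or_gt (L - 2 * δ) x with h2 | h2
      · left
        refine (hB x).trans (mul_le_mul_of_nonneg_left ?_ hB0)
        rw [abs_of_pos (sub_pos.2 hx.2)]; linarith
      · right
        exact deriv_cutoff_eq_zero hδ h1 h2
    rcases hk with h1 | h1
    · calc |ψ x| * |deriv (cutoff L δ) x| ≤ B * (2 * δ) * (M / δ) := by gcongr; exact hM L δ x hδ
        _ = B * 2 * M := by field_simp
    · rw [h1, abs_zero, mul_zero]; positivity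
  · refine (ae_restrict_iff' measurableSet_Ioo).2 (Eventually.of_forall fun x hx => ?_)
    refine tendsto_const_nhds.congr' ?_
    have h1 : 0 < min x (L - x) / 2 := by
      have : 0 < min x (L - x) := lt_min hx.1 (sub_pos.2 hx.2)
      positivity
    filter_upwards [Ioo_mem_nhdsGT h1] with δ hδ
    have h2 := min_le_left x (L - x)
    have h3 := min_le_right x (L - x)
    rw [deriv_cutoff_eq_zero hδ.1 (by linarith [hδ.2]) (by linarith [hδ.2]), mul_zero]

/-- `w` has a continuous representative that vanishes at both end points. -/
def HasZeroTrace (L : ℝ) (w : L2 L) : Prop :=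
  ∃ c : ℝ → ℝ, ContinuousOn c (Icc 0 L) ∧ c 0 = 0 ∧ c L = 0 ∧
    (w : ℝ → ℝ) =ᵐ[volume.restrict (Ioo (0 : ℝ) L)] c

/-- Integration by parts for a function with zero boundary values. -/
theorem weakDeriv_of_hasZeroTrace {L : ℝ} (hL : 0 < L) {w g : L2 L} (h : HasWeakDeriv L w g)
    (hw : HasZeroTrace L w) {ψ : ℝ → ℝ} (hψ : ContDiff ℝ ((⊤ : ℕ∞) : WithTop ℕ∞) ψ) :
    ∫ x in Ioo (0 : ℝ) L, w x * deriv ψ x = - ∫ x in Ioo (0 : ℝ) L, g x * ψ x := by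
  refine weakDeriv_of_tendsto h hψ ?_
  obtain ⟨M, hM0, hM⟩ := exists_abs_deriv_cutoff_le
  obtain ⟨c, hc, hc0, hcL, hwc⟩ := hw
  obtain ⟨B, hB⟩ := (isCompact_Icc (a := (0 : ℝ)) (b := L)).exists_bound_of_continuousOn
    hψ.continuous.continuousOn
  have hB0 : 0 ≤ B := (norm_nonneg _).trans (hB 0 ⟨le_rfl, hL.le⟩)
  rw [Metric.tendsto_nhds]
  intro ε hε
  set ε' := ε / (4 * B * M + 1) with hε'
  have hε'0 : 0 < ε' := by positivity
  obtain ⟨η₁, hη₁, h₁⟩ := Metric.continuousWithinAt_iff.1 (hc 0 ⟨le_rfl, hL.le⟩) ε' hε'0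
  obtain ⟨η₂, hη₂, h₂⟩ := Metric.continuousWithinAt_iff.1 (hc L ⟨hL.le, le_rfl⟩) ε' hε'0
  have hη : 0 < min η₁ η₂ / 2 := by positivity
  filter_upwards [Ioo_mem_nhdsGT hη] with δ hδ
  have hδ0 : 0 < δ := hδ.1
  have m1 := min_le_left η₁ η₂
  have m2 := min_le_right η₁ η₂
  set E : Set ℝ := Ioc 0 (2 * δ) ∪ Ico (L - 2 * δ) L with hE
  have hvol : volume.real (E ∩ Ioo 0 L) ≤ 4 * δ := by
    have e1 : volume.real (Ioc 0 (2 * δ)) = 2 * δ := by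
      rw [Real.volume_real_Ioc_of_le (by linarith)]; ring
    have e2 : volume.real (Ico (L - 2 * δ) L) = 2 * δ := by
      rw [Real.volume_real_Ico_of_le (by linarith)]; ring
    refine (measureReal_mono inter_subset_left ?_).trans ((measureReal_union_le _ _).trans ?_)
    · rw [hE]; exact (measure_union_lt_top measure_Ioc_lt_top measure_Ico_lt_top).ne
    · rw [e1, e2]; linarith
  have hcongr : ∫ x in Ioo (0 : ℝ) L, w x * ψ x * deriv (cutoff L δ) x =
      ∫ x in E ∩ Ioo (0 : ℝ) L, c x * ψ x * deriv (cutoff L δ) x := by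
    have e1 : ∫ x in Ioo (0 : ℝ) L, w x * ψ x * deriv (cutoff L δ) x =
        ∫ x in Ioo (0 : ℝ) L, c x * ψ x * deriv (cutoff L δ) x := by
      refine integral_congr_ae ?_
      filter_upwards [hwc] with x hx
      rw [hx]
    rw [e1]
    refine setIntegral_eq_of_subset_of_forall_sdiff_eq_zero measurableSet_Ioo inter_subset_right ?_
    intro x hx
    have hxE : x ∉ E := fun h => hx.2 ⟨h, hx.1⟩
    rw [hE, mem_union, not_or, mem_Ioc, mem_Ico, not_and, not_and, not_le] at hxE
    rw [deriv_cutoff_eq_zero hδ0 (hxE.1 hx.1.1) ?_, mul_zero]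
    by_contra hcon
    exact hxE.2 (not_lt.1 hcon) hx.1.2
  rw [hcongr, dist_zero_right]
  have hbd : ∀ x ∈ E ∩ Ioo 0 L, ‖c x * ψ x * deriv (cutoff L δ) x‖ ≤ ε' * B * (M / δ) := by
    intro x hx
    have hxI : x ∈ Icc 0 L := Ioo_subset_Icc_self hx.2
    have hcx : ‖c x‖ ≤ ε' := by
      rcases hx.1 with h | h
      · have := h₁ hxI (by
          rw [Real.dist_eq, sub_zero, abs_of_pos h.1]
          exact h.2.trans_lt (by linarith [hδ.2]))
        rw [hc0, dist_zero_right] at this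
        exact this.le
      · have := h₂ hxI (by
          rw [Real.dist_eq, abs_sub_comm, abs_of_pos (sub_pos.2 h.2)]
          linarith [hδ.2, h.1])
        rw [hcL, dist_zero_right] at this
        exact this.le
    rw [norm_mul, norm_mul]
    have k2 := hB x hxI
    have k3 := hM L δ x hδ0
    rw [← Real.norm_eq_abs] at k3
    gcongr
  have hfin : volume (E ∩ Ioo 0 L) < ⊤ :=
    (measure_mono inter_subset_right).trans_lt (by simp)
  refine (norm_setIntegral_le_of_norm_le_const hfin hbd).trans_lt ?_
  calc ε' * B * (M / δ) * volume.real (E ∩ Ioo 0 L) ≤ ε' * B * (M / δ) * (4 * δ) := by gcongr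
    _ = ε' * (4 * B * M) := by field_simp
    _ < ε' * (4 * B * M + 1) := by
        apply mul_lt_mul_of_pos_left _ hε'0; linarith
    _ = ε := by rw [hε']; field_simp

end SFOR

namespace SFOR
open MeasureTheory Set Filter Topology

/-! ### Eigenfunction coefficients -/

/-- The square root `k π / L`, `k = j + 1`, of the Dirichlet eigenvalue. -/
def frequency (L : ℝ) (j : ℕ) : ℝ := ((j : ℝ) + 1) * Real.pi / L

theorem frequency_pos {L : ℝ} (hL : 0 < L) (j : ℕ) : 0 < frequency L j := by
  have := Real.pi_pos
  unfold frequency; positivity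

theorem dirichletEigenvalue_eq (L : ℝ) (j : ℕ) : dirichletEigenvalue L j = frequency L j ^ 2 := rfl

theorem hasDerivAt_dirichletEigenfunction (L : ℝ) (j : ℕ) (x : ℝ) :
    HasDerivAt (dirichletEigenfunction L j) (frequency L j * neumannEigenfunction L j x) x := by
  have h1 : HasDerivAt (fun x : ℝ => ((j : ℝ) + 1) * Real.pi * x / L) (frequency L j) x := by
    simpa [frequency] using (((hasDerivAt_id x).const_mul (((j : ℝ) + 1) * Real.pi)).div_const L)
  refine (h1.sin.const_mul (Real.sqrt (2 / L))).congr_deriv ?_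
  rw [neumannEigenfunction]; ring

theorem hasDerivAt_neumannEigenfunction (L : ℝ) (j : ℕ) (x : ℝ) :
    HasDerivAt (neumannEigenfunction L j) (-(frequency L j * dirichletEigenfunction L j x)) x := by
  have h1 : HasDerivAt (fun x : ℝ => ((j : ℝ) + 1) * Real.pi * x / L) (frequency L j) x := by
    simpa [frequency] using (((hasDerivAt_id x).const_mul (((j : ℝ) + 1) * Real.pi)).div_const L)
  refine (h1.cos.const_mul (Real.sqrt (2 / L))).congr_deriv ?_
  rw [dirichletEigenfunction]; ring

theorem contDiff_dirichletEigenfunction (L : ℝ) (j : ℕ) {n : WithTop ℕ∞} :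
    ContDiff ℝ n (dirichletEigenfunction L j) := by
  unfold dirichletEigenfunction; fun_prop

theorem contDiff_neumannEigenfunction (L : ℝ) (j : ℕ) {n : WithTop ℕ∞} :
    ContDiff ℝ n (neumannEigenfunction L j) := by
  unfold neumannEigenfunction; fun_prop

theorem dirichletEigenfunction_zero (L : ℝ) (j : ℕ) : dirichletEigenfunction L j 0 = 0 := by
  simp [dirichletEigenfunction]

theorem dirichletEigenfunction_reflect {L : ℝ} (hL : 0 < L) (j : ℕ) (x : ℝ) :
    |dirichletEigenfunction L j (L - x)| = |dirichletEigenfunction L j x| := by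
  have e : ((j : ℝ) + 1) * Real.pi * (L - x) / L =
      ((j + 1 : ℕ) : ℝ) * Real.pi - ((j : ℝ) + 1) * Real.pi * x / L := by
    push_cast; field_simp
  rw [dirichletEigenfunction, dirichletEigenfunction, e, Real.sin_nat_mul_pi_sub, abs_mul, abs_mul,
    abs_neg, abs_mul, abs_pow, abs_neg, abs_one, one_pow, one_mul]

theorem dirichletEigenfunction_right {L : ℝ} (hL : 0 < L) (j : ℕ) :
    dirichletEigenfunction L j L = 0 := by
  have h := dirichletEigenfunction_reflect hL j 0
  rwa [sub_zero, dirichletEigenfunction_zero, abs_zero, abs_eq_zero] at h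

theorem abs_dirichletEigenfunction_le {L : ℝ} (hL : 0 < L) (j : ℕ) (x : ℝ) :
    |dirichletEigenfunction L j x| ≤ Real.sqrt (2 / L) * frequency L j * |x| := by
  rw [dirichletEigenfunction, abs_mul, abs_of_nonneg (Real.sqrt_nonneg _),
    mul_assoc (Real.sqrt (2 / L))]
  refine mul_le_mul_of_nonneg_left (Real.abs_sin_le_abs.trans_eq ?_) (Real.sqrt_nonneg _)
  rw [show ((j : ℝ) + 1) * Real.pi * x / L = frequency L j * x by rw [frequency]; ring, abs_mul,
    abs_of_pos (frequency_pos hL j)]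

theorem abs_dirichletEigenfunction_le_sqrt (L : ℝ) (j : ℕ) (x : ℝ) :
    |dirichletEigenfunction L j x| ≤ Real.sqrt (2 / L) := by
  rw [dirichletEigenfunction, abs_mul, abs_of_nonneg (Real.sqrt_nonneg _)]
  exact mul_le_of_le_one_right (Real.sqrt_nonneg _) (Real.abs_sin_le_one _)

/-- The eigenfunction coefficients diagonalize the weak Dirichlet Laplacian. -/
theorem eigenCoeff_laplacian {L : ℝ} (hL : 0 < L) {w h : L2 L} (hw : HasZeroTrace L w)
    (hh : HasWeakLaplacian L w h) (j : ℕ) :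
    eigenCoeff L h j = -(frequency L j ^ 2 * eigenCoeff L w j) := by
  obtain ⟨g, hwg, hgh⟩ := hh
  have h1 := weakDeriv_of_vanishing hgh (contDiff_dirichletEigenfunction L j)
    (abs_dirichletEigenfunction_le hL j) (fun x => by
      rw [← dirichletEigenfunction_reflect hL]; exact abs_dirichletEigenfunction_le hL j _)
  have h2 := weakDeriv_of_hasZeroTrace hL hwg hw (contDiff_neumannEigenfunction L j)
  simp_rw [(hasDerivAt_dirichletEigenfunction L j _).deriv, mul_left_comm _ (frequency L j)] at h1
  simp_rw [(hasDerivAt_neumannEigenfunction L j _).deriv, mul_neg, mul_left_comm _ (frequency L j)]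
    at h2
  rw [integral_const_mul] at h1
  rw [integral_neg, integral_const_mul, neg_inj] at h2
  rw [← h2] at h1
  rw [eigenCoeff, eigenCoeff]
  linarith

theorem eigenCoeff_sub {L : ℝ} (ψ χ : L2 L) (j : ℕ) :
    eigenCoeff L (ψ - χ) j = eigenCoeff L ψ j - eigenCoeff L χ j := by
  simp only [eigenCoeff_eq_inner, inner_sub_right]

theorem eigenCoeff_add {L : ℝ} (ψ χ : L2 L) (j : ℕ) :
    eigenCoeff L (ψ + χ) j = eigenCoeff L ψ j + eigenCoeff L χ j := by
  simp only [eigenCoeff_eq_inner, inner_add_right]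

theorem eigenCoeff_smul {L : ℝ} (c : ℝ) (ψ : L2 L) (j : ℕ) :
    eigenCoeff L (c • ψ) j = c * eigenCoeff L ψ j := by
  simp only [eigenCoeff_eq_inner, inner_smul_right]

theorem eigenCoeff_zero {L : ℝ} (j : ℕ) : eigenCoeff L (0 : L2 L) j = 0 := by
  simp only [eigenCoeff_eq_inner, inner_zero_right]

theorem MemH10.hasZeroTrace {L : ℝ} {w : L2 L} (h : MemH10 L w) : HasZeroTrace L w := h.2

theorem HasZeroTrace.add {L : ℝ} {w v : L2 L} (hw : HasZeroTrace L w) (hv : HasZeroTrace L v) :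
    HasZeroTrace L (w + v) := by
  obtain ⟨c, hc, hc0, hcL, hwc⟩ := hw
  obtain ⟨d, hd, hd0, hdL, hvd⟩ := hv
  refine ⟨fun x => c x + d x, hc.add hd, by simp [hc0, hd0], by simp [hcL, hdL], ?_⟩
  filter_upwards [hwc, hvd, Lp.coeFn_add w v] with x h1 h2 h3
  rw [h3, Pi.add_apply, h1, h2]

theorem HasZeroTrace.smul {L : ℝ} {w : L2 L} (a : ℝ) (hw : HasZeroTrace L w) :
    HasZeroTrace L (a • w) := by
  obtain ⟨c, hc, hc0, hcL, hwc⟩ := hw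
  refine ⟨fun x => a * c x, continuousOn_const.mul hc, by simp [hc0], by simp [hcL], ?_⟩
  filter_upwards [hwc, Lp.coeFn_smul a w] with x h1 h2
  rw [h2, Pi.smul_apply, h1, smul_eq_mul]

theorem ext_eigenCoeff {L : ℝ} (hL : 0 < L) {ψ χ : L2 L}
    (h : ∀ j, eigenCoeff L ψ j = eigenCoeff L χ j) : ψ = χ :=
  sub_eq_zero.1 (eq_zero_of_eigenCoeff_eq_zero hL fun j => by rw [eigenCoeff_sub, h, sub_self])

/-- A function with absolutely summable sine coefficients vanishes at the end points. -/
theorem hasZeroTrace_of_summable {L : ℝ} (hL : 0 < L) {w : L2 L}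
    (h : Summable fun j => |eigenCoeff L w j|) : HasZeroTrace L w := by
  have hb : ∀ j x, ‖eigenCoeff L w j * dirichletEigenfunction L j x‖ ≤
      |eigenCoeff L w j| * Real.sqrt (2 / L) := fun j x => by
    rw [norm_mul]
    exact mul_le_mul_of_nonneg_left (abs_dirichletEigenfunction_le_sqrt L j x) (abs_nonneg _)
  have hs := h.mul_right (Real.sqrt (2 / L))
  set c : ℝ → ℝ := fun x => ∑' j, eigenCoeff L w j * dirichletEigenfunction L j x with hc
  have hcont : Continuous c :=
    continuous_tsum (fun j => continuous_const.mul (continuous_dirichletEigenfunction L j)) hs hb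
  refine ⟨c, hcont.continuousOn, ?_, ?_, ?_⟩
  · simp [hc, dirichletEigenfunction_zero]
  · simp [hc, dirichletEigenfunction_right hL]
  have hw : w = ofContinuous L c hcont := by
    refine ext_eigenCoeff hL fun i => ?_
    rw [eigenCoeff_eq_inner (ofContinuous L c hcont), sineMode, inner_ofContinuous_ofContinuous]
    set F : ℕ → ℝ → ℝ := fun j x =>
      dirichletEigenfunction L i x * (eigenCoeff L w j * dirichletEigenfunction L j x) with hF
    have hFc : ∀ j, Continuous (F j) := fun j => (continuous_dirichletEigenfunction L i).mul
      (continuous_const.mul (continuous_dirichletEigenfunction L j))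
    have hFi : ∀ j, Integrable (F j) (volume.restrict (Ioo (0 : ℝ) L)) := fun j =>
      ((hFc j).integrableOn_Icc).mono_set Ioo_subset_Icc_self
    have hFb : ∀ j x, ‖F j x‖ ≤ Real.sqrt (2 / L) * (|eigenCoeff L w j| * Real.sqrt (2 / L)) := by
      intro j x
      rw [hF, norm_mul]
      exact mul_le_mul (abs_dirichletEigenfunction_le_sqrt L i x) (hb j x) (norm_nonneg _)
        (Real.sqrt_nonneg _)
    have hsum : Summable fun j => ∫ x in Ioo (0 : ℝ) L, ‖F j x‖ := by
      refine Summable.of_nonneg_of_le (fun j => integral_nonneg fun x => norm_nonneg _)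
        (fun j => (integral_mono (hFi j).norm (integrable_const _) (hFb j)).trans_eq
          (by rw [integral_const])) ?_
      exact (hs.mul_left _).mul_left _
    have hval : ∀ j, ∫ x in Ioo (0 : ℝ) L, F j x = if j = i then eigenCoeff L w i else 0 := by
      intro j
      have e : ∀ x, F j x = eigenCoeff L w j *
          (dirichletEigenfunction L j x * dirichletEigenfunction L i x) := fun x => by
        rw [hF]; ring
      simp_rw [e]
      rw [integral_const_mul, integral_sine_mul_sine hL]
      split_ifs with hji
      · rw [hji, mul_one]
      · rw [mul_zero]
    have key := hasSum_integral_of_summable_integral_norm hFi hsum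
    simp_rw [hval] at key
    rw [(hasSum_ite_eq i (eigenCoeff L w i)).unique key]
    refine integral_congr_ae (Eventually.of_forall fun x => ?_)
    simp only [hF, hc]
    rw [tsum_mul_left]
  rw [hw]
  exact coeFn_ofContinuous hcont

/-! ### The weak gradient in terms of the coefficients -/

theorem exists_hasSum_cosineMode {L : ℝ} (hL : 0 < L) {c : ℕ → ℝ} (h : Summable fun j => c j ^ 2) :
    ∃ g : L2 L, HasSum (fun j => c j • cosineMode L j) g ∧ HasSum (fun j => c j ^ 2) (‖g‖ ^ 2) := by
  have ho := orthonormal_cosineMode hL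
  have hs : Summable fun j => c j • cosineMode L j := by
    have := (ho.orthogonalFamily.summable_iff_norm_sq_summable c).2 (by simpa using h)
    simpa using this
  refine ⟨_, hs.hasSum, ?_⟩
  set g := ∑' j, c j • cosineMode L j
  have hin : ∀ i, inner ℝ (cosineMode L i) g = c i := by
    intro i
    have h1 := hs.hasSum.mapL (innerSL ℝ (cosineMode L i))
    have h2 : (fun j => innerSL ℝ (cosineMode L i) (c j • cosineMode L j)) =
        fun j => if j = i then c i else 0 := by
      ext j
      rw [innerSL_apply_apply, inner_smul_right, orthonormal_iff_ite.1 ho]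
      by_cases hij : i = j
      · simp [hij]
      · simp [hij, Ne.symm hij]
    rw [h2] at h1
    exact h1.unique (hasSum_ite_eq i (c i))
  have h3 := hs.hasSum.mapL (innerSL ℝ g)
  rw [innerSL_apply_apply, real_inner_self_eq_norm_sq] at h3
  refine h3.congr_fun fun j => ?_
  rw [innerSL_apply_apply, inner_smul_right, real_inner_comm, hin, sq]

theorem integral_sine_mul_deriv {L : ℝ} (hL : 0 < L) (j : ℕ) {φ : ℝ → ℝ}
    (hφ : ContDiff ℝ ((⊤ : ℕ∞) : WithTop ℕ∞) φ) (hsupp : tsupport φ ⊆ Ioo (0 : ℝ) L) :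
    ∫ x in Ioo (0 : ℝ) L, deriv φ x * dirichletEigenfunction L j x =
      -(frequency L j * ∫ x in Ioo (0 : ℝ) L, φ x * neumannEigenfunction L j x) := by
  have h0 : φ 0 = 0 := image_eq_zero_of_notMem_tsupport fun h => (hsupp h).1.ne rfl
  have hφL : φ L = 0 := image_eq_zero_of_notMem_tsupport fun h => (hsupp h).2.ne rfl
  have hd : Continuous (deriv φ) := hφ.continuous_deriv (by exact_mod_cast le_top)
  have h := intervalIntegral.integral_mul_deriv_eq_deriv_mul (a := 0) (b := L)
    (u := dirichletEigenfunction L j) (v := φ)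
    (fun x _ => hasDerivAt_dirichletEigenfunction L j x)
    (fun x _ => (hφ.differentiable (by simp) x).hasDerivAt)
    ((continuous_const.mul (continuous_neumannEigenfunction L j)).intervalIntegrable _ _)
    (hd.intervalIntegrable _ _)
  rw [h0, hφL, mul_zero, mul_zero, sub_zero, zero_sub] at h
  simp only [← integral_Ioc_eq_integral_Ioo]
  simp only [← intervalIntegral.integral_of_le hL.le]
  simp_rw [mul_comm (deriv φ _), h]
  rw [← intervalIntegral.integral_const_mul]
  congr 1
  refine intervalIntegral.integral_congr fun x _ => ?_
  ring

/-- If `∑ λ_j (w, φ_j)² < ∞` then `w` has a weak derivative, with the corresponding norm. -/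
theorem exists_hasWeakDeriv {L : ℝ} (hL : 0 < L) {w : L2 L}
    (h : Summable fun j => (frequency L j * eigenCoeff L w j) ^ 2) :
    ∃ g : L2 L, HasWeakDeriv L w g ∧
      HasSum (fun j => (frequency L j * eigenCoeff L w j) ^ 2) (‖g‖ ^ 2) := by
  obtain ⟨g, hg, hg2⟩ := exists_hasSum_cosineMode hL h
  refine ⟨g, fun φ hφ _ hsupp => ?_, hg2⟩
  have hd : Continuous (deriv φ) := hφ.continuous_deriv (by exact_mod_cast le_top)
  rw [← inner_ofContinuous hd w, ← inner_ofContinuous hφ.continuous g]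
  have h1 := hasSum_inner_eigenCoeff hL (ofContinuous L (deriv φ) hd) w
  have h2 := (hg.mapL (innerSL ℝ (ofContinuous L φ hφ.continuous))).neg
  rw [innerSL_apply_apply] at h2
  refine h1.unique (h2.congr_fun fun j => ?_)
  rw [innerSL_apply_apply, inner_smul_right, cosineMode, inner_ofContinuous_ofContinuous,
    eigenCoeff_eq_inner, sineMode, real_inner_comm, inner_ofContinuous_ofContinuous,
    integral_sine_mul_deriv hL j hφ hsupp]
  ring

end SFOR

namespace SFOR
open MeasureTheory Set Filter Topology

/-! ### The modes of the continuous solution -/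

/-- The coefficient `ψ ↦ (ψ, φ_j)` as a continuous linear map into `ℂ`. -/
def coeffCLM (L : ℝ) (j : ℕ) : L2 L →L[ℝ] ℂ := Complex.ofRealCLM.comp (innerSL ℝ (sineMode L j))

theorem coeffCLM_apply {L : ℝ} (j : ℕ) (ψ : L2 L) : coeffCLM L j ψ = (eigenCoeff L ψ j : ℂ) := by
  rw [eigenCoeff_eq_inner]; rfl

/-- The coefficient of the source, divided by `t ^ (1 - 2β)`. -/
def sourceCoeff {L : ℝ} (β : ℝ) (a₁ f : L2 L) (j : ℕ) : ℝ :=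
  eigenCoeff L a₁ j / Real.Gamma (2 - 2 * β) + eigenCoeff L f j

theorem eigenCoeff_source {L β : ℝ} (a₁ f : L2 L) (t : ℝ) (j : ℕ) :
    eigenCoeff L (source (2 * β) a₁ f t) j = t ^ (1 - 2 * β) * sourceCoeff β a₁ f j := by
  rw [source, eigenCoeff_add, eigenCoeff_smul, eigenCoeff_smul, sourceCoeff, omega,
    show 2 - 2 * β - 1 = 1 - 2 * β by ring]
  ring

theorem TimeRegular.hasDerivAt {L T : ℝ} {ψ : ℝ → L2 L} (h : TimeRegular T ψ) {t : ℝ}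
    (ht : t ∈ Ioo 0 T) : HasDerivAt ψ (deriv ψ t) t :=
  ((h.contDiffOn.differentiableOn one_ne_zero).differentiableAt
    (isOpen_Ioo.mem_nhds ht)).hasDerivAt

theorem TimeRegular.continuousOn_deriv {L T : ℝ} {ψ : ℝ → L2 L} (h : TimeRegular T ψ) :
    ContinuousOn (deriv ψ) (Ioo 0 T) :=
  h.contDiffOn.continuousOn_deriv_of_isOpen isOpen_Ioo le_rfl

theorem TimeRegular.coeffCLM_caputo {L T β : ℝ} (hβ1 : β < 1) {ψ : ℝ → L2 L} (h : TimeRegular T ψ)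
    {t : ℝ} (ht : t ∈ Ioo 0 T) (j : ℕ) : coeffCLM L j (caputo β ψ t) =
      ∫ s in (0 : ℝ)..t, omega (1 - β) (t - s) • coeffCLM L j (deriv ψ s) := by
  rw [caputo, ← ContinuousLinearMap.intervalIntegral_comp_comm _
    (intervalIntegrable_omega_smul_of_continuousOn hβ1 h.continuousOn_deriv h.integrableOn ht)]
  simp only [map_smul]

theorem IsReducedSolution.mode_eq {L T β : ℝ} (hL : 0 < L) (hT : 0 < T) (hβ : 1 / 2 < β)
    (hβ1 : β < 1) {a₀ a₁ f : L2 L} {u v : ℝ → L2 L}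
    (h : IsReducedSolution (2 * β) T a₀ a₁ f u v) (j : ℕ) {t : ℝ} (ht : t ∈ Icc 0 T) :
    (eigenCoeff L (v t) j : ℂ) + Complex.I * frequency L j * eigenCoeff L (u t) j =
      Complex.I * frequency L j * eigenCoeff L a₀ j +
        modeIncrement β (frequency L j) (Complex.I * frequency L j * eigenCoeff L a₀ j)
          (sourceCoeff β a₁ f j) t := by
  set μ := frequency L j with hμ
  set ℓ := coeffCLM L j with hℓ
  have hα : 2 * β / 2 = β := by ring
  set ψ : ℝ → ℂ := fun t => ℓ (v t) + Complex.I * μ * ℓ (u t) with hψ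
  set ψ' : ℝ → ℂ := fun t => ℓ (deriv v t) + Complex.I * μ * ℓ (deriv u t) with hψ'
  have hψ0 : ψ 0 = Complex.I * μ * eigenCoeff L a₀ j := by
    simp only [hψ, h.initial_u, h.initial_v, hℓ, coeffCLM_apply, eigenCoeff_zero,
      Complex.ofReal_zero, zero_add]
  have hcont : ContinuousOn ψ (Icc 0 T) :=
    (ℓ.continuous.comp_continuousOn h.regular_v.continuousOn).add
      (continuousOn_const.mul (ℓ.continuous.comp_continuousOn h.regular_u.continuousOn))
  have hderiv : ∀ t ∈ Ioo 0 T, HasDerivAt ψ (ψ' t) t := fun t ht =>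
    (ℓ.hasFDerivAt.comp_hasDerivAt t (h.regular_v.hasDerivAt ht)).add
      ((ℓ.hasFDerivAt.comp_hasDerivAt t (h.regular_u.hasDerivAt ht)).const_mul _)
  have hcv : ContinuousOn (fun t => ℓ (deriv v t)) (Ioo 0 T) :=
    ℓ.continuous.comp_continuousOn h.regular_v.continuousOn_deriv
  have hcu : ContinuousOn (fun t => ℓ (deriv u t)) (Ioo 0 T) :=
    ℓ.continuous.comp_continuousOn h.regular_u.continuousOn_deriv
  have hiv : IntegrableOn (fun t => ℓ (deriv v t)) (Ioo 0 T) :=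
    ℓ.integrable_comp h.regular_v.integrableOn
  have hiu : IntegrableOn (fun t => ℓ (deriv u t)) (Ioo 0 T) :=
    ℓ.integrable_comp h.regular_u.integrableOn
  have heq : ∀ t ∈ Ioo 0 T, ∫ s in (0 : ℝ)..t, omega (1 - β) (t - s) • ψ' s =
      Complex.I * μ * ψ t + ((t ^ (1 - 2 * β) : ℝ) : ℂ) * (sourceCoeff β a₁ f j : ℂ) := by
    intro t ht
    have e1 : ∫ s in (0 : ℝ)..t, omega (1 - β) (t - s) • ψ' s =
        ℓ (caputo β v t) + Complex.I * μ * ℓ (caputo β u t) := by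
      rw [h.regular_v.coeffCLM_caputo hβ1 ht, h.regular_u.coeffCLM_caputo hβ1 ht,
        ← intervalIntegral.integral_const_mul, ← intervalIntegral.integral_add
          (intervalIntegrable_omega_smul_of_continuousOn hβ1 hcv hiv ht)
          ((intervalIntegrable_omega_smul_of_continuousOn hβ1 hcu hiu ht).const_mul _)]
      refine intervalIntegral.integral_congr fun s _ => ?_
      simp only [hψ', Complex.real_smul, hℓ]
      ring
    obtain ⟨w, hw, hwe⟩ := h.equation_v t ht
    have e2 := h.equation_u t ht
    rw [hα] at hwe e2
    have e3 : caputo β v t = source (2 * β) a₁ f t + w := by rw [← hwe]; abel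
    rw [e1, e3, ← e2, map_add]
    simp only [hψ, hℓ, coeffCLM_apply, eigenCoeff_source]
    rw [eigenCoeff_laplacian hL (h.boundary_u t ht).hasZeroTrace hw, ← hμ]
    push_cast
    linear_combination (μ : ℂ) ^ 2 * eigenCoeff L (u t) j * (-Complex.I_sq)
  have hres := eq_mode hβ hβ1 hT (frequency_pos hL j).le hcont hderiv (hcv.add (continuousOn_const.mul hcu))
    (hiv.add (hiu.const_mul _)) heq t ht
  rw [hψ0] at hres
  rw [← hres]
  simp only [hψ, hℓ, coeffCLM_apply]

/-! ### The modes of the discrete solution -/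

theorem coeffCLM_discreteCaputo {L : ℝ} (A : ℕ → ℕ → ℝ) (W : ℕ → L2 L) (n j : ℕ) :
    coeffCLM L j (discreteCaputo A W (n + 1)) = ∑ i ∈ Finset.range (n + 1),
      A (n + 1) (i + 1) • (coeffCLM L j (W (i + 1)) - coeffCLM L j (W i)) := by
  rw [discreteCaputo, map_sum, ← Finset.Ico_add_one_right_eq_Icc, Finset.sum_Ico_eq_sum_range]
  refine Finset.sum_congr (by simp) fun i _ => ?_
  rw [map_smul, map_sub, add_comm 1 i, Nat.add_sub_cancel]

theorem IsSchemeSolution.mode_eq {L β θ : ℝ} (hL : 0 < L) {A : ℕ → ℕ → ℝ} {t : ℕ → ℝ} {N : ℕ}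
    {a₀ a₁ f : L2 L} {U V : ℕ → L2 L} (h : IsSchemeSolution (2 * β) θ A t N a₀ a₁ f U V) (j : ℕ)
    {n : ℕ} (hn : n < N) (htr : HasZeroTrace L (offsetValue θ U (n + 1))) {Z : ℕ → ℂ}
    (hZ : ∀ n, Z n = (eigenCoeff L (V n) j : ℂ) + Complex.I * frequency L j * eigenCoeff L (U n) j) :
    ∑ i ∈ Finset.range (n + 1), A (n + 1) (i + 1) • (Z (i + 1) - Z i) =
      Complex.I * frequency L j * (θ • Z n + (1 - θ) • Z (n + 1)) +
        ((offsetTime θ t (n + 1) ^ (1 - 2 * β) : ℝ) : ℂ) * (sourceCoeff β a₁ f j : ℂ) := by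
  set μ := frequency L j with hμ
  have hsum : ∑ i ∈ Finset.range (n + 1), A (n + 1) (i + 1) • (Z (i + 1) - Z i) =
      coeffCLM L j (discreteCaputo A V (n + 1)) +
        Complex.I * μ * coeffCLM L j (discreteCaputo A U (n + 1)) := by
    rw [coeffCLM_discreteCaputo, coeffCLM_discreteCaputo, Finset.mul_sum, ← Finset.sum_add_distrib]
    refine Finset.sum_congr rfl fun i _ => ?_
    simp only [hZ, coeffCLM_apply, Complex.real_smul]
    ring
  obtain ⟨w, hw, hwe⟩ := h.equation_V (n + 1) (by omega) (by omega)
  have e2 := h.equation_U (n + 1) (by omega) (by omega)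
  have e3 : discreteCaputo A V (n + 1) = source (2 * β) a₁ f (offsetTime θ t (n + 1)) + w := by
    rw [← hwe]; abel
  rw [hsum, e3, ← e2, map_add]
  simp only [coeffCLM_apply, eigenCoeff_source, eigenCoeff_laplacian hL htr hw]
  simp only [offsetValue, Nat.add_sub_cancel, eigenCoeff_add, eigenCoeff_smul, hZ,
    Complex.real_smul, ← hμ]
  push_cast
  linear_combination (μ : ℂ) ^ 2 * (θ * eigenCoeff L (U n) j + (1 - θ) * eigenCoeff L (U (n + 1)) j) *
    (-Complex.I_sq)

/-! ### Summation over the modes -/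

/-- Modewise error bounds add up to an error bound in the energy norm. -/
theorem exists_weakDeriv_and_norm_le {L : ℝ} (hL : 0 < L) {u v : L2 L} {κ : ℕ → ℝ} {S R : ℝ}
    (hR : 0 ≤ R) (hκ : HasSum (fun j => κ j ^ 2) S)
    (h : ∀ j, ‖(eigenCoeff L v j : ℂ) + Complex.I * frequency L j * eigenCoeff L u j‖ ≤ κ j * R) :
    ∃ g : L2 L, HasWeakDeriv L u g ∧ ‖v‖ + ‖g‖ ≤ 2 * Real.sqrt S * R := by
  have hsq : ∀ j, eigenCoeff L v j ^ 2 + (frequency L j * eigenCoeff L u j) ^ 2 ≤ κ j ^ 2 * R ^ 2 := by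
    intro j
    have h1 := pow_le_pow_left₀ (norm_nonneg _) (h j) 2
    rw [Complex.sq_norm, Complex.normSq_apply, mul_pow] at h1
    simp only [Complex.add_re, Complex.add_im, Complex.mul_re, Complex.mul_im, Complex.I_re,
      Complex.I_im, Complex.ofReal_re, Complex.ofReal_im] at h1
    nlinarith
  have hκR := hκ.mul_right (R ^ 2)
  have hu : Summable fun j => (frequency L j * eigenCoeff L u j) ^ 2 :=
    Summable.of_nonneg_of_le (fun j => sq_nonneg _)
      (fun j => by nlinarith [hsq j, sq_nonneg (eigenCoeff L v j)]) hκR.summable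
  obtain ⟨g, hg, hg2⟩ := exists_hasWeakDeriv hL hu
  refine ⟨g, hg, ?_⟩
  have h1 : ‖v‖ ^ 2 + ‖g‖ ^ 2 ≤ S * R ^ 2 :=
    hasSum_le hsq ((hasSum_sq_eigenCoeff hL v).add hg2) hκR
  have hS : 0 ≤ S := hκ.nonneg fun j => sq_nonneg _
  have h2 : S * R ^ 2 = (Real.sqrt S * R) ^ 2 := by rw [mul_pow, Real.sq_sqrt hS]
  rw [h2] at h1
  have h3 : 0 ≤ Real.sqrt S * R := by positivity
  have h4 : ‖v‖ ≤ Real.sqrt S * R := abs_le_of_sq_le_sq' (by nlinarith [sq_nonneg ‖g‖]) h3 |>.2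
  have h5 : ‖g‖ ≤ Real.sqrt S * R := abs_le_of_sq_le_sq' (by nlinarith [sq_nonneg ‖v‖]) h3 |>.2
  linarith

/-! ### Weighted square summability of the data -/

theorem frequency_ge {L : ℝ} (hL : 0 < L) (j : ℕ) : Real.pi / L ≤ frequency L j := by
  have := Real.pi_pos
  rw [frequency]
  gcongr
  nlinarith [(Nat.cast_nonneg j : (0 : ℝ) ≤ j)]

theorem summable_rpow_mul_eigenCoeff {L γ p : ℝ} (hL : 0 < L) (hp : p ≤ 2 * γ) {ψ : L2 L}
    (hψ : ψ ∈ fracDomain L γ) : Summable fun j => (frequency L j ^ p * eigenCoeff L ψ j) ^ 2 := by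
  have hπ : 0 < Real.pi / L := div_pos Real.pi_pos hL
  have h : Summable fun j : ℕ => (dirichletEigenvalue L j ^ γ * eigenCoeff L ψ j) ^ 2 := hψ
  refine Summable.of_nonneg_of_le (fun j => sq_nonneg _) (fun j => ?_)
    (h.mul_left (((Real.pi / L) ^ (p - 2 * γ)) ^ 2))
  have hμ := frequency_pos hL j
  have e : frequency L j ^ p = frequency L j ^ (p - 2 * γ) * dirichletEigenvalue L j ^ γ := by
    rw [dirichletEigenvalue_eq, ← Real.rpow_natCast, ← Real.rpow_mul hμ.le, ← Real.rpow_add hμ]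
    congr 1
    push_cast; ring
  rw [e, mul_assoc, mul_pow]
  refine mul_le_mul_of_nonneg_right ?_ (sq_nonneg _)
  refine pow_le_pow_left₀ (by positivity) ?_ 2
  exact Real.rpow_le_rpow_of_nonpos hπ (frequency_ge hL j) (by linarith)

theorem summable_sq_add {x y : ℕ → ℝ} (hx : Summable fun j => x j ^ 2)
    (hy : Summable fun j => y j ^ 2) : Summable fun j => (x j + y j) ^ 2 :=
  Summable.of_nonneg_of_le (fun j => sq_nonneg _)
    (fun j => by nlinarith [sq_nonneg (x j - y j)]) ((hx.mul_left 2).add (hy.mul_left 2))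

/-- The size of the `j`-th mode of the data. -/
def dataSize {L : ℝ} (β : ℝ) (a₀ a₁ f : L2 L) (j : ℕ) : ℝ :=
  frequency L j ^ (1 / β) * |eigenCoeff L a₀ j| + |sourceCoeff β a₁ f j|

theorem summable_rpow_mul_dataSize {L β p γ δ : ℝ} (hL : 0 < L) (hγ : 1 / β + p ≤ 2 * γ)
    (hδ : p ≤ 2 * δ) {a₀ a₁ f : L2 L} (ha₀ : a₀ ∈ fracDomain L γ) (ha₁ : a₁ ∈ fracDomain L δ)
    (hf : f ∈ fracDomain L δ) :
    Summable fun j => (frequency L j ^ p * dataSize β a₀ a₁ f j) ^ 2 := by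
  have h0 := summable_rpow_mul_eigenCoeff hL hγ ha₀
  have h1 := (summable_rpow_mul_eigenCoeff hL hδ ha₁).mul_left ((Real.Gamma (2 - 2 * β))⁻¹ ^ 2)
  have h2 := summable_rpow_mul_eigenCoeff hL hδ hf
  simp_rw [← mul_pow] at h1
  have h3 := summable_sq_add h1 h2
  have h4 : Summable fun j => (|frequency L j ^ (1 / β + p) * eigenCoeff L a₀ j|) ^ 2 := by
    simpa only [sq_abs] using h0
  have h5 : Summable fun j => (|(Real.Gamma (2 - 2 * β))⁻¹ * (frequency L j ^ p * eigenCoeff L a₁ j) +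
      frequency L j ^ p * eigenCoeff L f j|) ^ 2 := by simpa only [sq_abs] using h3
  refine (summable_sq_add h4 h5).congr fun j => ?_
  have hμ := frequency_pos hL j
  have hp : 0 < frequency L j ^ p := by positivity
  congr 1
  rw [dataSize, sourceCoeff, Real.rpow_add hμ, abs_mul,
    abs_of_pos (by positivity : 0 < frequency L j ^ (1 / β) * frequency L j ^ p), mul_add,
    show (Real.Gamma (2 - 2 * β))⁻¹ * (frequency L j ^ p * eigenCoeff L a₁ j) +
      frequency L j ^ p * eigenCoeff L f j = frequency L j ^ p *
        (eigenCoeff L a₁ j / Real.Gamma (2 - 2 * β) + eigenCoeff L f j) by ring, abs_mul,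
    abs_of_pos hp]
  ring

theorem hasZeroTrace_of_mem_fracDomain {L γ : ℝ} (hL : 0 < L) (hγ : 1 / 2 ≤ γ) {ψ : L2 L}
    (hψ : ψ ∈ fracDomain L γ) : HasZeroTrace L ψ := by
  refine hasZeroTrace_of_summable hL ?_
  have h1 := summable_rpow_mul_eigenCoeff hL (p := 1) (by linarith) hψ
  have h2 : Summable fun j : ℕ => (L / Real.pi) ^ 2 * (1 / ((j : ℝ) + 1) ^ 2) := by
    have := (summable_nat_add_iff 1).2 (Real.summable_one_div_nat_pow.2 (by norm_num : 1 < 2))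
    simpa using this.mul_left ((L / Real.pi) ^ 2)
  refine Summable.of_nonneg_of_le (fun j => abs_nonneg _) (fun j => ?_) (h1.add h2)
  have hμ := frequency_pos hL j
  have hπ := Real.pi_pos
  have e : (L / Real.pi) ^ 2 * (1 / ((j : ℝ) + 1) ^ 2) = (1 / frequency L j) ^ 2 := by
    rw [frequency]; field_simp
  rw [e, Real.rpow_one]
  set x := frequency L j * eigenCoeff L ψ j with hx
  have e2 : |eigenCoeff L ψ j| = |x| * (1 / frequency L j) := by
    rw [hx, abs_mul, abs_of_pos hμ]; field_simp
  rw [e2, ← sq_abs x]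
  nlinarith [sq_nonneg (|x| - 1 / frequency L j), sq_nonneg |x|, sq_nonneg (1 / frequency L j)]

end SFOR

namespace SFOR
open MeasureTheory Set Filter Topology

/-! ### Convergence of the semi-discrete schemes -/

theorem gradedMesh_mem_Icc {T r : ℝ} (hT : 0 < T) (hr : 1 ≤ r) {N n : ℕ} (hN : 1 ≤ N)
    (hn : n ≤ N) : gradedMesh T r N n ∈ Icc 0 T := by
  have hN' : (0 : ℝ) < N := by exact_mod_cast hN
  have h1 : (n : ℝ) / N ≤ 1 := by rw [div_le_one hN']; exact_mod_cast hn
  have h2 : ((n : ℝ) / N) ^ r ≤ 1 := Real.rpow_le_one (by positivity) h1 (by linarith)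
  refine ⟨by unfold gradedMesh; positivity, ?_⟩
  rw [gradedMesh]
  nlinarith

theorem ConvergesWithRate.mono {L α T θ r : ℝ} {A : (ℕ → ℝ) → ℕ → ℕ → ℝ} {a₀ a₁ f : L2 L}
    {rate rate' : ℕ → ℝ} (h : ConvergesWithRate α T θ r A a₀ a₁ f rate)
    (hle : ∀ N, rate N ≤ rate' N) : ConvergesWithRate α T θ r A a₀ a₁ f rate' := by
  obtain ⟨C, hC, h⟩ := h
  refine ⟨C, hC, fun u v huv N hN U V hUV n hn hnN => ?_⟩
  obtain ⟨g, hg, hle'⟩ := h u v huv N hN U V hUV n hn hnN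
  exact ⟨g, hg, hle'.trans (mul_le_mul_of_nonneg_left (hle N) hC.le)⟩

/-- Convergence follows from a uniform modewise error bound. -/
theorem convergesWithRate_of_modes {L β T θ r e : ℝ} (hL : 0 < L) (hT : 0 < T) (hβ : 1 / 2 < β)
    (hβ1 : β < 1) (hr : 1 ≤ r) {A : (ℕ → ℝ) → ℕ → ℕ → ℝ} {a₀ a₁ f : L2 L}
    (htrace : ∀ N U V, IsSchemeSolution (2 * β) θ (A (gradedMesh T r N)) (gradedMesh T r N) N
      a₀ a₁ f U V → ∀ n < N, HasZeroTrace L (offsetValue θ U (n + 1)))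
    {κ : ℕ → ℝ} (hκ : Summable fun j => κ j ^ 2)
    (hmode : ∀ (j N : ℕ) (Z : ℕ → ℂ), 1 ≤ N → Z 0 = Complex.I * frequency L j * eigenCoeff L a₀ j →
      (∀ n < N, ∑ i ∈ Finset.range (n + 1),
          A (gradedMesh T r N) (n + 1) (i + 1) • (Z (i + 1) - Z i) =
        Complex.I * frequency L j * (θ • Z n + (1 - θ) • Z (n + 1)) +
          ((offsetTime θ (gradedMesh T r N) (n + 1) ^ (1 - 2 * β) : ℝ) : ℂ) *
            (sourceCoeff β a₁ f j : ℂ)) →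
      ∀ n, 1 ≤ n → n ≤ N → ‖Complex.I * frequency L j * eigenCoeff L a₀ j +
        modeIncrement β (frequency L j) (Complex.I * frequency L j * eigenCoeff L a₀ j)
          (sourceCoeff β a₁ f j) (gradedMesh T r N n) - Z n‖ ≤ κ j * (N : ℝ) ^ e) :
    ConvergesWithRate (2 * β) T θ r A a₀ a₁ f fun N => (N : ℝ) ^ e := by
  obtain ⟨S, hS⟩ := hκ
  refine ⟨2 * Real.sqrt S + 1, by positivity, fun u v huv N hN U V hUV n hn hnN => ?_⟩
  have hN0 : (0 : ℝ) ≤ (N : ℝ) ^ e := by positivity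
  have hmodes : ∀ j, ‖(eigenCoeff L (v (gradedMesh T r N n) - V n) j : ℂ) +
      Complex.I * frequency L j * eigenCoeff L (u (gradedMesh T r N n) - U n) j‖ ≤
      κ j * (N : ℝ) ^ e := by
    intro j
    set Z : ℕ → ℂ := fun n =>
      (eigenCoeff L (V n) j : ℂ) + Complex.I * frequency L j * eigenCoeff L (U n) j with hZ
    have hZ0 : Z 0 = Complex.I * frequency L j * eigenCoeff L a₀ j := by
      simp only [hZ, hUV.initial_U, hUV.initial_V, eigenCoeff_zero, Complex.ofReal_zero, zero_add]
    have h := hmode j N Z hN hZ0 (fun m hm =>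
      hUV.mode_eq hL j hm (htrace N U V hUV m hm) fun _ => rfl) n hn hnN
    rw [← huv.mode_eq hL hT hβ hβ1 j (gradedMesh_mem_Icc hT hr hN hnN)] at h
    refine le_trans (le_of_eq ?_) h
    congr 1
    simp only [hZ, eigenCoeff_sub]
    push_cast
    ring
  obtain ⟨g, hg, hle⟩ := exists_weakDeriv_and_norm_le hL hN0 hS hmodes
  exact ⟨g, hg, hle.trans (mul_le_mul_of_nonneg_right (by linarith) hN0)⟩

theorem mode_size {L β : ℝ} (hL : 0 < L) {a₀ a₁ f : L2 L} (j : ℕ) :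
    frequency L j ^ (1 / β - 1) * ‖Complex.I * (frequency L j : ℂ) * (eigenCoeff L a₀ j : ℂ)‖ +
      ‖(sourceCoeff β a₁ f j : ℂ)‖ = dataSize β a₀ a₁ f j := by
  have hμ := frequency_pos hL j
  rw [norm_mul, norm_mul, Complex.norm_I, one_mul, Complex.norm_real, Complex.norm_real,
    Complex.norm_real, Real.norm_of_nonneg hμ.le, Real.norm_eq_abs, Real.norm_eq_abs, dataSize,
    Real.rpow_sub_one hμ.ne']
  field_simp

/-- Convergence of the `L1` scheme. -/
theorem convergesWithRateL1 {L β T r : ℝ} (hL : 0 < L) (hT : 0 < T) (hβ : 1 / 2 < β) (hβ1 : β < 1)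
    (hr : 1 ≤ r) {a₀ a₁ f : L2 L} (hdata : AssumptionB1 (2 * β) L a₀ a₁ f) :
    ConvergesWithRate (2 * β) T 0 r (kernelL1 β) a₀ a₁ f
      fun N => (N : ℝ) ^ (-min (r * (1 - β)) (2 - β)) := by
  have hβ0 : 0 < β := by linarith
  obtain ⟨γ₁, hγ₁, γ₂, hγ₂, ε, hε, h₀, h₁, h₂⟩ := hdata
  obtain ⟨C, hC, hscalar⟩ := scalar_convergenceL1 hβ0 hβ1 (sub_pos.2 hβ1) (by linarith : 1 - β ≤ 1)
    hT hr
  obtain ⟨C', hC', hreg⟩ := exists_powerRegular_mode hβ hβ1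
  have hb : 1 / β = 2 * (1 / (2 * β)) := by field_simp
  have hsum := summable_rpow_mul_dataSize (β := β) (p := 0) hL (by linarith [hγ₁.1])
    (by linarith [hγ₂.1]) h₀ h₁ h₂
  refine convergesWithRate_of_modes hL hT hβ hβ1 hr (κ := fun j => C * C' * dataSize β a₀ a₁ f j)
    ?_ ?_ ?_
  · intro N U V hUV n hn
    rw [offsetValue, zero_smul, zero_add, sub_zero, one_smul]
    exact (hUV.boundary_U (n + 1) (by omega) (by omega)).hasZeroTrace
  · refine (hsum.mul_left ((C * C') ^ 2)).congr fun j => ?_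
    rw [Real.rpow_zero, one_mul, ← mul_pow]
  · intro j N Z hN hZ0 hZ n hn hnN
    obtain ⟨z₁, z₂, z₃, hz⟩ := hreg (frequency L j)
      (Complex.I * frequency L j * eigenCoeff L a₀ j) (sourceCoeff β a₁ f j) (frequency_pos hL j).le
    have h := hscalar _ (frequency L j) _ z₁ z₂ z₃
      (fun s => ((s ^ (1 - 2 * β) : ℝ) : ℂ) * (sourceCoeff β a₁ f j : ℂ)) N Z hz hN
      (fun s hs => caputo_mode hβ0 hβ1 hz.deriv₁ hs.1)
      (by simp [hZ0, modeIncrement_zero hβ0 hβ1])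
      (fun m hm => by
        have h0 := hZ m hm
        rwa [zero_smul, zero_add, sub_zero, one_smul, offsetTime, zero_mul, zero_add, sub_zero,
          one_mul] at h0) n hn hnN
    rw [mode_size hL, ← mul_assoc] at h
    exact h

/-- Convergence of the `L2-1_σ` scheme. -/
theorem convergesWithRateAlikhanov {L β T r : ℝ} (hL : 0 < L) (hT : 0 < T) (hβ : 1 / 2 < β)
    (hβ1 : β < 1) (hr : 1 ≤ r) {a₀ a₁ f : L2 L} (hdata : AssumptionB2 (2 * β) L a₀ a₁ f) :
    ConvergesWithRate (2 * β) T (β / 2) r (kernelAlikhanov β (β / 2)) a₀ a₁ f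
      fun N => (N : ℝ) ^ (-min (r * (1 - β)) 2) := by
  have hβ0 : 0 < β := by linarith
  obtain ⟨γ₁, hγ₁, γ₂, hγ₂, ε, hε, h₀, h₁, h₂⟩ := hdata
  obtain ⟨C, hC, hscalar⟩ := scalar_convergenceAlikhanov hβ0 hβ1 (sub_pos.2 hβ1)
    (by linarith : 1 - β ≤ 1) hT hr
  obtain ⟨C', hC', hreg⟩ := exists_powerRegular_mode hβ hβ1
  have hb : 1 / β = 2 * (1 / (2 * β)) := by field_simp
  have hb0 : 0 < 1 / (2 * β) := by positivity
  have hsum0 := summable_rpow_mul_dataSize (β := β) (p := 0) hL (by linarith [hγ₁.1])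
    (by linarith [hγ₂.1]) h₀ h₁ h₂
  have hsum1 := summable_rpow_mul_dataSize (β := β) (p := 1) hL (by linarith [hγ₁.1])
    (by linarith [hγ₂.1]) h₀ h₁ h₂
  have ha₀ : HasZeroTrace L a₀ := hasZeroTrace_of_mem_fracDomain hL (by linarith [hγ₁.1]) h₀
  refine convergesWithRate_of_modes hL hT hβ hβ1 hr
    (κ := fun j => C * C' * ((1 + frequency L j) * dataSize β a₀ a₁ f j)) ?_ ?_ ?_
  · intro N U V hUV n hn
    have h1 := (hUV.boundary_U (n + 1) (by omega) (by omega)).hasZeroTrace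
    have h2 : HasZeroTrace L (U n) := by
      rcases n with _ | n
      · rw [hUV.initial_U]; exact ha₀
      · exact (hUV.boundary_U (n + 1) (by omega) (by omega)).hasZeroTrace
    exact (h2.smul _).add (h1.smul _)
  · refine ((summable_sq_add hsum0 hsum1).mul_left ((C * C') ^ 2)).congr fun j => ?_
    rw [Real.rpow_zero, Real.rpow_one, ← mul_pow]
    ring
  · intro j N Z hN hZ0 hZ n hn hnN
    obtain ⟨z₁, z₂, z₃, hz⟩ := hreg (frequency L j)
      (Complex.I * frequency L j * eigenCoeff L a₀ j) (sourceCoeff β a₁ f j) (frequency_pos hL j).le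
    have h := hscalar _ (frequency L j) _ z₁ z₂ z₃
      (fun s => ((s ^ (1 - 2 * β) : ℝ) : ℂ) * (sourceCoeff β a₁ f j : ℂ)) N Z hz hN
      (frequency_pos hL j).le (fun s hs => caputo_mode hβ0 hβ1 hz.deriv₁ hs.1)
      (by simp [hZ0, modeIncrement_zero hβ0 hβ1]) hZ n hn hnN
    rw [mode_size hL] at h
    refine h.trans_eq ?_
    ring

/-! ### The optimal mesh grading -/

theorem isLeast_grading {β e : ℝ} (hβ0 : 0 < β) (hβ1 : β < 1) (he : 1 - β ≤ e) :
    IsLeast {r : ℝ | 1 ≤ r ∧ min (r * (1 - β)) e = e ∧ min (r * (1 - β / 2)) e = e}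
      (e / (1 - β)) := by
  have h1 : 0 < 1 - β := sub_pos.2 hβ1
  refine ⟨⟨(one_le_div h1).2 he, ?_, ?_⟩, fun r hr => ?_⟩
  · rw [div_mul_cancel₀ _ h1.ne', min_self]
  · refine min_eq_right ?_
    calc e = e / (1 - β) * (1 - β) := (div_mul_cancel₀ _ h1.ne').symm
      _ ≤ _ := mul_le_mul_of_nonneg_left (by linarith) (div_nonneg (h1.le.trans he) h1.le)
  · rw [div_le_iff₀ h1]
    exact min_eq_right_iff.1 hr.2.1

end SFOR

end

theorem theorem4p6 (α β T L : ℝ) (hα₁ : 1 < α) (hα₂ : α < 2) (hβ : β = α / 2)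
    (hT : 0 < T) (hL : 0 < L) (a₀ a₁ f : SFOR.L2 L) :
    -- the `L1` scheme, `θ = 0`
    (SFOR.AssumptionB1 α L a₀ a₁ f →
      (∀ r : ℝ, 1 ≤ r →
        SFOR.ConvergesWithRate α T 0 r (SFOR.kernelL1 β) a₀ a₁ f
          (fun N => (N : ℝ) ^ (-min (r * (1 - β)) (2 - β))
            + (N : ℝ) ^ (-min (r * (1 - β / 2)) (2 - β)))) ∧
      SFOR.ConvergesWithRate α T 0 ((4 - α) / (2 - α)) (SFOR.kernelL1 β) a₀ a₁ f
        (fun N => (N : ℝ) ^ (-(2 - β))) ∧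
      IsLeast {r : ℝ | 1 ≤ r ∧ min (r * (1 - β)) (2 - β) = 2 - β ∧
        min (r * (1 - β / 2)) (2 - β) = 2 - β} ((4 - α) / (2 - α))) ∧
    -- the `L2-1_σ` scheme, `θ = β / 2`
    (SFOR.AssumptionB2 α L a₀ a₁ f →
      (∀ r : ℝ, 1 ≤ r →
        SFOR.ConvergesWithRate α T (β / 2) r (SFOR.kernelAlikhanov β (β / 2)) a₀ a₁ f
          (fun N => (N : ℝ) ^ (-min (r * (1 - β)) 2)
            + (N : ℝ) ^ (-min (r * (1 - β / 2)) 2))) ∧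
      SFOR.ConvergesWithRate α T (β / 2) (4 / (2 - α)) (SFOR.kernelAlikhanov β (β / 2)) a₀ a₁ f
        (fun N => (N : ℝ) ^ (-(2 : ℝ))) ∧
      IsLeast {r : ℝ | 1 ≤ r ∧ min (r * (1 - β)) 2 = 2 ∧ min (r * (1 - β / 2)) 2 = 2}
        (4 / (2 - α))) := by
  obtain rfl : α = 2 * β := by linarith
  have hβ1 : β < 1 := by linarith
  have hβ2 : 1 / 2 < β := by linarith
  have hβ0 : 0 < β := by linarith
  have h1 : 0 < 1 - β := by linarith
  have e1 : (4 - 2 * β) / (2 - 2 * β) = (2 - β) / (1 - β) := by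
    rw [show 4 - 2 * β = 2 * (2 - β) by ring, show 2 - 2 * β = 2 * (1 - β) by ring,
      mul_div_mul_left _ _ two_ne_zero]
  have e2 : 4 / (2 - 2 * β) = 2 / (1 - β) := by
    rw [show (4 : ℝ) = 2 * 2 by norm_num, show 2 - 2 * β = 2 * (1 - β) by ring,
      mul_div_mul_left _ _ two_ne_zero]
  rw [e1, e2]
  refine ⟨fun hB => ⟨fun r hr => ?_, ?_, SFOR.isLeast_grading hβ0 hβ1 (by linarith)⟩,
    fun hB => ⟨fun r hr => ?_, ?_, SFOR.isLeast_grading hβ0 hβ1 (by linarith)⟩⟩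
  · exact (SFOR.convergesWithRateL1 hL hT hβ2 hβ1 hr hB).mono fun N =>
      le_add_of_nonneg_right (by positivity)
  · have h := SFOR.convergesWithRateL1 (r := (2 - β) / (1 - β)) hL hT hβ2 hβ1
      ((one_le_div h1).2 (by linarith)) hB
    rwa [div_mul_cancel₀ _ h1.ne', min_self] at h
  · exact (SFOR.convergesWithRateAlikhanov hL hT hβ2 hβ1 hr hB).mono fun N =>
      le_add_of_nonneg_right (by positivity)
  · have h := SFOR.convergesWithRateAlikhanov (r := 2 / (1 - β)) hL hT hβ2 hβ1
      ((one_le_div h1).2 (by linarith)) hB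
    rwa [div_mul_cancel₀ _ h1.ne', min_self] at h
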